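/- **Setting.** Let $d\in\{2,3\}$, $Y=(0,1]^d$, $Y^\star=(-\pi,\pi]^d$, and let $D$ be an open set with $C^{1,\theta}$ boundary (for some $0<\theta\le1$) and $\overline D\subset(0,1)^d$. Consider three problems, each with an $L^2$ space $X$ (inner product $(u,v)=\int_Y u\bar v$), a Hilbert space $\mathcal H\subset X$ with inner product $\langle u,v\rangle=\int_Y\nabla u\cdot\nabla\bar v$, and a constant $\Lambda$: 1. $\alpha\in Y^\star$, $\alpha\neq0$: $X$ = $\alpha$-quasi-periodic functions in $L^2_{loc}(\mathbb R^d)$, $\mathcal H$ = $\alpha$-quasi-periodic functions in $H^1_{loc}(\mathbb R^d)$, $\Lambda=|\alpha|^2$; 2. $\alpha=0$: $X$ = periodic $L^2$ functions with zero average over $Y$, $\mathcal H$ = periodic $H^1_{loc}$ functions with zero average, $\Lambda=4\pi^2$; 3. Neumann problem: $X$ = functions in $L^2(Y)$ with zero average, $\mathcal H$ = functions in $H^1(Y)$ with zero average, $\Lambda=\pi^2$. Let $(-\Delta)^{-1}:X\to\mathcal H$ be given by $\langle(-\Delta)^{-1}f,v\rangle=(f,v)$ for all $v\in\mathcal H$.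 Let $W_1\subset\mathcal H$ be the closure of the functions with support away from $D$; let $W_2\subset\mathcal H$ be the space of functions in $H^1_0(D)$ extended by zero (minus their average over $Y$ in problems 2 and 3); let $W_3=(W_1\oplus W_2)^\perp$. A real $\mu$ is a *resonance eigenvalue* if there is $0\ne u\in W_3$ with $$\tfrac12\int_{Y\setminus D}\nabla u\cdot\nabla\bar v-\tfrac12\int_D\nabla u\cdot\nabla\bar v=\mu\langle u,v\rangle\quad\text{for all }v\in W_3 ;$$ let $P_\mu$ be the $\langle\cdot,\cdot\rangle$-orthogonal projection onto the space of all such $u$. Let $P_1$ be the sum of the orthogonal projection onto $W_1$ and $P_{1/2}$, and let $P_2$ be the orthogonal projection onto $W_2$. With sums over the resonance eigenvalues $\mu\in(-\frac12,\frac12)$, converging strongly, put $$K(z)=P_1+\sum_\mu[(\tfrac12+\mu)+z(\tfrac12-\mu)]^{-1}P_\mu,\qquad A(z)=(P_2+zK(z))(-\Delta)^{-1}:X\to X .$$ Set $R(\zeta,0)=(A(0)-\zeta)^{-1}$ and $\mathcal N(\zeta,z)=K(z)(-\Delta)^{-1}R(\zeta,0)$. Let $\beta_0\in\sigma(A(0))$,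 let $\Gamma$ be a closed piecewise $C^1$ contour with winding number $1$ about $\beta_0$ and $0$ about every other point of $\sigma(A(0))$, and let $\hat d=\inf_{\zeta\in\Gamma}\mathrm{dist}(\zeta,\sigma(A(0)))$. Let $-\frac12<\mu^*<\frac12$ be a lower bound for all the resonance eigenvalues of the problem, and set $$z^*=\frac{\mu^*+1/2}{\mu^*-1/2},\qquad r^*=\frac{\Lambda\hat d|z^*|}{\frac1{1/2-\mu^*}+\Lambda\hat d}.$$ **Theorem.** In each of the three problems the following holds. Let $z\in\mathbb R$ with $|z|<r^*$, let $\beta_i(z)$ be any eigenvalue of $A(z)$ inside $\Gamma$ (that is, about which $\Gamma$ has nonzero winding number), let $\varphi_i(z)\in X$ be any corresponding eigenfunction of unit $L^2$ norm, and put $\beta_i^0(z)=\beta_0$ and, for $n\ge1$, $$\beta_i^n(z)=-\frac1{2\pi i}\Big(\oint_\Gamma(\zeta-\beta_0)R(\zeta,0)(-\mathcal N(\zeta,z))^n\,d\zeta\;\varphi_i(z),\varphi_i(z)\Big).$$ Then for every integer $p\ge0$ $$\Big|\beta_i(z)-\sum_{n=0}^p z^n\beta_i^n(z)\Big|\le\frac{\hat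 d\,|z|^{p+1}}{(r^*)^p\,(r^*-|z|)} .$$ In particular the bound is uniform over the eigenvalue group inside $\Gamma$. -/

import Mathlib

open scoped ContDiff InnerProductSpace
open MeasureTheory Set

noncomputable section

namespace HighContrast

/-! ### The period cell and the Lebesgue spaces over it -/

/-- The physical space `ℝ^d` with its Euclidean norm. -/
abbrev Space (d : ℕ) := EuclideanSpace ℝ (Fin d)

/-- Vectors of `ℂ^d`, the values of gradients. -/
abbrev CVec (d : ℕ) := EuclideanSpace ℂ (Fin d)

/-- The unit period cell `Y = (0,1]^d`. -/
def cell (d : ℕ) : Set (Space d) := {x | ∀ i, x i ∈ Ioc (0 : ℝ) 1}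

/-- The open cube `(0,1)^d`, the interior of the period cell. -/
def openCell (d : ℕ) : Set (Space d) := {x | ∀ i, x i ∈ Ioo (0 : ℝ) 1}

/-- The first Brillouin zone `Y* = (-π,π]^d`. -/
def brillouinZone (d : ℕ) : Set (Space d) := {α | ∀ i, α i ∈ Ioc (-Real.pi) Real.pi}

/-- Lebesgue measure on the period cell. -/
abbrev cellMeasure (d : ℕ) : Measure (Space d) := volume.restrict (cell d)

lemma volume_cell_lt_top (d : ℕ) : volume (cell d) < ⊤ := by
  have hb : Bornology.IsBounded (cell d) := by
    refine (Metric.isBounded_iff_subset_closedBall 0).2 ⟨Real.sqrt d, fun x hx => ?_⟩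
    rw [mem_closedBall_zero_iff, EuclideanSpace.norm_eq]
    apply Real.sqrt_le_sqrt
    calc ∑ i, ‖x i‖ ^ 2 ≤ ∑ _i : Fin d, (1 : ℝ) := by
          refine Finset.sum_le_sum fun i _ => ?_
          have h := hx i
          rw [Real.norm_eq_abs, sq_abs]
          nlinarith [h.1, h.2]
      _ = d := by simp
  exact hb.measure_lt_top

instance instIsFiniteMeasureCell (d : ℕ) : IsFiniteMeasure (cellMeasure d) :=
  ⟨by simpa using volume_cell_lt_top d⟩

/-- Square integrable complex functions on the cell, with `(u,v) = ∫_Y u v̄`. -/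
abbrev L2 (d : ℕ) := Lp ℂ 2 (cellMeasure d)

/-- Square integrable `ℂ^d`-valued fields on the cell. -/
abbrev L2Field (d : ℕ) := Lp (CVec d) 2 (cellMeasure d)

/-- The functions of `L²(Y)` with zero average, i.e. those orthogonal to the constant `1`. -/
def zeroMean (d : ℕ) : Submodule ℂ (L2 d) := (ℂ ∙ (Lp.const 2 (cellMeasure d) (1 : ℂ)))ᗮ

instance instCompleteZeroMean (d : ℕ) : CompleteSpace (zeroMean d) := by
  unfold zeroMean; infer_instance

instance instCompleteTop (d : ℕ) : CompleteSpace (⊤ : Submodule ℂ (L2 d)) :=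
  (show IsClosed ((⊤ : Submodule ℂ (L2 d)) : Set (L2 d)) by simp).completeSpace_coe

/-! ### Weak gradients and first order Sobolev spaces -/

/-- The classical gradient of a complex valued function. -/
def grad {d : ℕ} (φ : Space d → ℂ) (x : Space d) : CVec d :=
  WithLp.toLp 2 fun i => fderiv ℝ φ x (EuclideanSpace.single i 1)

/-- `φ` is a smooth function with compact support in `U`. -/
def IsTest {d : ℕ} (U : Set (Space d)) (φ : Space d → ℂ) : Prop :=
  ContDiff ℝ ∞ φ ∧ HasCompactSupport φ ∧ tsupport φ ⊆ U

/-- `g` is the weak gradient of `u` on the open set `U`. -/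
def IsWeakGrad {d : ℕ} (U : Set (Space d)) (u : Space d → ℂ) (g : Space d → CVec d) : Prop :=
  ∀ φ, IsTest U φ → ∀ i, ∫ x in U, u x * grad φ x i = -∫ x in U, g x i * φ x

/-- The lattice vector `m ∈ ℤ^d` with `x - m ∈ (0,1]^d`. -/
def latticePart {d : ℕ} (x : Space d) : Space d :=
  WithLp.toLp 2 fun i => ((⌈x i⌉ - 1 : ℤ) : ℝ)

/-- The `α` quasi-periodic extension to `ℝ^d` of a function on the cell: it satisfies
`h (x + p) = h x * exp (i α ⬝ p)` for `p ∈ ℤ^d`, and agrees with the given function on the cell. -/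
def qpExt {d : ℕ} {F : Type*} [SMul ℂ F] (α : Space d) (f : Space d → F) (x : Space d) : F :=
  Complex.exp (Complex.I * ((∑ i, α i * latticePart x i : ℝ) : ℂ)) • f (x - latticePart x)

lemma measurableSet_cell (d : ℕ) : MeasurableSet (cell d) := by
  have h : cell d = ⋂ i, (fun x : Space d => x i) ⁻¹' Ioc (0 : ℝ) 1 := by
    ext x; simp [cell]
  rw [h]
  exact MeasurableSet.iInter fun i =>
    (EuclideanSpace.proj (𝕜 := ℝ) i).continuous.measurable measurableSet_Ioc

lemma sub_latticePart_mem_cell {d : ℕ} (x : Space d) : x - latticePart x ∈ cell d := by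
  intro i
  have h1 := Int.ceil_lt_add_one (x i)
  have h2 := Int.le_ceil (x i)
  simp only [latticePart, PiLp.sub_apply, Int.cast_sub, Int.cast_one, mem_Ioc]
  constructor <;> linarith

lemma latticePart_eq {d : ℕ} {x : Space d} {m : Fin d → ℤ}
    (h : x - WithLp.toLp 2 (fun i => (m i : ℝ)) ∈ cell d) :
    latticePart x = WithLp.toLp 2 (fun i => (m i : ℝ)) := by
  ext i
  have hi := h i
  simp only [PiLp.sub_apply, mem_Ioc] at hi
  have hc : ⌈x i⌉ = m i + 1 := by
    rw [Int.ceil_eq_iff]; push_cast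
    constructor <;> linarith
  simp [latticePart, hc]

lemma qpExt_congr {d : ℕ} {F : Type*} [SMul ℂ F] (α : Space d) {f g : Space d → F}
    (h : f =ᵐ[cellMeasure d] g) : qpExt α f =ᵐ[volume] qpExt α g := by
  have h0 : ∀ᵐ x ∂(volume : Measure (Space d)), x ∈ cell d → f x = g x :=
    (ae_restrict_iff' (measurableSet_cell d)).1 h
  have h1 : ∀ᵐ x ∂(volume : Measure (Space d)), ∀ m : Fin d → ℤ,
      x - WithLp.toLp 2 (fun i => (m i : ℝ)) ∈ cell d →
        f (x - WithLp.toLp 2 (fun i => (m i : ℝ))) = g (x - WithLp.toLp 2 (fun i => (m i : ℝ))) :=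
    ae_all_iff.2 fun m =>
      (measurePreserving_sub_right volume (WithLp.toLp 2 (fun i => (m i : ℝ)))).quasiMeasurePreserving.ae h0
  filter_upwards [h1] with x hx
  have := hx (fun i => ⌈x i⌉ - 1) (sub_latticePart_mem_cell x)
  simp only [qpExt]
  exact congrArg _ this

lemma qpExt_locallyIntegrable {d : ℕ} {F : Type*} [NormedAddCommGroup F] [NormedSpace ℂ F]
    (α : Space d) {f : Space d → F} (hf : Integrable f (cellMeasure d)) :
    LocallyIntegrable (qpExt α f) := by
  intro x
  refine ⟨Metric.ball x 1, Metric.ball_mem_nhds x one_pos, ?_⟩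
  let s : Finset (Fin d → ℤ) := Fintype.piFinset fun i => Finset.Icc (⌊x i⌋ - 3) (⌊x i⌋ + 3)
  let S : (Fin d → ℤ) → Set (Space d) := fun m =>
    (fun y => y - WithLp.toLp 2 (fun i => (m i : ℝ))) ⁻¹' cell d
  have hsub : Metric.ball x 1 ⊆ ⋃ m ∈ s, S m := by
    intro y hy
    refine mem_iUnion₂.2 ⟨fun i => ⌈y i⌉ - 1, ?_, sub_latticePart_mem_cell y⟩
    rw [Fintype.mem_piFinset]
    intro i
    have hn : |y i - x i| < 1 := by
      have h1 := PiLp.norm_apply_le (y - x) i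
      have h2 : ‖y - x‖ < 1 := by rwa [mem_ball_iff_norm] at hy
      simpa using h1.trans_lt h2
    rw [abs_lt] at hn
    have a1 := Int.floor_le (x i)
    have a2 := Int.lt_floor_add_one (x i)
    have b1 := Int.le_ceil (y i)
    have b2 := Int.ceil_lt_add_one (y i)
    rw [Finset.mem_Icc]
    constructor
    · have : ((⌊x i⌋ - 3 : ℤ) : ℝ) ≤ ((⌈y i⌉ - 1 : ℤ) : ℝ) := by push_cast; linarith
      exact_mod_cast this
    · have : ((⌈y i⌉ - 1 : ℤ) : ℝ) ≤ ((⌊x i⌋ + 3 : ℤ) : ℝ) := by push_cast; linarith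
      exact_mod_cast this
  refine IntegrableOn.mono_set ?_ hsub
  rw [integrableOn_finset_iUnion]
  intro m _
  have hS : MeasurableSet (S m) := measurable_id.sub_const _ (measurableSet_cell d)
  have hint : IntegrableOn (fun y => f (y - WithLp.toLp 2 (fun i => (m i : ℝ)))) (S m) :=
    ((measurePreserving_sub_right volume
      (WithLp.toLp 2 (fun i => (m i : ℝ)))).integrableOn_comp_preimage
        (measurableEmbedding_subRight _)).2 hf
  refine IntegrableOn.congr_fun (hint.smul (Complex.exp (Complex.I *
    ((∑ i, α i * (m i : ℝ) : ℝ) : ℂ)))) ?_ hS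
  intro y hy
  simp only [qpExt, latticePart_eq (show y - WithLp.toLp 2 (fun i => (m i : ℝ)) ∈ cell d from hy),
    Pi.smul_apply]

lemma IsTest.continuous_grad {d : ℕ} {U : Set (Space d)} {φ : Space d → ℂ} (h : IsTest U φ)
    (i : Fin d) : Continuous fun x => grad φ x i :=
  (h.1.continuous_fderiv (by simp)).clm_apply continuous_const

lemma IsTest.hasCompactSupport_grad {d : ℕ} {U : Set (Space d)} {φ : Space d → ℂ}
    (h : IsTest U φ) (i : Fin d) : HasCompactSupport fun x => grad φ x i :=
  h.2.1.fderiv_apply (𝕜 := ℝ) (EuclideanSpace.single i 1)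

lemma isWeakGrad_congr {d : ℕ} {U : Set (Space d)} {u u' : Space d → ℂ} {g g' : Space d → CVec d}
    (hu : u =ᵐ[volume.restrict U] u') (hg : g =ᵐ[volume.restrict U] g') (h : IsWeakGrad U u g) :
    IsWeakGrad U u' g' := by
  intro φ hφ i
  have h1 : ∫ x in U, u x * grad φ x i = ∫ x in U, u' x * grad φ x i :=
    integral_congr_ae (hu.mono fun x hx => by simp only [hx])
  have h2 : ∫ x in U, g x i * φ x = ∫ x in U, g' x i * φ x :=
    integral_congr_ae (hg.mono fun x hx => by simp only [hx])
  rw [← h1, ← h2]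
  exact h φ hφ i

lemma isWeakGrad_add {d : ℕ} {U : Set (Space d)} {u u' : Space d → ℂ} {g g' : Space d → CVec d}
    (hu : LocallyIntegrable u (volume.restrict U)) (hu' : LocallyIntegrable u' (volume.restrict U))
    (hg : LocallyIntegrable g (volume.restrict U)) (hg' : LocallyIntegrable g' (volume.restrict U))
    (h : IsWeakGrad U u g) (h' : IsWeakGrad U u' g') : IsWeakGrad U (u + u') (g + g') := by
  intro φ hφ i
  have comp : ∀ {v : Space d → CVec d}, LocallyIntegrable v (volume.restrict U) →
      Integrable (fun x => v x i * φ x) (volume.restrict U) := by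
    intro v hv
    have h1 := hv.integrable_smul_left_of_hasCompactSupport hφ.1.continuous hφ.2.1
    refine ((EuclideanSpace.proj (𝕜 := ℂ) i).integrable_comp h1).congr (ae_of_all _ fun x => ?_)
    simp [mul_comm]
  have int : ∀ {v : Space d → ℂ}, LocallyIntegrable v (volume.restrict U) →
      Integrable (fun x => v x * grad φ x i) (volume.restrict U) := fun hv =>
    hv.integrable_smul_right_of_hasCompactSupport (hφ.continuous_grad i)
      (hφ.hasCompactSupport_grad i)
  simp only [Pi.add_apply, PiLp.add_apply, add_mul]
  rw [integral_add (int hu) (int hu'), integral_add (comp hg) (comp hg'), h φ hφ i, h' φ hφ i,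
    neg_add]

lemma isWeakGrad_smul {d : ℕ} {U : Set (Space d)} {u : Space d → ℂ} {g : Space d → CVec d}
    (c : ℂ) (h : IsWeakGrad U u g) : IsWeakGrad U (c • u) (c • g) := by
  intro φ hφ i
  simp only [Pi.smul_apply, PiLp.smul_apply, smul_eq_mul, mul_assoc]
  rw [integral_const_mul, integral_const_mul, h φ hφ i, mul_neg]

lemma isWeakGrad_zero {d : ℕ} (U : Set (Space d)) :
    IsWeakGrad U (0 : Space d → ℂ) (0 : Space d → CVec d) := by
  intro φ _ i; simp

lemma qpExt_add {d : ℕ} {F : Type*} [NormedAddCommGroup F] [NormedSpace ℂ F] (α : Space d)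
    (f g : Space d → F) : qpExt α (f + g) = qpExt α f + qpExt α g := by
  ext1 x; simp [qpExt]

lemma qpExt_smul {d : ℕ} {F : Type*} [NormedAddCommGroup F] [NormedSpace ℂ F] (α : Space d)
    (c : ℂ) (f : Space d → F) : qpExt α (c • f) = c • qpExt α f := by
  ext1 x; simp only [qpExt, Pi.smul_apply]; exact smul_comm _ _ _

lemma qpExt_zero {d : ℕ} {F : Type*} [NormedAddCommGroup F] [NormedSpace ℂ F] (α : Space d) :
    qpExt α (0 : Space d → F) = 0 := by
  ext1 x; simp [qpExt]

lemma integrable_coe {d : ℕ} {F : Type*} [NormedAddCommGroup F] (f : Lp F 2 (cellMeasure d)) :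
    Integrable f (cellMeasure d) :=
  (Lp.memLp f).integrable (by norm_num)

/-- The pairs `(u, ∇u)` with `u` an `α` quasi-periodic function in `H¹_loc(ℝ^d)`; the function and
its gradient are recorded through their restrictions to the cell. -/
def blochH1 {d : ℕ} (α : Space d) : Submodule ℂ (L2 d × L2Field d) where
  carrier := {p | IsWeakGrad univ (qpExt α p.1) (qpExt α p.2)}
  zero_mem' := by
    refine isWeakGrad_congr ?_ ?_ (isWeakGrad_zero univ) <;> rw [Measure.restrict_univ]
    · exact ((qpExt_congr α (Lp.coeFn_zero ℂ 2 (cellMeasure d))).trans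
        (by rw [qpExt_zero])).symm
    · exact ((qpExt_congr α (Lp.coeFn_zero (CVec d) 2 (cellMeasure d))).trans
        (by rw [qpExt_zero])).symm
  add_mem' := by
    intro p q hp hq
    have h := isWeakGrad_add (by simpa using qpExt_locallyIntegrable α (integrable_coe p.1))
      (by simpa using qpExt_locallyIntegrable α (integrable_coe q.1))
      (by simpa using qpExt_locallyIntegrable α (integrable_coe p.2))
      (by simpa using qpExt_locallyIntegrable α (integrable_coe q.2)) hp hq
    refine isWeakGrad_congr ?_ ?_ h <;> rw [Measure.restrict_univ, ← qpExt_add]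
    · exact (qpExt_congr α (Lp.coeFn_add p.1 q.1)).symm
    · exact (qpExt_congr α (Lp.coeFn_add p.2 q.2)).symm
  smul_mem' := by
    intro c p hp
    refine isWeakGrad_congr ?_ ?_ (isWeakGrad_smul c hp) <;>
      rw [Measure.restrict_univ, ← qpExt_smul]
    · exact (qpExt_congr α (Lp.coeFn_smul c p.1)).symm
    · exact (qpExt_congr α (Lp.coeFn_smul c p.2)).symm

lemma openCell_subset_cell (d : ℕ) : openCell d ⊆ cell d :=
  fun _ hx i => ⟨(hx i).1, (hx i).2.le⟩

lemma ae_openCell {d : ℕ} {F : Type*} {f g : Space d → F} (h : f =ᵐ[cellMeasure d] g) :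
    f =ᵐ[volume.restrict (openCell d)] g :=
  ae_restrict_of_ae_restrict_of_subset (openCell_subset_cell d) h

/-- The pairs `(u, ∇u)` with `u ∈ H¹(Y)`. -/
def neumannH1 (d : ℕ) : Submodule ℂ (L2 d × L2Field d) where
  carrier := {p | IsWeakGrad (openCell d) p.1 p.2}
  zero_mem' := isWeakGrad_congr (ae_openCell (Lp.coeFn_zero ℂ 2 (cellMeasure d))).symm
    (ae_openCell (Lp.coeFn_zero (CVec d) 2 (cellMeasure d))).symm (isWeakGrad_zero _)
  add_mem' := by
    intro p q hp hq
    have hi : ∀ {F : Type} [NormedAddCommGroup F] (f : Lp F 2 (cellMeasure d)),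
        LocallyIntegrable f (volume.restrict (openCell d)) := fun f =>
      ((integrable_coe f).mono_measure (Measure.restrict_mono
        (openCell_subset_cell d) le_rfl)).locallyIntegrable
    exact isWeakGrad_congr (ae_openCell (Lp.coeFn_add p.1 q.1)).symm
      (ae_openCell (Lp.coeFn_add p.2 q.2)).symm
      (isWeakGrad_add (hi p.1) (hi q.1) (hi p.2) (hi q.2) hp hq)
  smul_mem' := by
    intro c p hp
    exact isWeakGrad_congr (ae_openCell (Lp.coeFn_smul c p.1)).symm
      (ae_openCell (Lp.coeFn_smul c p.2)).symm (isWeakGrad_smul c hp)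

/-! ### The three eigenvalue problems -/

/-- The function spaces of an eigenvalue problem: a closed subspace `base` of `L²(Y)` and the pairs
`(u, ∇u)` of the first order Sobolev functions that go with it. -/
structure FunctionSpaces (d : ℕ) where
  base : Submodule ℂ (L2 d)
  complete : CompleteSpace base
  sobolev : Submodule ℂ (L2 d × L2Field d)

/-- `L²_#(α,Y)` and `H¹_#(α,Y)` for `α ≠ 0`. -/
def bloch {d : ℕ} (α : Space d) : FunctionSpaces d := ⟨⊤, inferInstance, blochH1 α⟩

/-- `L²_#(0,Y)` and `H¹_#(0,Y)`: periodic functions with zero average. -/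
def periodic (d : ℕ) : FunctionSpaces d := ⟨zeroMean d, inferInstance, blochH1 0⟩

/-- `L²_0(Y)` and `𝓗`: functions in `H¹(Y)` with zero average. -/
def neumann (d : ℕ) : FunctionSpaces d := ⟨zeroMean d, inferInstance, neumannH1 d⟩

namespace FunctionSpaces

variable {d : ℕ} (S : FunctionSpaces d)

instance instCompleteBase : CompleteSpace S.base := S.complete

/-- The pairs `(u, ∇u)` with `u` a Sobolev function of the problem lying in `base`. -/
def pairs : Submodule ℂ (L2 d × L2Field d) :=
  S.sobolev ⊓ S.base.comap (LinearMap.fst ℂ (L2 d) (L2Field d))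

/-- The Hilbert space of the problem, with inner product `⟨u, v⟩ = ∫_Y ∇u ⬝ ∇v̄`. Since `u ↦ ∇u` is
an isometry for this inner product, an element `u` is represented by `∇u ∈ L²(Y; ℂ^d)`. (The range
of `u ↦ ∇u` is closed by the Poincaré inequality, so taking the closure adds nothing.) -/
def energy : Submodule ℂ (L2Field d) :=
  (S.pairs.map (LinearMap.snd ℂ (L2 d) (L2Field d))).topologicalClosure

instance instCompleteEnergy : CompleteSpace S.energy := by
  unfold energy; infer_instance

open Classical in
/-- The embedding of the energy space into `L²`, that is `∇u ↦ u`; it is a bounded operator by the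
Poincaré inequality. -/
def embed : S.energy →L[ℂ] S.base :=
  if h : ∃ J : S.energy →L[ℂ] S.base,
      ∀ p ∈ S.pairs, ∀ hp : p.2 ∈ S.energy, (J ⟨p.2, hp⟩ : L2 d) = p.1
  then h.choose else 0

/-- The inverse Laplacian `(-Δ)⁻¹`, from `L²` to the energy space, determined by
`⟨(-Δ)⁻¹ f, v⟩ = (f, v)` for all `v` in the energy space. -/
def invLaplacian : S.base →L[ℂ] S.energy := ContinuousLinearMap.adjoint S.embed

/-- Orthogonal projection of the energy space onto (the closure of) a subspace. -/
def proj (W : Submodule ℂ S.energy) : S.energy →L[ℂ] S.energy := W.topologicalClosure.starProjection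

variable (D : Set (Space d))

/-- `W₁`: the completion of the subspace of functions with support away from `D`. -/
def W₁ : Submodule ℂ S.energy :=
  (Submodule.span ℂ {g : S.energy | ∃ u : L2 d, (u, (g : L2Field d)) ∈ S.pairs ∧
    ∃ U : Set (Space d), IsOpen U ∧ closure D ⊆ U ∧
      ∀ᵐ x ∂cellMeasure d, x ∈ U → u x = 0}).topologicalClosure

/-- `W₂`: the functions of `H¹₀(D)`, extended by zero to the cell, up to an additive constant (the
one that makes the average vanish when `base` consists of functions with zero average). In terms of
gradients this is the closure of the gradients of smooth functions with compact support in `D`. -/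
def W₂ : Submodule ℂ S.energy :=
  (Submodule.span ℂ {g : S.energy | ∃ φ : Space d → ℂ, IsTest D φ ∧
    (g : L2Field d) =ᵐ[cellMeasure d] grad φ}).topologicalClosure

/-- `W₃ = (W₁ ⊕ W₂)^⊥`. -/
def W₃ : Submodule ℂ S.energy := (S.W₁ D ⊔ S.W₂ D)ᗮ

/-- The sesquilinear form `⟨T u, v⟩ = ½ ∫_{Y∖D} ∇u ⬝ ∇v̄ - ½ ∫_D ∇u ⬝ ∇v̄`. -/
def resonanceForm (u v : S.energy) : ℂ :=
  (1 / 2) * (∫ x in Dᶜ, ⟪(v : L2Field d) x, (u : L2Field d) x⟫_ℂ ∂cellMeasure d) -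
    (1 / 2) * ∫ x in D, ⟪(v : L2Field d) x, (u : L2Field d) x⟫_ℂ ∂cellMeasure d

lemma setIntegral_inner_add (s : Set (Space d)) (u u' v : L2Field d) :
    ∫ x in s, ⟪v x, (u + u' : L2Field d) x⟫_ℂ ∂cellMeasure d =
      (∫ x in s, ⟪v x, u x⟫_ℂ ∂cellMeasure d) + ∫ x in s, ⟪v x, u' x⟫_ℂ ∂cellMeasure d := by
  rw [← integral_add (L2.integrable_inner (𝕜 := ℂ) v u).restrict
    (L2.integrable_inner (𝕜 := ℂ) v u').restrict]
  refine integral_congr_ae (ae_restrict_of_ae ?_)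
  filter_upwards [Lp.coeFn_add u u'] with x hx
  rw [hx, Pi.add_apply, inner_add_right]

lemma setIntegral_inner_smul (s : Set (Space d)) (c : ℂ) (u v : L2Field d) :
    ∫ x in s, ⟪v x, (c • u : L2Field d) x⟫_ℂ ∂cellMeasure d =
      c * ∫ x in s, ⟪v x, u x⟫_ℂ ∂cellMeasure d := by
  rw [← integral_const_mul]
  refine integral_congr_ae (ae_restrict_of_ae ?_)
  filter_upwards [Lp.coeFn_smul c u] with x hx
  rw [hx, Pi.smul_apply, inner_smul_right]

lemma resonanceForm_add (u u' v : S.energy) :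
    S.resonanceForm D (u + u') v = S.resonanceForm D u v + S.resonanceForm D u' v := by
  simp only [resonanceForm, Submodule.coe_add, setIntegral_inner_add]; ring

lemma resonanceForm_smul (c : ℂ) (u v : S.energy) :
    S.resonanceForm D (c • u) v = c * S.resonanceForm D u v := by
  simp only [resonanceForm, Submodule.coe_smul, setIntegral_inner_smul]; ring

/-- The space of solutions `u ∈ W₃` of the resonance eigenvalue problem
`⟨T u, v⟩ = μ ⟨u, v⟩` for all `v ∈ W₃`. -/
def resonanceSpace (μ : ℝ) : Submodule ℂ S.energy where
  carrier := {u | u ∈ S.W₃ D ∧ ∀ v ∈ S.W₃ D, S.resonanceForm D u v = μ * ⟪v, u⟫_ℂ}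
  zero_mem' := ⟨zero_mem _, fun v _ => by
    simpa using S.resonanceForm_smul D 0 0 v⟩
  add_mem' := fun ha hb => ⟨add_mem ha.1 hb.1, fun v hv => by
    rw [resonanceForm_add, ha.2 v hv, hb.2 v hv, inner_add_right, mul_add]⟩
  smul_mem' := fun c u hu => ⟨Submodule.smul_mem _ c hu.1, fun v hv => by
    rw [resonanceForm_smul, hu.2 v hv, inner_smul_right]; ring⟩

/-- `μ` is a resonance eigenvalue, i.e. an eigenvalue of `T` on `W₃`. -/
def IsResonance (μ : ℝ) : Prop := S.resonanceSpace D μ ≠ ⊥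

/-- `P₁ = Q₁ + P_{1/2}`, where `Q₁` projects onto `W₁` and `P_{1/2}` onto the resonance eigenspace
for `μ = 1/2`. -/
def P₁ : S.energy →L[ℂ] S.energy := S.proj (S.W₁ D) + S.proj (S.resonanceSpace D (1 / 2))

/-- `P₂`, the projection onto `W₂`. -/
def P₂ : S.energy →L[ℂ] S.energy := S.proj (S.W₂ D)

open Classical in
/-- The strongly convergent series `∑ [(1/2 + μ) + z (1/2 - μ)]⁻¹ P_μ` over the resonance eigenvalues
`μ` with `-1/2 < μ < 1/2`. -/
def resonanceSeries (z : ℂ) : S.energy →L[ℂ] S.energy :=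
  if h : ∃ L : S.energy →L[ℂ] S.energy, ∀ u,
      HasSum (fun μ : {μ : ℝ // μ ∈ Ioo (-1 / 2 : ℝ) (1 / 2) ∧ S.IsResonance D μ} =>
        ((1 / 2 + (μ : ℂ)) + z * (1 / 2 - (μ : ℂ)))⁻¹ • S.proj (S.resonanceSpace D μ) u) (L u)
  then h.choose else 0

/-- `A(z) = (z P₁ + P₂ + z ∑ [(1/2 + μ) + z (1/2 - μ)]⁻¹ P_μ) (-Δ)⁻¹`, as an operator on `L²`. -/
def A (z : ℂ) : S.base →L[ℂ] S.base :=
  S.embed ∘L (z • S.P₁ D + S.P₂ D + z • S.resonanceSeries D z) ∘L S.invLaplacian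

/-- The resolvent `R(ζ, 0) = (A(0) - ζ)⁻¹`. -/
def R₀ (ζ : ℂ) : S.base →L[ℂ] S.base := Ring.inverse (S.A D 0 - ζ • 1)

/-- `𝓝(ζ, z) = (P₁ + ∑ [(1/2 + μ) + z (1/2 - μ)]⁻¹ P_μ) (-Δ)⁻¹ R(ζ, 0)`, so that
`z 𝓝(ζ, z) = (A(z) - A(0)) R(ζ, 0)`. -/
def calN (ζ z : ℂ) : S.base →L[ℂ] S.base :=
  S.embed ∘L (S.P₁ D + S.resonanceSeries D z) ∘L S.invLaplacian ∘L S.R₀ D ζ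

end FunctionSpaces

/-! ### Contours -/

/-- `γ : [0,1] → ℂ` is a closed contour: continuous, closed, and continuously differentiable with
bounded derivative away from finitely many points. -/
def IsClosedContour (γ : ℝ → ℂ) : Prop :=
  ContinuousOn γ (Icc 0 1) ∧ γ 0 = γ 1 ∧ ∃ (s : Finset ℝ) (C : ℝ), ∀ t ∈ Ioo (0 : ℝ) 1, t ∉ s →
    DifferentiableAt ℝ γ t ∧ ContinuousAt (deriv γ) t ∧ ‖deriv γ t‖ ≤ C

/-- The contour integral `∮_γ f(ζ) dζ`. -/
def contourIntegral {F : Type*} [NormedAddCommGroup F] [NormedSpace ℂ F] (γ : ℝ → ℂ) (f : ℂ → F) :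
    F := ∫ t in (0 : ℝ)..1, deriv γ t • f (γ t)

/-- The winding number of `γ` about `w`. -/
def windingNumber (γ : ℝ → ℂ) (w : ℂ) : ℂ :=
  (2 * Real.pi * Complex.I)⁻¹ * contourIntegral γ fun ζ => (ζ - w)⁻¹

/-- `γ` is a closed contour that winds once around the point `β₀` of the set `σ`, and around no
other point of `σ`. -/
def Separates (γ : ℝ → ℂ) (σ : Set ℂ) (β₀ : ℂ) : Prop :=
  IsClosedContour γ ∧ β₀ ∈ σ ∧ windingNumber γ β₀ = 1 ∧
    ∀ s ∈ σ, s ≠ β₀ → windingNumber γ s = 0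

/-- The distance `inf_{ζ ∈ Γ} dist(ζ, σ)` between a contour and a set. -/
def contourDist (γ : ℝ → ℂ) (σ : Set ℂ) : ℝ := ⨅ t : Icc (0 : ℝ) 1, Metric.infDist (γ t) σ

/-! ### The series for the eigenvalues and the radii -/

/-- The coefficients `βⁿ(z)` of the series `β(z) = β₀ + ∑_{n ≥ 1} zⁿ βⁿ(z)` for an eigenvalue `β(z)`
of `A(z)` with normalized eigenfunction `φ`: here `β⁰ = β₀` and, for `n ≥ 1`,
`βⁿ(z) = -(1/2πi) (∮_Γ (ζ - β₀) R(ζ,0) (-𝓝(ζ,z))ⁿ dζ φ, φ)`. -/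
def eigCoeff {d : ℕ} (S : FunctionSpaces d) (D : Set (Space d)) (γ : ℝ → ℂ) (β₀ z : ℂ)
    (φ : S.base) : ℕ → ℂ
  | 0 => β₀
  | n + 1 => -(2 * Real.pi * Complex.I)⁻¹ *
      ⟪φ, contourIntegral γ
        (fun ζ => (ζ - β₀) • (S.R₀ D ζ * (-S.calN D ζ z) ^ (n + 1))) φ⟫_ℂ

/-- `z* = (μ* + 1/2) / (μ* - 1/2)`. -/
def zStar (μs : ℝ) : ℝ := (μs + 1 / 2) / (μs - 1 / 2)

/-- `r* = Λ d̂ |z*| / (1 / (1/2 - μ*) + Λ d̂)`. -/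
def rStar (Λ dhat μs : ℝ) : ℝ := Λ * dhat * |zStar μs| / (1 / (1 / 2 - μs) + Λ * dhat)

/-! ### The geometry of the inclusions -/

/-- The boundary of the open set `D` is of class `C^{1,θ}` for some `0 < θ ≤ 1`: near each boundary
point, `D` is the negativity set of a `C^{1,θ}` function with nonvanishing differential. -/
def HasC1HolderBoundary {d : ℕ} (D : Set (Space d)) : Prop :=
  ∃ θ : NNReal, 0 < θ ∧ θ ≤ 1 ∧ ∀ x₀ ∈ frontier D, ∃ (U : Set (Space d)) (ρ : Space d → ℝ)
    (C : NNReal), IsOpen U ∧ x₀ ∈ U ∧ ContDiffOn ℝ 1 ρ U ∧ HolderOnWith C θ (fderiv ℝ ρ) U ∧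
      fderiv ℝ ρ x₀ ≠ 0 ∧ D ∩ U = {x ∈ U | ρ x < 0}

/-- `D`, the union of the inclusions, is an open set with `C^{1,θ}` boundary, compactly contained in
the interior of the period cell. -/
structure IsInclusionDomain {d : ℕ} (D : Set (Space d)) : Prop where
  isOpen : IsOpen D
  closure_subset : closure D ⊆ openCell d
  boundary : HasC1HolderBoundary D

end HighContrast

end

open HighContrast

noncomputable section

namespace HighContrast

/-! ### Contour integrals -/

section Contour

variable {F : Type*} [NormedAddCommGroup F] [NormedSpace ℂ F] {γ : ℝ → ℂ}

/-! Fix a real `z` and freeze the operator `b = increment z`, so that `A(z) = a + z b` with `a =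
A(0)`. Both `a` and `b` are self-adjoint and the family `a + t b` is linear in `t`. Applied to a
unit eigenvector of `a + z b` inside the contour, the integral of `(ζ - β₀) (a + z b - ζ)⁻¹` gives
`-2πi (β - β₀)`. Expanding the resolvent in a Neumann series writes the integral as `∑ zⁿ Cₙ`, and
the matrix coefficients of `Cₙ` are, up to the factor `-1/2πi`, the terms `eigCoeff`. The estimate
is then the tail of a geometric series.

The main point is a bound for `Cₙ` that does not involve the length of the contour. If the contour
has distance `δ` from the spectrum of `a`, then no other spectral point is closer than `2δ` to `β₀`,
and the circle of radius `δ` about `β₀` also keeps distance `δ` from the spectrum. For small real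
`t` the operator `a + t b` is self-adjoint, and by the functional calculus its contour integral
depends only on winding numbers, which agree for the two curves. So the two power series in `t` have
equal coefficients (`seriesCoeff_eq`). On the circle `|ζ - β₀| = δ` cancels the bound `δ⁻¹` of one
resolvent, and `‖Cₙ‖ ≤ 2πδ (‖b‖/δ)ⁿ` (`norm_seriesCoeff_le`).

It remains to bound `‖b‖`. The operator is `J K(z) J*`, where `J` embeds the energy space into `L²`.
A Poincaré inequality gives `‖J‖² ≤ Λ⁻¹`, and `K(z)` is diagonal with respect to orthogonal
projections, so its norm is controlled by its largest coefficient. The radius `r*` is the value for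
which these two bounds give `‖b‖ ≤ δ / r*`.

The constants `Λ` come from Parseval's identity on the cell: plane waves in the quasi-periodic and
periodic problems, products of cosines (with one sine for a gradient component) in the Neumann
problem. The Fourier coefficients of a weak gradient are found by testing with products of
one-variable functions. -/

lemma IsClosedContour.continuousOn_comp {X : Type*} [TopologicalSpace X] (hγ : IsClosedContour γ)
    {f : ℂ → X} (hf : ∀ t ∈ Icc (0 : ℝ) 1, ContinuousAt f (γ t)) :
    ContinuousOn (fun t => f (γ t)) (Icc 0 1) :=
  fun t ht => (hf t ht).comp_continuousWithinAt (hγ.1 t ht)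

lemma IsClosedContour.intervalIntegrable_deriv (hγ : IsClosedContour γ) :
    IntervalIntegrable (deriv γ) volume 0 1 := by
  obtain ⟨s, C, h⟩ := hγ.2.2
  rw [intervalIntegrable_iff_integrableOn_Ioo_of_le zero_le_one]
  refine Measure.integrableOn_of_bounded (M := C) (by simp)
    (stronglyMeasurable_deriv γ).aestronglyMeasurable ?_
  have hs : ∀ᵐ t ∂(volume : Measure ℝ), t ∉ s := by
    have := s.countable_toSet.ae_notMem (volume : Measure ℝ)
    simpa using this
  filter_upwards [ae_restrict_mem measurableSet_Ioo, ae_restrict_of_ae hs] with t ht hts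
  exact (h t ht hts).2.2

lemma IsClosedContour.intervalIntegrable_smul (hγ : IsClosedContour γ) {f : ℂ → F}
    (hf : ContinuousOn (fun t => f (γ t)) (Icc 0 1)) :
    IntervalIntegrable (fun t => deriv γ t • f (γ t)) volume 0 1 :=
  hγ.intervalIntegrable_deriv.smul_continuousOn (by rwa [uIcc_of_le zero_le_one])

lemma contourIntegral_eq_zero_of_hasDerivAt [CompleteSpace F] (hγ : IsClosedContour γ)
    {f f' : ℂ → F} (hf : ∀ t ∈ Icc (0 : ℝ) 1, HasDerivAt f (f' (γ t)) (γ t))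
    (hf' : ∀ t ∈ Icc (0 : ℝ) 1, ContinuousAt f' (γ t)) :
    contourIntegral γ f' = 0 := by
  obtain ⟨s, C, h⟩ := hγ.2.2
  have := integral_eq_of_hasDerivAt_off_countable_of_le
    (fun t => f (γ t)) (fun t => deriv γ t • f' (γ t)) zero_le_one s.countable_toSet
    (hγ.continuousOn_comp fun t ht => (hf t ht).continuousAt)
    (fun t ht => (hf t (Ioo_subset_Icc_self ht.1)).scomp t (h t ht.1 ht.2).1.hasDerivAt)
    (hγ.intervalIntegrable_smul (hγ.continuousOn_comp hf'))
  rw [contourIntegral, this, hγ.2.1, sub_self]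

lemma contourIntegral_add (hγ : IsClosedContour γ) {f g : ℂ → F}
    (hf : ContinuousOn (fun t => f (γ t)) (Icc 0 1))
    (hg : ContinuousOn (fun t => g (γ t)) (Icc 0 1)) :
    contourIntegral γ (fun ζ => f ζ + g ζ) = contourIntegral γ f + contourIntegral γ g := by
  simp only [contourIntegral, smul_add]
  exact intervalIntegral.integral_add (hγ.intervalIntegrable_smul hf)
    (hγ.intervalIntegrable_smul hg)

lemma contourIntegral_const_mul (c : ℂ) (f : ℂ → ℂ) :
    contourIntegral γ (fun ζ => c * f ζ) = c * contourIntegral γ f := by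
  simp only [contourIntegral, smul_eq_mul, ← intervalIntegral.integral_const_mul]
  congr 1; ext t; ring

lemma contourIntegral_congr {f g : ℂ → F} (h : ∀ t ∈ Icc (0 : ℝ) 1, f (γ t) = g (γ t)) :
    contourIntegral γ f = contourIntegral γ g := by
  refine intervalIntegral.integral_congr fun t ht => ?_
  rw [uIcc_of_le zero_le_one] at ht
  simp only [h t ht]

lemma map_contourIntegral {G : Type*} [NormedAddCommGroup G] [NormedSpace ℂ G] [CompleteSpace F]
    [CompleteSpace G] (hγ : IsClosedContour γ) (L : F →L[ℂ] G) {f : ℂ → F}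
    (hf : ContinuousOn (fun t => f (γ t)) (Icc 0 1)) :
    L (contourIntegral γ f) = contourIntegral γ fun ζ => L (f ζ) := by
  simp only [contourIntegral, ← map_smul]
  exact (L.intervalIntegral_comp_comm (hγ.intervalIntegrable_smul hf)).symm

/-- The winding number is the same at two points whose distance is less than the distance of one of
them to the contour. -/
lemma windingNumber_eq_of_norm_sub_lt (hγ : IsClosedContour γ) {s β : ℂ} {δ : ℝ}
    (hs : ∀ t ∈ Icc (0 : ℝ) 1, δ ≤ ‖γ t - s‖) (hβ : ‖β - s‖ < δ) :
    windingNumber γ β = windingNumber γ s := by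
  have hδ : 0 < δ := (norm_nonneg _).trans_lt hβ
  have h1 : ∀ t ∈ Icc (0 : ℝ) 1, γ t - s ≠ 0 := fun t ht =>
    norm_pos_iff.1 (hδ.trans_le (hs t ht))
  have h2 : ∀ t ∈ Icc (0 : ℝ) 1, γ t - β ≠ 0 := fun t ht h0 => by
    have : γ t - s = β - s := by rw [sub_eq_zero.1 h0]
    exact absurd (hs t ht) (by rw [this]; exact not_le.2 hβ)
  -- The quotient differs from 1 by less than 1 in modulus, so its principal logarithm is a
  -- primitive of the difference of the two integrands along the whole contour.
  have h3 : ∀ t ∈ Icc (0 : ℝ) 1, (γ t - β) / (γ t - s) ∈ Complex.slitPlane := fun t ht => by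
    have h : 1 + -((β - s) / (γ t - s)) ∈ Complex.slitPlane := by
      refine Complex.mem_slitPlane_of_norm_lt_one ?_
      rw [norm_neg, norm_div, div_lt_one (norm_pos_iff.2 (h1 t ht))]
      exact hβ.trans_le (hs t ht)
    convert h using 1
    have := h1 t ht
    field_simp
    ring
  have h0 : contourIntegral γ (fun ζ => (ζ - β)⁻¹ + -(ζ - s)⁻¹) = 0 := by
    refine contourIntegral_eq_zero_of_hasDerivAt hγ
      (f := fun ζ => Complex.log ((ζ - β) / (ζ - s))) (fun t ht => ?_) fun t ht => ?_
    · have hd : HasDerivAt (fun ζ : ℂ => (ζ - β) / (ζ - s))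
          ((1 * (γ t - s) - (γ t - β) * 1) / (γ t - s) ^ 2) (γ t) :=
        ((hasDerivAt_id _).sub_const β).div ((hasDerivAt_id _).sub_const s) (h1 t ht)
      refine (hd.clog (h3 t ht)).congr_deriv ?_
      have h4 := h1 t ht; have h5 := h2 t ht
      field_simp
      ring
    · have := h1 t ht; have := h2 t ht
      fun_prop (disch := assumption)
  rw [contourIntegral_add hγ
    (hγ.continuousOn_comp fun t ht => by have := h2 t ht; fun_prop (disch := assumption))
    (hγ.continuousOn_comp fun t ht => by have := h1 t ht; fun_prop (disch := assumption))] at h0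
  have h4 : contourIntegral γ (fun ζ => -(ζ - s)⁻¹) = -contourIntegral γ fun ζ => (ζ - s)⁻¹ := by
    simpa using contourIntegral_const_mul (γ := γ) (-1) fun ζ => (ζ - s)⁻¹
  rw [h4, add_neg_eq_zero] at h0
  rw [windingNumber, windingNumber, h0]

/-- Division gives `(ζ - β₀)/(β - ζ) = -1 - (β - β₀)/(ζ - β)`; the constant has a primitive and
integrates to zero. The weight `ζ - β₀` thus turns a winding number into the displacement `β - β₀`.
-/
lemma contourIntegral_sub_mul_inv (hγ : IsClosedContour γ) {β : ℂ} (β₀ : ℂ)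
    (hβ : ∀ t ∈ Icc (0 : ℝ) 1, γ t ≠ β) :
    contourIntegral γ (fun ζ => (ζ - β₀) * (β - ζ)⁻¹) =
      -(2 * Real.pi * Complex.I) * ((β - β₀) * windingNumber γ β) := by
  have h1 : ∀ t ∈ Icc (0 : ℝ) 1, γ t - β ≠ 0 := fun t ht => sub_ne_zero.2 (hβ t ht)
  rw [contourIntegral_congr (g := fun ζ => (-1 : ℂ) + -(β - β₀) * (ζ - β)⁻¹)]
  · rw [contourIntegral_add hγ continuousOn_const
      (hγ.continuousOn_comp fun t ht => by have := h1 t ht; fun_prop (disch := assumption)),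
      contourIntegral_const_mul, contourIntegral_eq_zero_of_hasDerivAt hγ
        (f := fun ζ => -ζ) (f' := fun _ => -1) (fun t _ => (hasDerivAt_id _).neg)
        (fun t _ => continuousAt_const), windingNumber]
    have : (Real.pi : ℂ) ≠ 0 := by exact_mod_cast Real.pi_ne_zero
    have := Complex.I_ne_zero
    field_simp
    ring
  · intro t ht
    have h2 : β - γ t ≠ 0 := fun h => h1 t ht (by rw [← neg_sub, h, neg_zero])
    have h3 := h1 t ht
    field_simp
    ring

/-- The circle of radius `δ` about `β₀`, parametrized by the unit interval. -/
def unitCircleMap (β₀ : ℂ) (δ : ℝ) (t : ℝ) : ℂ :=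
  β₀ + δ * Complex.exp (2 * Real.pi * Complex.I * t)

lemma hasDerivAt_unitCircleMap (β₀ : ℂ) (δ t : ℝ) :
    HasDerivAt (unitCircleMap β₀ δ)
      (δ * (Complex.exp (2 * Real.pi * Complex.I * t) * (2 * Real.pi * Complex.I))) t := by
  have h : HasDerivAt (fun t : ℝ => (2 * Real.pi * Complex.I * t : ℂ)) (2 * Real.pi * Complex.I) t := by
    simpa using (Complex.ofRealCLM.hasDerivAt (x := t)).const_mul (2 * Real.pi * Complex.I : ℂ)
  exact (h.cexp.const_mul (δ : ℂ)).const_add β₀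

lemma norm_unitCircleMap_sub (β₀ : ℂ) {δ : ℝ} (hδ : 0 ≤ δ) (t : ℝ) :
    ‖unitCircleMap β₀ δ t - β₀‖ = δ := by
  have : (2 * Real.pi * Complex.I * t : ℂ) = ((2 * Real.pi * t : ℝ) : ℂ) * Complex.I := by
    push_cast; ring
  rw [unitCircleMap, add_sub_cancel_left, norm_mul, this, Complex.norm_exp_ofReal_mul_I]
  simp [abs_of_nonneg hδ]

lemma norm_deriv_unitCircleMap (β₀ : ℂ) {δ : ℝ} (hδ : 0 ≤ δ) (t : ℝ) :
    ‖deriv (unitCircleMap β₀ δ) t‖ = 2 * Real.pi * δ := by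
  have : (2 * Real.pi * Complex.I * t : ℂ) = ((2 * Real.pi * t : ℝ) : ℂ) * Complex.I := by
    push_cast; ring
  rw [(hasDerivAt_unitCircleMap β₀ δ t).deriv, this, norm_mul, norm_mul,
    Complex.norm_exp_ofReal_mul_I]
  simp [abs_of_nonneg hδ, abs_of_pos Real.pi_pos]
  ring

lemma isClosedContour_unitCircleMap (β₀ : ℂ) {δ : ℝ} (hδ : 0 ≤ δ) :
    IsClosedContour (unitCircleMap β₀ δ) := by
  refine ⟨fun t _ => (hasDerivAt_unitCircleMap β₀ δ t).continuousAt.continuousWithinAt, ?_,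
    ∅, 2 * Real.pi * δ, fun t _ _ => ⟨(hasDerivAt_unitCircleMap β₀ δ t).differentiableAt, ?_,
      (norm_deriv_unitCircleMap β₀ hδ t).le⟩⟩
  · simp [unitCircleMap, Complex.exp_two_pi_mul_I]
  · rw [show deriv (unitCircleMap β₀ δ) = _ from
      funext fun t => (hasDerivAt_unitCircleMap β₀ δ t).deriv]
    fun_prop

lemma windingNumber_unitCircleMap_self (β₀ : ℂ) {δ : ℝ} (hδ : 0 < δ) :
    windingNumber (unitCircleMap β₀ δ) β₀ = 1 := by
  have h : contourIntegral (unitCircleMap β₀ δ) (fun ζ => (ζ - β₀)⁻¹) =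
      ∫ t in (0 : ℝ)..1, (2 * Real.pi * Complex.I : ℂ) := by
    refine intervalIntegral.integral_congr fun t _ => ?_
    have h1 := Complex.exp_ne_zero (2 * Real.pi * Complex.I * t)
    have h2 : (δ : ℂ) ≠ 0 := by exact_mod_cast hδ.ne'
    simp only [(hasDerivAt_unitCircleMap β₀ δ t).deriv, smul_eq_mul]
    rw [unitCircleMap, add_sub_cancel_left]
    field_simp
  rw [windingNumber, h, intervalIntegral.integral_const]
  simp only [sub_zero, one_smul]
  exact inv_mul_cancel₀ Complex.two_pi_I_ne_zero

/-- The quotient `(ζ - s)/(β₀ - s)` stays in the unit disc about 1 along the circle, so the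
integrand has a logarithm as primitive. -/
lemma windingNumber_unitCircleMap_of_lt (β₀ : ℂ) {δ : ℝ} (hδ : 0 < δ) {s : ℂ}
    (hs : δ < ‖s - β₀‖) : windingNumber (unitCircleMap β₀ δ) s = 0 := by
  have h1 : β₀ - s ≠ 0 := fun h => by
    rw [← norm_neg, neg_sub, h, norm_zero] at hs; exact absurd hs hδ.le.not_gt
  have hn : ∀ t, unitCircleMap β₀ δ t - s ≠ 0 := fun t h => by
    have := norm_unitCircleMap_sub β₀ hδ.le t
    rw [sub_eq_zero.1 h] at this; exact absurd this hs.ne'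
  have h0 : contourIntegral (unitCircleMap β₀ δ) (fun ζ => (ζ - s)⁻¹) = 0 := by
    refine contourIntegral_eq_zero_of_hasDerivAt (isClosedContour_unitCircleMap β₀ hδ.le)
      (f := fun ζ => Complex.log ((ζ - s) / (β₀ - s))) (fun t _ => ?_) fun t _ => ?_
    · have hsl : (unitCircleMap β₀ δ t - s) / (β₀ - s) ∈ Complex.slitPlane := by
        have h : 1 + (unitCircleMap β₀ δ t - β₀) / (β₀ - s) ∈ Complex.slitPlane := by
          refine Complex.mem_slitPlane_of_norm_lt_one ?_
          rw [norm_div, div_lt_one (norm_pos_iff.2 h1), norm_unitCircleMap_sub β₀ hδ.le,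
            ← norm_neg, neg_sub]
          exact hs
        convert h using 1
        field_simp
        ring
      refine ((((hasDerivAt_id _).sub_const s).div_const (β₀ - s)).clog hsl).congr_deriv ?_
      have := hn t
      simp only [id]
      field_simp
      exact div_self this
    · have := hn t
      fun_prop (disch := assumption)
  rw [windingNumber, h0, mul_zero]

end Contour

/-! ### Contour integrals of resolvents -/

section Resolvent

variable {A : Type*} [NormedRing A] [NormedAlgebra ℂ A] [CompleteSpace A] {γ : ℝ → ℂ}

lemma isUnit_sub_smul_one {R : Type*} [Ring R] [Algebra ℂ R] {a : R} {ζ : ℂ}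
    (h : ζ ∉ spectrum ℂ a) : IsUnit (a - ζ • (1 : R)) := by
  rw [spectrum.notMem_iff, Algebra.algebraMap_eq_smul_one] at h
  simpa using h.neg

lemma IsClosedContour.continuousOn_inverse (hγ : IsClosedContour γ) {a : A}
    (h : ∀ t ∈ Icc (0 : ℝ) 1, IsUnit (a - γ t • (1 : A))) :
    ContinuousOn (fun t => Ring.inverse (a - γ t • (1 : A))) (Icc 0 1) := by
  intro t ht
  obtain ⟨u, hu⟩ := h t ht
  have h1 := NormedRing.inverse_continuousAt u
  rw [hu] at h1
  exact h1.comp_continuousWithinAt (f := fun t => a - γ t • (1 : A))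
    (continuousWithinAt_const.sub ((hγ.1 t ht).smul continuousWithinAt_const))

lemma map_ringInverse {R S : Type*} [Ring R] [Ring S] (f : R →+* S) {x : R} (hx : IsUnit x) :
    f (Ring.inverse x) = Ring.inverse (f x) := by
  obtain ⟨u, rfl⟩ := hx
  rw [Ring.inverse_unit]
  exact (Ring.inverse_unit (Units.map f.toMonoidHom u)).symm

/-- The integral `∮ (ζ - β₀) (a - ζ)⁻¹ dζ`. -/
def resolventIntegral (γ : ℝ → ℂ) (β₀ : ℂ) (a : A) : A :=
  contourIntegral γ fun ζ => (ζ - β₀) • Ring.inverse (a - ζ • (1 : A))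

lemma IsClosedContour.continuousOn_smul_inverse (hγ : IsClosedContour γ) {a : A} (β₀ : ℂ)
    (h : ∀ t ∈ Icc (0 : ℝ) 1, IsUnit (a - γ t • (1 : A))) :
    ContinuousOn (fun t => (γ t - β₀) • Ring.inverse (a - γ t • (1 : A))) (Icc 0 1) :=
  (hγ.1.sub continuousOn_const).smul (hγ.continuousOn_inverse h)

lemma map_resolventIntegral {B : Type*} [NormedRing B] [NormedAlgebra ℂ B] [CompleteSpace B]
    (hγ : IsClosedContour γ) (β₀ : ℂ) (Ψ : A →ₐ[ℂ] B) (hΨ : Continuous Ψ) {a : A}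
    (h : ∀ t ∈ Icc (0 : ℝ) 1, IsUnit (a - γ t • (1 : A))) :
    Ψ (resolventIntegral γ β₀ a) = resolventIntegral γ β₀ (Ψ a) := by
  have := map_contourIntegral hγ (⟨Ψ.toLinearMap, hΨ⟩ : A →L[ℂ] B)
    (f := fun ζ => (ζ - β₀) • Ring.inverse (a - ζ • (1 : A))) (hγ.continuousOn_smul_inverse β₀ h)
  refine (show _ = _ from this).trans (contourIntegral_congr fun t ht => ?_)
  change Ψ _ = _
  rw [map_smul]
  congr 1
  refine (map_ringInverse Ψ.toRingHom (h t ht)).trans ?_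
  simp

end Resolvent

/-! ### Self-adjoint elements and the continuous functional calculus -/

section SelfAdjoint

variable {A : Type*} [CStarAlgebra A] {γ : ℝ → ℂ}

/-- For a self-adjoint element, `∮ (ζ - β₀) (a - ζ)⁻¹ dζ` depends only on the winding numbers of the
contour about the points of the spectrum different from `β₀`. -/
lemma resolventIntegral_eq_of_windingNumber_eq {γ' : ℝ → ℂ} (hγ : IsClosedContour γ)
    (hγ' : IsClosedContour γ') (β₀ : ℂ) {a : A} (ha : IsSelfAdjoint a)
    (h : ∀ t ∈ Icc (0 : ℝ) 1, γ t ∉ spectrum ℂ a)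
    (h' : ∀ t ∈ Icc (0 : ℝ) 1, γ' t ∉ spectrum ℂ a)
    (hw : ∀ s ∈ spectrum ℂ a, (s - β₀) * windingNumber γ s = (s - β₀) * windingNumber γ' s) :
    resolventIntegral γ β₀ a = resolventIntegral γ' β₀ a := by
  have hn : IsStarNormal a := ha.isStarNormal
  -- The functional calculus carries the coordinate function `x` to `a`. In `C(spectrum ℂ a, ℂ)` the
  -- integral can be evaluated point by point, where it becomes a scalar integral given by a winding
  -- number.
  let x : C(spectrum ℂ a, ℂ) := (ContinuousMap.id ℂ).restrict (spectrum ℂ a)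
  have hx : cfcHom (R := ℂ) hn x = a := cfcHom_id hn
  have hu : ∀ ζ, ζ ∉ spectrum ℂ a → IsUnit (x - ζ • (1 : C(spectrum ℂ a, ℂ))) := by
    intro ζ hζ
    rw [ContinuousMap.isUnit_iff_forall_ne_zero]
    intro s hs
    refine hζ ?_
    have : (s : ℂ) - ζ = 0 := by simpa [x] using hs
    rw [← sub_eq_zero.1 this]
    exact s.2
  have hev : ∀ (η : ℝ → ℂ), IsClosedContour η → (∀ t ∈ Icc (0 : ℝ) 1, η t ∉ spectrum ℂ a) →
      resolventIntegral η β₀ a = cfcHom (R := ℂ) hn (resolventIntegral η β₀ x) ∧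
      ∀ s : spectrum ℂ a, resolventIntegral η β₀ x s =
        -(2 * Real.pi * Complex.I) * ((s - β₀) * windingNumber η s) := by
    intro η hη h
    constructor
    · have := map_resolventIntegral hη β₀ (cfcHom (R := ℂ) hn).toAlgHom (cfcHom_continuous hn)
        (a := x) (fun t ht => hu _ (h t ht))
      conv_lhs => rw [← hx]
      exact this.symm
    · intro s
      have := map_resolventIntegral hη β₀
        (ContinuousMap.evalAlgHom ℂ ℂ s : C(spectrum ℂ a, ℂ) →ₐ[ℂ] ℂ)
        (continuous_eval_const (F := C(spectrum ℂ a, ℂ)) s)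
        (a := x) (fun t ht => hu _ (h t ht))
      refine (show _ = _ from this).trans ?_
      rw [← contourIntegral_sub_mul_inv hη β₀ (fun t ht h0 => h t ht (h0 ▸ s.2))]
      refine contourIntegral_congr fun t _ => ?_
      simp [x, Ring.inverse_eq_inv']
  rw [(hev γ hγ h).1, (hev γ' hγ' h').1]
  congr 1
  ext s
  rw [(hev γ hγ h).2, (hev γ' hγ' h').2, hw s s.2]

/-- The functional calculus bounds the resolvent by the supremum of `|s - ζ|⁻¹` over the spectrum.
-/
lemma norm_inverse_sub_le {a : A} (ha : IsSelfAdjoint a) {ζ : ℂ} {δ : ℝ} (hδ : 0 < δ)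
    (h : ∀ s ∈ spectrum ℂ a, δ ≤ ‖ζ - s‖) : ‖Ring.inverse (a - ζ • (1 : A))‖ ≤ δ⁻¹ := by
  have hn : IsStarNormal a := ha.isStarNormal
  have h0 : ∀ s ∈ spectrum ℂ a, s - ζ ≠ 0 := fun s hs h0 => by
    have := h s hs
    rw [← norm_neg, neg_sub, h0, norm_zero] at this
    exact absurd this hδ.not_ge
  have h1 : cfc (fun s : ℂ => s - ζ) a = a - ζ • (1 : A) := by
    rw [cfc_sub .., cfc_id' ℂ a, cfc_const ζ a, Algebra.algebraMap_eq_smul_one]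
  rw [← h1, ← cfc_inv (fun s : ℂ => s - ζ) a h0]
  refine norm_cfc_le (inv_nonneg.2 hδ.le) fun s hs => ?_
  rw [norm_inv, ← norm_neg, neg_sub]
  exact inv_anti₀ hδ (h s hs)

end SelfAdjoint

/-! ### Perturbation series -/

lemma hasSum_of_eq {ι E : Type*} [AddCommMonoid E] [TopologicalSpace E] {f g : ι → E} {s : E}
    (h : ∀ i, f i = g i) (hf : HasSum f s) : HasSum g s :=
  funext h ▸ hf

/-- A power series in a real variable which vanishes near the origin has vanishing coefficients. -/
lemma eq_zero_of_hasSum_pow_smul {E : Type*} [NormedAddCommGroup E] [NormedSpace ℝ E] {c : ℕ → E}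
    {ε : ℝ} (hε : 0 < ε) (h : ∀ t : ℝ, |t| < ε → HasSum (fun n => t ^ n • c n) 0) (n : ℕ) :
    c n = 0 := by
  let p : FormalMultilinearSeries ℝ ℝ E := fun n => ContinuousMultilinearMap.mkPiRing ℝ (Fin n) (c n)
  have hp : HasFPowerSeriesAt (0 : ℝ → E) p 0 := by
    -- The point `ε / 2` lies inside the interval of convergence; the terms there tend to zero,
    -- which bounds the radius of convergence from below.
    refine ⟨ENNReal.ofReal (ε / 2), ?_, by simpa using hε, fun {y} hy => ?_⟩
    · have h1 := (h (ε / 2) (by rw [abs_of_pos (by positivity)]; linarith)).summable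
      have h2 := h1.tendsto_atTop_zero.norm
      refine FormalMultilinearSeries.le_radius_of_tendsto p (r := (ε / 2).toNNReal) (l := 0) ?_
      convert h2 using 2 with n
      · rw [norm_smul, norm_pow, Real.norm_eq_abs, abs_of_pos (by positivity),
          ContinuousMultilinearMap.norm_mkPiRing, Real.coe_toNNReal _ (by positivity), mul_comm]
      · simp
    · have hy' : |y| < ε := by
        rw [Metric.mem_eball, edist_zero_right, ← ofReal_norm,
          ENNReal.ofReal_lt_ofReal_iff (by positivity), Real.norm_eq_abs] at hy
        linarith
      simpa [p] using h y hy'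
  simpa [p] using hp.apply_eq_zero n 1

section Series

variable {A : Type*} [CStarAlgebra A] {γ γ' : ℝ → ℂ} {a b : A} {δ : ℝ}

/-- With `R = (a - ζ)⁻¹` one has `a + t b - ζ = (1 + t b R)(a - ζ)`, and the first factor is
inverted by a Neumann series because `‖t b R‖ < 1`. -/
lemma hasSum_inverse_add (ha : IsSelfAdjoint a) {ζ : ℂ} (hδ : 0 < δ)
    (h : ∀ s ∈ spectrum ℂ a, δ ≤ ‖ζ - s‖) {t : ℂ} (ht : ‖t‖ * ‖b‖ < δ) :
    IsUnit (a + t • b - ζ • (1 : A)) ∧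
    HasSum (fun n : ℕ => t ^ n • (Ring.inverse (a - ζ • (1 : A)) *
      (-(b * Ring.inverse (a - ζ • (1 : A)))) ^ n)) (Ring.inverse (a + t • b - ζ • (1 : A))) := by
  have hR := norm_inverse_sub_le ha hδ h
  have hu : IsUnit (a - ζ • (1 : A)) := isUnit_sub_smul_one fun hs => by
    have := h ζ hs
    simp only [sub_self, norm_zero] at this
    exact absurd this hδ.not_ge
  obtain ⟨u, hu'⟩ := hu
  rw [← hu', Ring.inverse_unit] at hR
  have hx : ‖t • -(b * (↑u⁻¹ : A))‖ < 1 := by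
    rw [norm_smul, norm_neg]
    calc ‖t‖ * ‖b * (↑u⁻¹ : A)‖ ≤ ‖t‖ * (‖b‖ * δ⁻¹) := by
          gcongr
          exact (norm_mul_le _ _).trans (by gcongr)
      _ = ‖t‖ * ‖b‖ * δ⁻¹ := by ring
      _ < δ * δ⁻¹ := by gcongr
      _ = 1 := mul_inv_cancel₀ hδ.ne'
  let v := Units.oneSub _ hx
  have hv : (↑(v * u) : A) = a + t • b - ζ • (1 : A) := by
    have h1 : a + t • b - ζ • (1 : A) = (u : A) + t • b := by rw [hu']; abel
    rw [h1, Units.val_mul, Units.val_oneSub, smul_neg, sub_neg_eq_add, add_mul, one_mul,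
      smul_mul_assoc, Units.inv_mul_cancel_right]
  refine ⟨hv ▸ (v * u).isUnit, ?_⟩
  rw [← hv, Ring.inverse_unit, mul_inv_rev, Units.val_mul, ← hu', Ring.inverse_unit]
  have h2 : HasSum (fun n : ℕ => (t • -(b * (↑u⁻¹ : A))) ^ n) (↑v⁻¹ : A) :=
    (summable_geometric_of_norm_lt_one hx).hasSum
  have h3 := h2.mul_left (↑u⁻¹ : A)
  simpa only [smul_pow, mul_smul_comm] using h3

/-- The coefficients of the expansion of `∮ (ζ - β₀) (a + t b - ζ)⁻¹ dζ` in powers of `t`. -/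
def seriesCoeff (γ : ℝ → ℂ) (β₀ : ℂ) (a b : A) (n : ℕ) : A :=
  contourIntegral γ fun ζ => (ζ - β₀) • (Ring.inverse (a - ζ • (1 : A)) *
    (-(b * Ring.inverse (a - ζ • (1 : A)))) ^ n)

lemma norm_smul_inverse_mul_pow_le (ha : IsSelfAdjoint a) {ζ : ℂ} (hδ : 0 < δ)
    (h : ∀ s ∈ spectrum ℂ a, δ ≤ ‖ζ - s‖) (n : ℕ) :
    ‖Ring.inverse (a - ζ • (1 : A)) * (-(b * Ring.inverse (a - ζ • (1 : A)))) ^ n‖ ≤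
      δ⁻¹ * (‖b‖ / δ) ^ n := by
  have hR := norm_inverse_sub_le ha hδ h
  have hp : ∀ x y : A, ‖x * y ^ n‖ ≤ ‖x‖ * ‖y‖ ^ n := fun x y => by
    induction n with
    | zero => simp
    | succ n ih =>
      rw [pow_succ, ← mul_assoc, pow_succ, ← mul_assoc]
      exact (norm_mul_le _ _).trans (by gcongr)
  refine (hp _ _).trans ?_
  gcongr
  rw [norm_neg, div_eq_mul_inv]
  exact (norm_mul_le _ _).trans (by gcongr)

lemma notMem_spectrum_of_le (hδ : 0 < δ) {ζ : ℂ} (h : ∀ s ∈ spectrum ℂ a, δ ≤ ‖ζ - s‖) :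
    ζ ∉ spectrum ℂ a := fun hs => by
  have := h ζ hs
  simp only [sub_self, norm_zero] at this
  exact absurd this hδ.not_ge

lemma continuousOn_seriesCoeff (hγ : IsClosedContour γ) (hδ : 0 < δ) (β₀ : ℂ)
    (h : ∀ t ∈ Icc (0 : ℝ) 1, ∀ s ∈ spectrum ℂ a, δ ≤ ‖γ t - s‖) (b : A) (n : ℕ) :
    ContinuousOn (fun t => (γ t - β₀) • (Ring.inverse (a - γ t • (1 : A)) *
      (-(b * Ring.inverse (a - γ t • (1 : A)))) ^ n)) (Icc 0 1) := by
  have h1 := hγ.continuousOn_inverse (a := a)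
    fun t ht => isUnit_sub_smul_one (notMem_spectrum_of_le hδ (h t ht))
  exact (hγ.1.sub continuousOn_const).smul (h1.mul ((continuousOn_const.mul h1).neg.pow n))

/-- The Neumann series is integrated term by term, with a geometric majorant of ratio `‖t‖ ‖b‖ / δ`.
-/
lemma hasSum_seriesCoeff (hγ : IsClosedContour γ) (ha : IsSelfAdjoint a) (hδ : 0 < δ) (β₀ : ℂ)
    (h : ∀ t ∈ Icc (0 : ℝ) 1, ∀ s ∈ spectrum ℂ a, δ ≤ ‖γ t - s‖) {t : ℂ} (ht : ‖t‖ * ‖b‖ < δ) :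
    HasSum (fun n => t ^ n • seriesCoeff γ β₀ a b n) (resolventIntegral γ β₀ (a + t • b)) := by
  have hq : ‖t‖ * ‖b‖ / δ < 1 := (div_lt_one hδ).2 ht
  have hq0 : 0 ≤ ‖t‖ * ‖b‖ / δ := by positivity
  have hcont := continuousOn_seriesCoeff hγ hδ β₀ h b
  have key := intervalIntegral.hasSum_integral_of_dominated_convergence (μ := volume) (a := 0)
    (b := 1) (F := fun (n : ℕ) (τ : ℝ) => t ^ n • (deriv γ τ • ((γ τ - β₀) •
      (Ring.inverse (a - γ τ • (1 : A)) * (-(b * Ring.inverse (a - γ τ • (1 : A)))) ^ n))))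
    (f := fun τ => deriv γ τ • ((γ τ - β₀) • Ring.inverse (a + t • b - γ τ • (1 : A))))
    (fun n τ => ‖deriv γ τ‖ * ‖γ τ - β₀‖ * δ⁻¹ * (‖t‖ * ‖b‖ / δ) ^ n)
    (fun n => ?_) (fun n => ?_) ?_ ?_ ?_
  · refine hasSum_of_eq (fun n => ?_) key
    rw [intervalIntegral.integral_smul]
    rfl
  · exact (((hγ.intervalIntegrable_smul (f := fun ζ => (ζ - β₀) •
      (Ring.inverse (a - ζ • (1 : A)) * (-(b * Ring.inverse (a - ζ • (1 : A)))) ^ n))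
      (hcont n)).smul (t ^ n)).def').aestronglyMeasurable
  · refine ae_of_all _ fun τ hτ => ?_
    rw [uIoc_of_le zero_le_one] at hτ
    have h1 := norm_smul_inverse_mul_pow_le (b := b) ha hδ (h τ (Ioc_subset_Icc_self hτ)) n
    rw [norm_smul, norm_smul, norm_smul, norm_pow]
    calc ‖t‖ ^ n * (‖deriv γ τ‖ * (‖γ τ - β₀‖ * _))
        ≤ ‖t‖ ^ n * (‖deriv γ τ‖ * (‖γ τ - β₀‖ * (δ⁻¹ * (‖b‖ / δ) ^ n))) := by gcongr
      _ = _ := by rw [mul_div_assoc, mul_pow]; ring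
  · exact ae_of_all _ fun τ _ => (summable_geometric_of_lt_one hq0 hq).mul_left _
  · simp only [tsum_mul_left]
    exact ((hγ.intervalIntegrable_deriv.norm.mul_continuousOn
      (by rw [uIcc_of_le zero_le_one]; exact (hγ.1.sub continuousOn_const).norm)).mul_const
        _).mul_const _
  · refine ae_of_all _ fun τ hτ => ?_
    rw [uIoc_of_le zero_le_one] at hτ
    have h1 := (hasSum_inverse_add ha hδ (h τ (Ioc_subset_Icc_self hτ)) ht).2
    have h2 := (h1.const_smul (γ τ - β₀)).const_smul (deriv γ τ)
    refine hasSum_of_eq (fun n => ?_) h2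
    simp only [smul_comm (t ^ n)]

/-- The weight `ζ - β₀` kills the pole at `β₀`, and the contour does not wind around the rest of the
spectrum. -/
lemma seriesCoeff_zero (hγ : Separates γ (spectrum ℂ a) β₀) (ha : IsSelfAdjoint a) (hδ : 0 < δ)
    (h : ∀ t ∈ Icc (0 : ℝ) 1, ∀ s ∈ spectrum ℂ a, δ ≤ ‖γ t - s‖) :
    seriesCoeff γ β₀ a b 0 = 0 := by
  obtain ⟨hc, -, -, h0⟩ := hγ
  have hns := fun t ht => notMem_spectrum_of_le hδ (h t ht)
  -- The comparison is with a constant contour, all of whose winding numbers and integrals vanish.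
  have h1 : resolventIntegral γ β₀ a = resolventIntegral (fun _ => γ 0) β₀ a := by
    refine resolventIntegral_eq_of_windingNumber_eq hc ?_ β₀ ha hns
      (fun _ _ => hns 0 (by simp)) fun s hs => ?_
    · exact ⟨continuousOn_const, rfl, ∅, 0, fun t _ _ => by simp [continuousAt_const]⟩
    · by_cases hs0 : s = β₀
      · simp [hs0]
      · rw [h0 s hs hs0]; simp [windingNumber, contourIntegral]
  have h2 : seriesCoeff γ β₀ a b 0 = resolventIntegral γ β₀ a := by
    simp [seriesCoeff, resolventIntegral]
  rw [h2, h1]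
  simp [resolventIntegral, contourIntegral]

lemma exists_spectrum_norm_sub_lt (ha : IsSelfAdjoint a) (hδ : 0 < δ) {t : ℂ}
    (ht : ‖t‖ * ‖b‖ < δ) {ζ : ℂ} (hζ : ζ ∈ spectrum ℂ (a + t • b)) :
    ∃ s ∈ spectrum ℂ a, ‖ζ - s‖ < δ := by
  by_contra! h
  have := (hasSum_inverse_add ha hδ h ht).1
  rw [← IsUnit.neg_iff, neg_sub, ← Algebra.algebraMap_eq_smul_one] at this
  exact hζ this

/-- The contour can be moved without any homotopy. For small real `t` the spectrum of the
self-adjoint `a + t b` stays within `δ` of that of `a`, so both contours have the same winding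
numbers about it and the two integrals agree. Equality of the coefficients follows by uniqueness of
power series. -/
lemma seriesCoeff_eq (ha : IsSelfAdjoint a) (hb : IsSelfAdjoint b) (hδ : 0 < δ)
    (hγ : Separates γ (spectrum ℂ a) β₀) (hγ' : Separates γ' (spectrum ℂ a) β₀)
    (h : ∀ t ∈ Icc (0 : ℝ) 1, ∀ s ∈ spectrum ℂ a, δ ≤ ‖γ t - s‖)
    (h' : ∀ t ∈ Icc (0 : ℝ) 1, ∀ s ∈ spectrum ℂ a, δ ≤ ‖γ' t - s‖) (n : ℕ) :
    seriesCoeff γ β₀ a b n = seriesCoeff γ' β₀ a b n := by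
  rw [← sub_eq_zero]
  -- The summand 1 covers the case `b = 0`.
  have hε : 0 < δ / (‖b‖ + 1) := by positivity
  refine eq_zero_of_hasSum_pow_smul (c := fun n => seriesCoeff γ β₀ a b n - seriesCoeff γ' β₀ a b n)
    hε (fun t ht => ?_) n
  have ht' : ‖(t : ℂ)‖ * ‖b‖ < δ := by
    rw [Complex.norm_real, Real.norm_eq_abs]
    rw [lt_div_iff₀ (by positivity)] at ht
    nlinarith [abs_nonneg t, norm_nonneg b]
  have hsa : IsSelfAdjoint (a + (t : ℂ) • b) :=
    ha.add (IsSelfAdjoint.smul (Complex.conj_ofReal t) hb)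
  have h1 : resolventIntegral γ β₀ (a + (t : ℂ) • b) =
      resolventIntegral γ' β₀ (a + (t : ℂ) • b) := by
    have hns : ∀ η : ℝ → ℂ, (∀ t ∈ Icc (0 : ℝ) 1, ∀ s ∈ spectrum ℂ a, δ ≤ ‖η t - s‖) →
        ∀ τ ∈ Icc (0 : ℝ) 1, η τ ∉ spectrum ℂ (a + (t : ℂ) • b) := fun η hη τ hτ hs => by
      obtain ⟨s, hs, hlt⟩ := exists_spectrum_norm_sub_lt ha hδ ht' hs
      exact absurd (hη τ hτ s hs) hlt.not_ge
    refine resolventIntegral_eq_of_windingNumber_eq hγ.1 hγ'.1 β₀ hsa (hns γ h) (hns γ' h')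
      fun ζ hζ => ?_
    obtain ⟨s, hs, hlt⟩ := exists_spectrum_norm_sub_lt ha hδ ht' hζ
    rw [windingNumber_eq_of_norm_sub_lt hγ.1 (fun τ hτ => h τ hτ s hs) hlt,
      windingNumber_eq_of_norm_sub_lt hγ'.1 (fun τ hτ => h' τ hτ s hs) hlt]
    by_cases hs0 : s = β₀
    · rw [hs0, hγ.2.2.1, hγ'.2.2.1]
    · rw [hγ.2.2.2 s hs hs0, hγ'.2.2.2 s hs hs0]
  have h2 := (hasSum_seriesCoeff (b := b) hγ.1 ha hδ β₀ h ht').sub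
    (hasSum_seriesCoeff (b := b) hγ'.1 ha hδ β₀ h' ht')
  rw [h1, sub_self] at h2
  refine hasSum_of_eq (fun n => ?_) h2
  rw [← smul_sub, ← Complex.ofReal_pow, Complex.coe_smul]

/-- Otherwise the midpoint of `s` and `β₀` would be closer than `δ` to both, and its winding number
would be 0 and 1 at once. -/
lemma Separates.two_mul_le_norm_sub {σ : Set ℂ} (hγ : Separates γ σ β₀)
    (h : ∀ t ∈ Icc (0 : ℝ) 1, ∀ s ∈ σ, δ ≤ ‖γ t - s‖) {s : ℂ} (hs : s ∈ σ)
    (hne : s ≠ β₀) : 2 * δ ≤ ‖s - β₀‖ := by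
  by_contra! hlt
  have h1 : ‖(s + β₀) / 2 - s‖ < δ := by
    rw [show (s + β₀) / 2 - s = -((s - β₀) / 2) by ring, norm_neg, norm_div, Complex.norm_two]
    linarith
  have h2 : ‖(s + β₀) / 2 - β₀‖ < δ := by
    rw [show (s + β₀) / 2 - β₀ = (s - β₀) / 2 by ring, norm_div, Complex.norm_two]
    linarith
  have h3 := windingNumber_eq_of_norm_sub_lt hγ.1 (fun t ht => h t ht s hs) h1
  have h4 := windingNumber_eq_of_norm_sub_lt hγ.1 (fun t ht => h t ht β₀ hγ.2.1) h2
  rw [h3, hγ.2.2.1, hγ.2.2.2 s hs hne] at h4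
  exact zero_ne_one h4

lemma Separates.le_norm_unitCircleMap_sub {σ : Set ℂ} (hγ : Separates γ σ β₀) (hδ : 0 < δ)
    (h : ∀ t ∈ Icc (0 : ℝ) 1, ∀ s ∈ σ, δ ≤ ‖γ t - s‖) {s : ℂ} (hs : s ∈ σ) (t : ℝ) :
    δ ≤ ‖unitCircleMap β₀ δ t - s‖ := by
  have h1 := norm_unitCircleMap_sub β₀ hδ.le t
  by_cases hne : s = β₀
  · rw [hne, h1]
  · have h2 := hγ.two_mul_le_norm_sub h hs hne
    have h3 := norm_sub_norm_le (s - β₀) (unitCircleMap β₀ δ t - β₀)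
    rw [h1, sub_sub_sub_cancel_right, norm_sub_rev s (HighContrast.unitCircleMap β₀ δ t)] at h3
    linarith

lemma Separates.unitCircleMap {σ : Set ℂ} (hγ : Separates γ σ β₀) (hδ : 0 < δ)
    (h : ∀ t ∈ Icc (0 : ℝ) 1, ∀ s ∈ σ, δ ≤ ‖γ t - s‖) :
    Separates (unitCircleMap β₀ δ) σ β₀ := by
  refine ⟨isClosedContour_unitCircleMap β₀ hδ.le, hγ.2.1, windingNumber_unitCircleMap_self β₀ hδ,
    fun s hs hne => windingNumber_unitCircleMap_of_lt β₀ hδ ?_⟩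
  have := hγ.two_mul_le_norm_sub h hs hne
  linarith

/-- The original contour may be arbitrarily long, so the estimate is made on the circle of radius
`δ`, of length `2πδ`. -/
lemma norm_seriesCoeff_le (ha : IsSelfAdjoint a) (hb : IsSelfAdjoint b) (hδ : 0 < δ)
    (hγ : Separates γ (spectrum ℂ a) β₀)
    (h : ∀ t ∈ Icc (0 : ℝ) 1, ∀ s ∈ spectrum ℂ a, δ ≤ ‖γ t - s‖) (n : ℕ) :
    ‖seriesCoeff γ β₀ a b n‖ ≤ 2 * Real.pi * δ * (‖b‖ / δ) ^ n := by
  have h' := fun t (_ : t ∈ Icc (0 : ℝ) 1) s hs => hγ.le_norm_unitCircleMap_sub hδ h (s := s) hs t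
  rw [seriesCoeff_eq ha hb hδ hγ (hγ.unitCircleMap hδ h) h h']
  have key := intervalIntegral.norm_integral_le_of_norm_le_const (a := (0 : ℝ)) (b := 1)
    (C := 2 * Real.pi * δ * (‖b‖ / δ) ^ n) (f := fun t => deriv (HighContrast.unitCircleMap β₀ δ) t •
      ((HighContrast.unitCircleMap β₀ δ t - β₀) •
      (Ring.inverse (a - HighContrast.unitCircleMap β₀ δ t • (1 : A)) *
      (-(b * Ring.inverse (a - HighContrast.unitCircleMap β₀ δ t • (1 : A)))) ^ n))) fun t ht => ?_
  · rw [sub_zero, abs_one, mul_one] at key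
    exact key
  · rw [uIoc_of_le zero_le_one] at ht
    have h1 := norm_smul_inverse_mul_pow_le (b := b) ha hδ (h' t (Ioc_subset_Icc_self ht)) n
    rw [norm_smul, norm_smul, norm_deriv_unitCircleMap β₀ hδ.le, norm_unitCircleMap_sub β₀ hδ.le]
    -- On the circle the weight `|ζ - β₀| = δ` cancels the `δ⁻¹` of the leading resolvent.
    calc 2 * Real.pi * δ * (δ * _) ≤ 2 * Real.pi * δ * (δ * (δ⁻¹ * (‖b‖ / δ) ^ n)) := by
          gcongr
      _ = _ := by rw [mul_inv_cancel_left₀ hδ.ne']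

end Series

/-- The error bound for the perturbation series of an eigenvalue of `a + z b` inside a contour
which separates a point of the spectrum of the self-adjoint operator `a`. -/
theorem norm_eigenvalue_sub_sum_le {X : Type*} [NormedAddCommGroup X] [InnerProductSpace ℂ X]
    [CompleteSpace X] {a b : X →L[ℂ] X} (ha : IsSelfAdjoint a) (hb : IsSelfAdjoint b) {γ : ℝ → ℂ}
    {β₀ : ℂ} (hγ : Separates γ (spectrum ℂ a) β₀) {δ r : ℝ} (hδ : 0 < δ)
    (h : ∀ t ∈ Icc (0 : ℝ) 1, ∀ s ∈ spectrum ℂ a, δ ≤ ‖γ t - s‖)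
    {z : ℝ} (hz : |z| < r) (hbr : |z| * ‖b‖ ≤ |z| * (δ / r)) {φ : X} {β : ℂ} (hφ : ‖φ‖ = 1)
    (hβ : (a + (z : ℂ) • b) φ = β • φ) (hw : windingNumber γ β ≠ 0) {e : ℕ → ℂ} (he0 : e 0 = β₀)
    (he : ∀ n, e (n + 1) = -(2 * Real.pi * Complex.I)⁻¹ *
      ⟪φ, seriesCoeff γ β₀ a b (n + 1) φ⟫_ℂ) (p : ℕ) :
    ‖β - ∑ n ∈ Finset.range (p + 1), (z : ℂ) ^ n * e n‖ ≤
      δ * |z| ^ (p + 1) / (r ^ p * (r - |z|)) := by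
  have hr : 0 < r := (abs_nonneg z).trans_lt hz
  have hzb : ‖(z : ℂ)‖ * ‖b‖ < δ := by
    rw [Complex.norm_real, Real.norm_eq_abs]
    refine hbr.trans_lt ?_
    rw [← mul_div_assoc, div_lt_iff₀ hr, mul_comm]
    gcongr
  have hφ0 : φ ≠ 0 := fun h0 => by simp [h0] at hφ
  have happly : ∀ ζ : ℂ, (a + (z : ℂ) • b - ζ • (1 : X →L[ℂ] X)) φ = (β - ζ) • φ := fun ζ => by
    rw [sub_apply, hβ, sub_smul]
    simp
  have hβs : β ∈ spectrum ℂ (a + (z : ℂ) • b) := by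
    intro hu
    rw [spectrum.mem_resolventSet_iff, ← IsUnit.neg_iff, neg_sub,
      Algebra.algebraMap_eq_smul_one] at hu
    obtain ⟨u, hu⟩ := hu
    have h1 : (u : X →L[ℂ] X) φ = 0 := by rw [hu, happly, sub_self, zero_smul]
    have h2 : ((↑u⁻¹ : X →L[ℂ] X) * (u : X →L[ℂ] X)) φ = 0 := by
      rw [mul_apply_eq_comp, h1, map_zero]
    rw [Units.inv_mul] at h2
    exact hφ0 h2
  obtain ⟨s, hs, hlt⟩ := exists_spectrum_norm_sub_lt ha hδ hzb hβs
  have hws := windingNumber_eq_of_norm_sub_lt hγ.1 (fun τ hτ => h τ hτ s hs) hlt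
  -- The eigenvalue has the winding number of a nearby spectral point `s` of `a`, which is 0 unless
  -- `s = β₀`.
  have hw1 : windingNumber γ β = 1 := by
    by_cases hs0 : s = β₀
    · rw [hws, hs0, hγ.2.2.1]
    · exact absurd (hws.trans (hγ.2.2.2 s hs hs0)) hw
  have hne : ∀ t ∈ Icc (0 : ℝ) 1, γ t ≠ β := fun t ht h0 =>
    absurd (h t ht s hs) (h0 ▸ hlt.not_ge)
  have hunit := fun t ht => (hasSum_inverse_add (b := b) ha hδ (h t ht) hzb).1
  let L : (X →L[ℂ] X) →L[ℂ] ℂ := (innerSL ℂ φ).comp (ContinuousLinearMap.apply ℂ X φ)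
  have hL : ∀ T, L T = ⟪φ, T φ⟫_ℂ := fun T => rfl
  have hLI : L (resolventIntegral γ β₀ (a + (z : ℂ) • b)) =
      -(2 * Real.pi * Complex.I) * (β - β₀) := by
    have h1 := map_contourIntegral hγ.1 L (f := fun ζ => (ζ - β₀) •
      Ring.inverse (a + (z : ℂ) • b - ζ • (1 : X →L[ℂ] X)))
      (hγ.1.continuousOn_smul_inverse β₀ hunit)
    refine h1.trans ?_
    have h2 := contourIntegral_sub_mul_inv hγ.1 β₀ hne
    rw [hw1, mul_one] at h2
    rw [← h2]
    refine contourIntegral_congr fun t ht => ?_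
    obtain ⟨u, hu⟩ := hunit t ht
    have hβt : β - γ t ≠ 0 := sub_ne_zero.2 (hne t ht).symm
    -- On an eigenvector the resolvent acts as a scalar, so the operator integral reduces to a
    -- scalar one.
    have h3 : (↑u⁻¹ : X →L[ℂ] X) φ = (β - γ t)⁻¹ • φ := by
      have h4 : (u : X →L[ℂ] X) φ = (β - γ t) • φ := by rw [hu, happly]
      have h5 : ((↑u⁻¹ : X →L[ℂ] X) * (u : X →L[ℂ] X)) φ = (β - γ t) • (↑u⁻¹ : X →L[ℂ] X) φ := by
        rw [mul_apply_eq_comp, h4, map_smul]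
      rw [Units.inv_mul] at h5
      rw [eq_inv_smul_iff₀ hβt, ← h5]
      rfl
    rw [map_smul, hL, ← hu, Ring.inverse_unit, h3, inner_smul_right, inner_self_eq_norm_sq_to_K, hφ]
    simp
  have hsum := (hasSum_seriesCoeff (b := b) hγ.1 ha hδ β₀ h hzb).mapL L
  rw [hLI] at hsum
  let f : ℕ → ℂ := fun n => -(2 * Real.pi * Complex.I)⁻¹ * ((z : ℂ) ^ n * L (seriesCoeff γ β₀ a b n))
  have hf : HasSum f (β - β₀) := by
    have h1 := hsum.mul_left (-(2 * Real.pi * Complex.I)⁻¹)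
    rw [neg_mul, neg_mul, mul_neg, neg_neg, inv_mul_cancel_left₀ Complex.two_pi_I_ne_zero] at h1
    simpa only [map_smul, smul_eq_mul] using h1
  have hf0 : f 0 = 0 := by
    simp [f, seriesCoeff_zero hγ ha hδ h]
  have hfn : ∀ n, ‖f n‖ ≤ δ * (|z| / r) ^ n := fun n => by
    have h1 : ‖L (seriesCoeff γ β₀ a b n)‖ ≤ 2 * Real.pi * δ * (‖b‖ / δ) ^ n := by
      rw [hL]
      refine (norm_inner_le_norm _ _).trans ?_
      rw [hφ, one_mul]
      refine (ContinuousLinearMap.le_opNorm _ _).trans ?_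
      rw [hφ, mul_one]
      exact norm_seriesCoeff_le ha hb hδ hγ h n
    have h2 : |z| * (‖b‖ / δ) ≤ |z| / r := by
      rw [← mul_div_assoc, div_le_iff₀ hδ]
      calc |z| * ‖b‖ ≤ |z| * (δ / r) := hbr
        _ = |z| / r * δ := by ring
    have h3 : ‖(2 * Real.pi * Complex.I : ℂ)‖ = 2 * Real.pi := by
      simp [abs_of_pos Real.pi_pos]
    rw [norm_mul, norm_neg, norm_inv, h3, norm_mul, norm_pow, Complex.norm_real, Real.norm_eq_abs]
    calc (2 * Real.pi)⁻¹ * (|z| ^ n * ‖L (seriesCoeff γ β₀ a b n)‖)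
        ≤ (2 * Real.pi)⁻¹ * (|z| ^ n * (2 * Real.pi * δ * (‖b‖ / δ) ^ n)) := by gcongr
      _ = δ * (|z| * (‖b‖ / δ)) ^ n := by
          have := Real.pi_pos
          rw [mul_pow]
          field_simp
      _ ≤ δ * (|z| / r) ^ n := by gcongr
  have hq : |z| / r < 1 := (div_lt_one hr).2 hz
  have hq0 : 0 ≤ |z| / r := by positivity
  -- The zeroth terms differ: `f 0 = 0` while `e 0 = β₀`. This accounts for `f` summing to `β - β₀`
  -- whereas the partial sums of `e` approximate `β`.
  have htail : HasSum (fun n => f (n + (p + 1)))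
      (β - ∑ n ∈ Finset.range (p + 1), (z : ℂ) ^ n * e n) := by
    have h1 := (hasSum_nat_add_iff' (p + 1)).2 hf
    refine (congrArg (HasSum _) ?_).mp h1
    rw [Finset.sum_range_succ', Finset.sum_range_succ', hf0, he0]
    simp only [he, f, hL, pow_zero, one_mul, add_zero]
    rw [← sub_sub, sub_right_comm]
    refine congrArg (β - · - β₀) (Finset.sum_congr rfl fun n _ => ?_)
    ring
  have hgeom : HasSum (fun n => δ * (|z| / r) ^ (n + (p + 1)))
      (δ * (|z| / r) ^ (p + 1) * (1 - |z| / r)⁻¹) := by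
    have h1 := (hasSum_geometric_of_lt_one hq0 hq).mul_left (δ * (|z| / r) ^ (p + 1))
    refine hasSum_of_eq (fun n => ?_) h1
    rw [pow_add]; ring
  rw [← htail.tsum_eq]
  refine (tsum_of_norm_bounded hgeom fun n => hfn _).trans (le_of_eq ?_)
  have h1 : r - |z| ≠ 0 := (sub_pos.2 hz).ne'
  rw [div_pow, pow_succ r]
  field_simp

/-! ### The operators of an eigenvalue problem -/

/-- Pythagoras reduces the bound to Bessel's inequality for the sum of the projections. -/
lemma norm_sum_smul_starProjection_le {E ι : Type*} [NormedAddCommGroup E] [InnerProductSpace ℂ E]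
    {V : ι → Submodule ℂ E} [∀ i, (V i).HasOrthogonalProjection]
    (hV : ∀ i j, i ≠ j → V i ⟂ V j) (F : Finset ι) {c : ι → ℂ} {M : ℝ} (hM : 0 ≤ M)
    (hc : ∀ i ∈ F, ‖c i‖ ≤ M) (u : E) : ‖∑ i ∈ F, c i • (V i).starProjection u‖ ≤ M * ‖u‖ := by
  have hfam : OrthogonalFamily ℂ (fun i => V i) fun i => (V i).subtypeₗᵢ :=
    OrthogonalFamily.of_pairwise fun i j hij => hV i j hij
  have hsq : ∀ c : ι → ℂ, ‖∑ i ∈ F, c i • (V i).starProjection u‖ ^ 2 =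
      ∑ i ∈ F, (‖c i‖ * ‖(V i).starProjection u‖) ^ 2 := fun c => by
    have := hfam.norm_sum (fun i => c i • (V i).orthogonalProjectionOnto u) F
    simp only [norm_smul] at this
    exact this
  have hB : ‖∑ i ∈ F, (V i).starProjection u‖ ≤ ‖u‖ := by
    set w := ∑ i ∈ F, (V i).starProjection u with hw
    have h1 : ‖w‖ ^ 2 = ∑ i ∈ F, ‖(V i).starProjection u‖ ^ 2 := by
      simpa [hw] using hsq fun _ => 1
    -- Together with Cauchy-Schwarz this gives `‖w‖² ≤ ‖w‖ ‖u‖`, which is Bessel's inequality.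
    have h2 : (⟪w, u⟫_ℂ) = ((‖w‖ ^ 2 : ℝ) : ℂ) := by
      rw [h1, hw, sum_inner]
      push_cast
      refine Finset.sum_congr rfl fun i _ => ?_
      have h3 : (V i).starProjection ((V i).starProjection u) = (V i).starProjection u :=
        Submodule.starProjection_eq_self_iff.2 (Submodule.starProjection_apply_mem _ u)
      conv_lhs => rw [← h3, Submodule.inner_starProjection_left_eq_right]
      rw [inner_self_eq_norm_sq_to_K]
      rfl
    have h3 := norm_inner_le_norm (𝕜 := ℂ) w u
    rw [h2, Complex.norm_real, Real.norm_of_nonneg (sq_nonneg _)] at h3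
    nlinarith [norm_nonneg w, norm_nonneg u]
  refine le_of_sq_le_sq ?_ (by positivity)
  have h1 : ∑ i ∈ F, ‖(V i).starProjection u‖ ^ 2 ≤ ‖u‖ ^ 2 := by
    have := hsq fun _ => 1
    simp only [one_smul, norm_one, one_mul] at this
    rw [← this]
    gcongr
  rw [hsq, mul_pow]
  calc ∑ i ∈ F, (‖c i‖ * ‖(V i).starProjection u‖) ^ 2
      ≤ ∑ i ∈ F, M ^ 2 * ‖(V i).starProjection u‖ ^ 2 := by
        refine Finset.sum_le_sum fun i hi => ?_
        rw [mul_pow]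
        have := hc i hi
        gcongr
    _ = M ^ 2 * ∑ i ∈ F, ‖(V i).starProjection u‖ ^ 2 := by rw [Finset.mul_sum]
    _ ≤ _ := by gcongr

namespace FunctionSpaces

variable {d : ℕ} (S : FunctionSpaces d) (D : Set (Space d))

/-- A Poincaré inequality bounds the embedding of the energy space. -/
lemma norm_embed_sq_le {Λ : ℝ} (hΛ : 0 < Λ)
    (hP : ∀ p ∈ S.pairs, Λ * ‖p.1‖ ^ 2 ≤ ‖p.2‖ ^ 2) : ‖S.embed‖ ^ 2 ≤ Λ⁻¹ := by
  by_cases h : ∃ J : S.energy →L[ℂ] S.base,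
      ∀ p ∈ S.pairs, ∀ hp : p.2 ∈ S.energy, (J ⟨p.2, hp⟩ : L2 d) = p.1
  swap
  -- The default value zero satisfies the bound trivially.
  · rw [embed, dif_neg h]
    have h0 : ‖(0 : S.energy →L[ℂ] S.base)‖ = 0 := ContinuousLinearMap.opNorm_zero
    rw [h0, zero_pow two_ne_zero]
    exact inv_nonneg.2 hΛ.le
  have hJ : ∀ p ∈ S.pairs, ∀ hp : p.2 ∈ S.energy, (S.embed ⟨p.2, hp⟩ : L2 d) = p.1 := by
    rw [embed, dif_pos h]
    exact h.choose_spec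
  -- The gradients of the pairs are dense in the energy space, so the Poincaré inequality passes to
  -- the limit.
  have key : ∀ g : S.energy, Λ * ‖S.embed g‖ ^ 2 ≤ ‖g‖ ^ 2 := fun g => by
    obtain ⟨x, hx, hlim⟩ := mem_closure_iff_seq_limit.1 (show (g : L2Field d) ∈ closure _ from g.2)
    have hxe : ∀ n, x n ∈ S.energy := fun n => subset_closure (hx n)
    have hlim' : Filter.Tendsto (fun n => (⟨x n, hxe n⟩ : S.energy)) Filter.atTop (nhds g) :=
      tendsto_subtype_rng.2 hlim
    refine le_of_tendsto_of_tendsto' ((((S.embed.continuous.tendsto g).comp hlim').norm.pow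
      2).const_mul Λ) (hlim'.norm.pow 2) fun n => ?_
    obtain ⟨p, hp, hpx⟩ := hx n
    have h1 := hJ p hp (by rw [show p.2 = x n from hpx]; exact hxe n)
    have h2 : (⟨p.2, by rw [show p.2 = x n from hpx]; exact hxe n⟩ : S.energy) = ⟨x n, hxe n⟩ :=
      Subtype.ext hpx
    rw [h2] at h1
    have h3 := hP p hp
    rw [← h1, show p.2 = x n from hpx] at h3
    exact h3
  have hb : ‖S.embed‖ ≤ Real.sqrt Λ⁻¹ := by
    refine ContinuousLinearMap.opNorm_le_bound _ (Real.sqrt_nonneg _) fun g => ?_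
    refine le_of_sq_le_sq ?_ (by positivity)
    rw [mul_pow, Real.sq_sqrt (by positivity), inv_mul_eq_div, le_div_iff₀ hΛ, mul_comm]
    exact key g
  calc ‖S.embed‖ ^ 2 ≤ Real.sqrt Λ⁻¹ ^ 2 := by gcongr
    _ = Λ⁻¹ := Real.sq_sqrt (by positivity)

lemma resonanceForm_conj (u v : S.energy) :
    (starRingEnd ℂ) (S.resonanceForm D v u) = S.resonanceForm D u v := by
  simp only [resonanceForm, map_sub, map_mul, ← integral_conj, inner_conj_symm]
  simp [Complex.conj_ofNat]

/-- The form is Hermitian and the eigenvalues are real, so the usual argument applies: `(μ - ν) ⟪u,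
v⟫ = 0`. -/
lemma isOrtho_resonanceSpace {μ ν : ℝ} (h : μ ≠ ν) :
    S.resonanceSpace D μ ⟂ S.resonanceSpace D ν := by
  rw [Submodule.isOrtho_iff_inner_eq]
  intro u hu v hv
  have h1 := hv.2 u hu.1
  have h2 := hu.2 v hv.1
  have h0 : (starRingEnd ℂ) ⟪v, u⟫_ℂ = ⟪u, v⟫_ℂ := inner_conj_symm u v
  rw [← resonanceForm_conj, h2, map_mul, Complex.conj_ofReal, h0] at h1
  have h3 : ((μ : ℂ) - ν) * ⟪u, v⟫_ℂ = 0 := by rw [sub_mul, h1, sub_self]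
  exact (mul_eq_zero.1 h3).resolve_left (sub_ne_zero.2 (by exact_mod_cast h))

lemma isOrtho_W₁_resonanceSpace (μ : ℝ) : S.W₁ D ⟂ S.resonanceSpace D μ := by
  rw [Submodule.isOrtho_iff_inner_eq]
  intro u hu v hv
  exact hv.1 u (Submodule.mem_sup_left hu)

lemma isOrtho_topologicalClosure {E : Type*} [NormedAddCommGroup E] [InnerProductSpace ℂ E]
    {U V : Submodule ℂ E} (h : U ⟂ V) : U.topologicalClosure ⟂ V.topologicalClosure := by
  rw [Submodule.isOrtho_iff_le, Submodule.orthogonal_closure]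
  exact Submodule.topologicalClosure_minimal _ h V.isClosed_orthogonal

/-- The ranges of the orthogonal projections in the definition of `A(z)`: the space `W₁` and the
resonance eigenspaces. -/
def spectralFamily : Option ℝ → Submodule ℂ S.energy
  | none => (S.W₁ D).topologicalClosure
  | some μ => (S.resonanceSpace D μ).topologicalClosure

instance instCompleteSpectralFamily (i : Option ℝ) : CompleteSpace (S.spectralFamily D i) := by
  cases i <;> unfold spectralFamily <;> infer_instance

lemma isOrtho_spectralFamily (i j : Option ℝ) (h : i ≠ j) :
    S.spectralFamily D i ⟂ S.spectralFamily D j := by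
  match i, j with
  | none, none => exact absurd rfl h
  | none, some μ => exact isOrtho_topologicalClosure (S.isOrtho_W₁_resonanceSpace D μ)
  | some μ, none => exact (isOrtho_topologicalClosure (S.isOrtho_W₁_resonanceSpace D μ)).symm
  | some μ, some ν =>
    exact isOrtho_topologicalClosure (S.isOrtho_resonanceSpace D fun h' => h (congrArg some h'))

/-- The coefficient `[(1/2 + μ) + z (1/2 - μ)]⁻¹`. -/
def resonanceCoeff (z : ℂ) (μ : ℝ) : ℂ := ((1 / 2 + (μ : ℂ)) + z * (1 / 2 - (μ : ℂ)))⁻¹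

/-- Both alternatives lead to the same self-adjointness and norm bound, so the convergence of the
series need not be decided. -/
lemma resonanceSeries_hasSum_or (z : ℂ) : S.resonanceSeries D z = 0 ∨ ∀ u,
    HasSum (fun μ : {μ : ℝ // μ ∈ Ioo (-1 / 2 : ℝ) (1 / 2) ∧ S.IsResonance D μ} =>
      resonanceCoeff z μ • S.proj (S.resonanceSpace D μ) u) (S.resonanceSeries D z u) := by
  by_cases h : ∃ L : S.energy →L[ℂ] S.energy, ∀ u,
      HasSum (fun μ : {μ : ℝ // μ ∈ Ioo (-1 / 2 : ℝ) (1 / 2) ∧ S.IsResonance D μ} =>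
        ((1 / 2 + (μ : ℂ)) + z * (1 / 2 - (μ : ℂ)))⁻¹ • S.proj (S.resonanceSpace D μ) u) (L u)
  · right
    rw [resonanceSeries, dif_pos h]
    exact h.choose_spec
  · left
    rw [resonanceSeries, dif_neg h]

lemma isSelfAdjoint_proj (W : Submodule ℂ S.energy) : IsSelfAdjoint (S.proj W) :=
  isSelfAdjoint_starProjection _

lemma isSelfAdjoint_P₁ : IsSelfAdjoint (S.P₁ D) :=
  IsSelfAdjoint.add (R := S.energy →L[ℂ] S.energy) (S.isSelfAdjoint_proj _) (S.isSelfAdjoint_proj _)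

/-- For real `z` the coefficients are real, so each term is self-adjoint; symmetry passes to the
strong limit by uniqueness of sums. -/
lemma isSelfAdjoint_resonanceSeries (z : ℝ) : IsSelfAdjoint (S.resonanceSeries D z) := by
  rcases S.resonanceSeries_hasSum_or D z with h | h
  · rw [h]; exact IsSelfAdjoint.zero (R := S.energy →L[ℂ] S.energy)
  rw [ContinuousLinearMap.isSelfAdjoint_iff_isSymmetric]
  intro u v
  have h1 := (Complex.hasSum_conj').2 ((h u).mapL (innerSL ℂ v))
  have h2 := (h v).mapL (innerSL ℂ u)
  simp only [innerSL_apply_apply, inner_conj_symm] at h1 h2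
  refine HasSum.unique h1 (hasSum_of_eq (fun μ => ?_) h2)
  have hc : (starRingEnd ℂ) (resonanceCoeff z μ) = resonanceCoeff z μ := by
    simp [resonanceCoeff, Complex.conj_ofNat]
  have h3 : ∀ x y : S.energy, ⟪resonanceCoeff z μ • x, y⟫_ℂ = ⟪x, resonanceCoeff z μ • y⟫_ℂ :=
    fun x y => by
      refine (inner_smul_left x y _).trans ?_
      rw [hc]
      exact (inner_smul_right x y _).symm
  refine ((h3 _ _).trans ?_).symm
  rw [← map_smul]
  exact Submodule.inner_starProjection_left_eq_right _ u _

/-- The projections onto `W₁` and the resonance spaces have mutually orthogonal ranges, so finite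
partial sums are bounded by the largest coefficient, and the bound survives the strong limit. The
coefficient 1 of `P₁` is the reason for `1 ≤ M`. -/
lemma norm_P₁_add_resonanceSeries_le (z : ℂ) {M : ℝ} (hM : 1 ≤ M)
    (hc : ∀ μ ∈ Ioo (-1 / 2 : ℝ) (1 / 2), S.IsResonance D μ → ‖resonanceCoeff z μ‖ ≤ M) :
    ‖S.P₁ D + S.resonanceSeries D z‖ ≤ M := by
  classical
  have hM0 : 0 ≤ M := zero_le_one.trans hM
  let ι := {μ : ℝ // μ ∈ Ioo (-1 / 2 : ℝ) (1 / 2) ∧ S.IsResonance D μ}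
  have hfin : ∀ (F : Finset ι) (u : S.energy),
      ‖S.P₁ D u + ∑ μ ∈ F, resonanceCoeff z μ • S.proj (S.resonanceSpace D μ) u‖ ≤ M * ‖u‖ := by
    intro F u
    let c : Option ℝ → ℂ := fun i => i.elim 1 fun μ => resonanceCoeff z μ
    let e : ι ↪ Option ℝ := ⟨fun μ => some μ.1, fun μ ν h => Subtype.ext (Option.some.inj h)⟩
    -- The resonance `μ = 1/2` fits the general formula for the coefficients.
    have hhalf : resonanceCoeff z (1 / 2) = 1 := by
      simp [resonanceCoeff]; norm_num
    have h1 : some (1 / 2 : ℝ) ∉ F.map e := fun h => by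
      obtain ⟨μ, -, hμ⟩ := Finset.mem_map.1 h
      have := μ.2.1.2
      rw [show μ.1 = 1 / 2 from Option.some.inj hμ] at this
      exact lt_irrefl _ this
    have h2 : (none : Option ℝ) ∉ insert (some (1 / 2 : ℝ)) (F.map e) := fun h => by
      rcases Finset.mem_insert.1 h with h | h
      · cases h
      · obtain ⟨μ, -, hμ⟩ := Finset.mem_map.1 h
        cases hμ
    have := norm_sum_smul_starProjection_le (S.isOrtho_spectralFamily D)
      (insert none (insert (some (1 / 2 : ℝ)) (F.map e))) (c := c) hM0 ?_ u
    · rw [Finset.sum_insert h2, Finset.sum_insert h1, Finset.sum_map] at this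
      convert this using 2
      rw [← add_assoc]
      congr 1
      change S.proj _ u + S.proj _ u = (1 : ℂ) • S.proj _ u +
        resonanceCoeff z (1 / 2) • S.proj _ u
      rw [hhalf, one_smul, one_smul]
    · intro i hi
      rcases Finset.mem_insert.1 hi with rfl | hi
      · simpa [c] using hM
      rcases Finset.mem_insert.1 hi with rfl | hi
      · change ‖resonanceCoeff z (1 / 2)‖ ≤ M
        rw [hhalf]; simpa using hM
      · obtain ⟨μ, -, rfl⟩ := Finset.mem_map.1 hi
        exact hc μ μ.2.1 μ.2.2
  refine ContinuousLinearMap.opNorm_le_bound _ hM0 fun u => ?_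
  rcases S.resonanceSeries_hasSum_or D z with h | h
  · rw [h]
    simpa using hfin ∅ u
  · exact le_of_tendsto ((h u).const_add _).norm (Filter.Eventually.of_forall fun F => hfin F u)

/-- The operator `K(z) (-Δ)⁻¹` on `L²`, so that `A(z) = A(0) + z K(z) (-Δ)⁻¹`. -/
def increment (z : ℂ) : S.base →L[ℂ] S.base :=
  S.embed ∘L (S.P₁ D + S.resonanceSeries D z) ∘L S.invLaplacian

/-- At `z = 0` the prefactor `z` kills everything except the `P₂` term. -/
lemma A_eq (z : ℂ) : S.A D z = S.A D 0 + z • S.increment D z := by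
  ext1 f
  simp only [A, increment, zero_smul, zero_add, add_zero, add_apply,
    ContinuousLinearMap.comp_apply, smul_apply, map_add, map_smul, smul_add]
  abel

lemma isSelfAdjoint_A_zero : IsSelfAdjoint (S.A D 0) := by
  have : S.A D 0 = S.embed ∘L S.P₂ D ∘L ContinuousLinearMap.adjoint S.embed := by
    ext1 f
    simp [A, invLaplacian]
  rw [this]
  exact (S.isSelfAdjoint_proj _).conj_adjoint S.embed

lemma isSelfAdjoint_increment (z : ℝ) : IsSelfAdjoint (S.increment D z) :=
  ((S.isSelfAdjoint_P₁ D).add (S.isSelfAdjoint_resonanceSeries D z)).conj_adjoint S.embed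

/-- The embedding enters twice, since the inverse Laplacian is its adjoint; hence the factor
`‖embed‖² ≤ Λ⁻¹`. -/
lemma norm_increment_le {Λ : ℝ} (hΛ : 0 < Λ) (hP : ∀ p ∈ S.pairs, Λ * ‖p.1‖ ^ 2 ≤ ‖p.2‖ ^ 2)
    (z : ℂ) {M : ℝ} (hM : ‖S.P₁ D + S.resonanceSeries D z‖ ≤ M) :
    ‖S.increment D z‖ ≤ M * Λ⁻¹ := by
  have h1 := S.norm_embed_sq_le hΛ hP
  have hM0 : 0 ≤ M := (norm_nonneg (S.P₁ D + S.resonanceSeries D z)).trans hM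
  calc ‖S.increment D z‖ ≤ ‖S.embed‖ * (‖S.P₁ D + S.resonanceSeries D z‖ * ‖S.embed‖) := by
        refine (ContinuousLinearMap.opNorm_comp_le _ _).trans ?_
        gcongr
        refine (ContinuousLinearMap.opNorm_comp_le _ _).trans ?_
        rw [invLaplacian, LinearIsometryEquiv.norm_map]
    _ ≤ ‖S.embed‖ * (M * ‖S.embed‖) := by gcongr
    _ = M * ‖S.embed‖ ^ 2 := by ring
    _ ≤ _ := by gcongr

lemma eigCoeff_succ (γ : ℝ → ℂ) (β₀ z : ℂ) (φ : S.base) (n : ℕ) :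
    eigCoeff S D γ β₀ z φ (n + 1) = -(2 * Real.pi * Complex.I)⁻¹ *
      ⟪φ, seriesCoeff γ β₀ (S.A D 0) (S.increment D z) (n + 1) φ⟫_ℂ := rfl

/-- The error estimate for the eigenvalue series, given the Poincaré inequality. -/
theorem norm_eigenvalue_sub_le {Λ : ℝ} (hΛ : 0 < Λ)
    (hP : ∀ p ∈ S.pairs, Λ * ‖p.1‖ ^ 2 ≤ ‖p.2‖ ^ 2) (γ : ℝ → ℂ) (β₀ : ℂ) (μs : ℝ)
    (hγ : Separates γ (spectrum ℂ (S.A D 0)) β₀) (hμ1 : -1 / 2 < μs) (hμ2 : μs < 1 / 2)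
    (hμ : ∀ μ : ℝ, S.IsResonance D μ → μs ≤ μ) (dhat r : ℝ)
    (hd : dhat = contourDist γ (spectrum ℂ (S.A D 0))) (hr : r = rStar Λ dhat μs) (z : ℝ)
    (hz : |z| < r) (φ : S.base) (β : ℂ) (hφ : ‖φ‖ = 1) (hβ : S.A D z φ = β • φ)
    (hw : windingNumber γ β ≠ 0) (p : ℕ) :
    ‖β - ∑ n ∈ Finset.range (p + 1), (z : ℂ) ^ n * eigCoeff S D γ β₀ z φ n‖ ≤
      dhat * |z| ^ (p + 1) / (r ^ p * (r - |z|)) := by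
  have hr0 : 0 < r := (abs_nonneg z).trans_lt hz
  have hd0 : 0 ≤ dhat := hd ▸ Real.iInf_nonneg fun _ => Metric.infDist_nonneg
  -- If the contour touched the spectrum then `r` would vanish, leaving no room for `|z| < r`.
  have hdpos : 0 < dhat := hd0.lt_of_ne fun h => by
    rw [hr, ← h] at hr0
    simp [rStar] at hr0
  have hdist : ∀ t ∈ Icc (0 : ℝ) 1, ∀ s ∈ spectrum ℂ (S.A D 0), dhat ≤ ‖γ t - s‖ := by
    intro t ht s hs
    rw [hd, ← dist_eq_norm]
    exact (ciInf_le ⟨0, by rintro _ ⟨t, rfl⟩; exact Metric.infDist_nonneg⟩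
      (⟨t, ht⟩ : Icc (0 : ℝ) 1)).trans (Metric.infDist_le_dist_of_mem hs)
  set κ := 1 / 2 - μs with hκ
  have hκ0 : 0 < κ := by rw [hκ]; linarith
  have hm : |zStar μs| = (μs + 1 / 2) / κ := by
    rw [zStar, show μs - 1 / 2 = -κ by rw [hκ]; ring, div_neg, abs_neg, abs_of_pos]
    exact div_pos (by linarith) hκ0
  set m := (μs + 1 / 2) / κ with hm'
  have hm0 : 0 < m := div_pos (by linarith) hκ0
  have hκm : κ * m = μs + 1 / 2 := by rw [hm']; field_simp
  have hL : 0 < Λ * dhat := by positivity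
  -- Equivalently `r = κ Λ d̂ (m - r)`: the radius is a fixed point of the bound on `d̂ /
  -- ‖increment‖`.
  have hr2 : r * (1 + κ * (Λ * dhat)) = κ * (Λ * dhat) * m := by
    rw [hr, rStar, hm, ← hκ]
    field_simp
  have hrm : r ≤ κ * (Λ * dhat) * (m - |z|) := by
    have : 0 < κ * (Λ * dhat) := by positivity
    nlinarith
  have hmz : 0 < m - |z| := by
    by_contra! h
    have : κ * (Λ * dhat) * (m - |z|) ≤ 0 := mul_nonpos_of_nonneg_of_nonpos (by positivity) h
    linarith
  have hκz : 0 < κ * (m - |z|) := by positivity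
  -- The denominator is at least `(1/2 + μ) - |z| (1/2 - μ)`, which increases with `μ` and equals `κ
  -- (m - |z|)` at `μ = μs`. This value is at most 1 because `κ m = μs + 1/2 < 1`.
  have hK : ‖S.P₁ D + S.resonanceSeries D z‖ ≤ (κ * (m - |z|))⁻¹ := by
    refine S.norm_P₁_add_resonanceSeries_le D z ?_ fun μ hμI hres => ?_
    · rw [one_le_inv₀ hκz, mul_sub, hκm]
      nlinarith [abs_nonneg z]
    · have h1 := hμ μ hres
      have h2 : resonanceCoeff z μ = (((1 / 2 + μ) + z * (1 / 2 - μ) : ℝ) : ℂ)⁻¹ := by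
        rw [resonanceCoeff]; push_cast; rfl
      rw [h2, norm_inv, Complex.norm_real, Real.norm_eq_abs]
      refine inv_anti₀ hκz (le_trans ?_ (le_abs_self _))
      have h3 : -|z| * (1 / 2 - μ) ≤ z * (1 / 2 - μ) :=
        mul_le_mul_of_nonneg_right (neg_abs_le z) (by linarith [hμI.2])
      rw [mul_sub, hκm, hκ]
      nlinarith [abs_nonneg z, mul_nonneg (abs_nonneg z) (sub_nonneg.2 h1)]
  have hB := S.norm_increment_le D hΛ hP z hK
  have hB2 : ‖S.increment D z‖ ≤ dhat / r := by
    refine hB.trans ?_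
    rw [← mul_inv, ← one_div, div_le_div_iff₀ (by positivity) hr0]
    linarith
  refine norm_eigenvalue_sub_sum_le (S.isSelfAdjoint_A_zero D) (S.isSelfAdjoint_increment D z)
    hγ hdpos hdist hz (by gcongr) hφ ?_ hw rfl (fun n => S.eigCoeff_succ D γ β₀ z φ n) p
  rw [← A_eq]
  exact hβ

end FunctionSpaces

/-! ### Folding and Fourier series on the cell -/

/-- Lebesgue measure on the interval `(0,1]`. -/
abbrev unitMeasure : Measure ℝ := volume.restrict (Ioc 0 1)

instance instIsProbabilityMeasureUnit : IsProbabilityMeasure unitMeasure := ⟨by simp⟩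

/-- Lebesgue measure on the cell, in coordinates. -/
abbrev boxMeasure (d : ℕ) : Measure (Fin d → ℝ) := Measure.pi fun _ => unitMeasure

lemma measurePreserving_ofLp_cell (d : ℕ) :
    MeasurePreserving (WithLp.ofLp : Space d → Fin d → ℝ) (cellMeasure d) (boxMeasure d) := by
  have h := (PiLp.volume_preserving_ofLp (Fin d)).restrict_preimage
    (MeasurableSet.univ_pi fun _ : Fin d => measurableSet_Ioc (a := (0 : ℝ)) (b := 1))
  rw [volume_pi, Measure.restrict_pi_pi] at h
  have h2 : (WithLp.ofLp : Space d → Fin d → ℝ) ⁻¹' (univ.pi fun _ => Ioc (0 : ℝ) 1) = cell d := by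
    ext x; simp [cell]
  rwa [h2] at h

lemma measurePreserving_toLp_cell (d : ℕ) :
    MeasurePreserving (WithLp.toLp 2 : (Fin d → ℝ) → Space d) (boxMeasure d) (cellMeasure d) :=
  MeasurePreserving.symm (MeasurableEquiv.toLp 2 (Fin d → ℝ)).symm (measurePreserving_ofLp_cell d)

lemma integral_cellMeasure_eq {d : ℕ} {F : Type*} [NormedAddCommGroup F] [NormedSpace ℝ F]
    (f : Space d → F) :
    ∫ x, f x ∂cellMeasure d = ∫ x, f (WithLp.toLp 2 x) ∂boxMeasure d :=
  ((measurePreserving_toLp_cell d).integral_comp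
    (MeasurableEquiv.toLp 2 (Fin d → ℝ)).measurableEmbedding f).symm

lemma ae_boxMeasure_mem_Ioo (d : ℕ) : ∀ᵐ x ∂boxMeasure d, ∀ i, x i ∈ Ioo (0 : ℝ) 1 := by
  refine ae_all_iff.2 fun i => ?_
  have h : ∀ᵐ y ∂unitMeasure, y ∈ Ioo (0 : ℝ) 1 := by
    rw [unitMeasure, ← Measure.restrict_congr_set Ioo_ae_eq_Ioc]
    exact ae_restrict_mem measurableSet_Ioo
  exact (Measure.quasiMeasurePreserving_eval (fun _ : Fin d => unitMeasure) i).ae h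

/-- The measure on the two point space which gives both points mass `c`. -/
def boolMeasure (c : NNReal) : Measure Bool := c • (Measure.dirac true + Measure.dirac false)

instance instIsFiniteMeasureBool (c : NNReal) : IsFiniteMeasure (boolMeasure c) := by
  unfold boolMeasure; infer_instance

instance instIsProbabilityMeasureBool : IsProbabilityMeasure (boolMeasure 2⁻¹) := by
  refine ⟨?_⟩
  simp only [boolMeasure, Measure.smul_apply, Measure.add_apply, measure_univ]
  rw [ENNReal.smul_def, smul_eq_mul, one_add_one_eq_two, ENNReal.coe_inv two_ne_zero]
  exact ENNReal.inv_mul_cancel (by simp) (by simp)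

lemma integral_boolMeasure {F : Type*} [NormedAddCommGroup F] [NormedSpace ℝ F] [CompleteSpace F]
    (c : NNReal) (f : Bool → F) : ∫ b, f b ∂boolMeasure c = (c : ℝ) • (f true + f false) := by
  rw [boolMeasure, integral_smul_nnreal_measure, integral_add_measure (.of_finite) (.of_finite),
    integral_dirac, integral_dirac]
  rfl

lemma map_boolMeasure_prod {Y : Type*} [MeasurableSpace Y] (c : NNReal) {ψ : Bool × ℝ → Y}
    (hψ : Measurable ψ) (μ : Measure ℝ) [SFinite μ] :
    ((boolMeasure c).prod μ).map ψ =
      c • (μ.map (fun x => ψ (true, x)) + μ.map fun x => ψ (false, x)) := by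
  rw [boolMeasure, Measure.prod_smul_left, Measure.add_prod, Measure.dirac_prod, Measure.dirac_prod,
    Measure.map_smul, Measure.map_add _ _ hψ, Measure.map_map hψ measurable_prodMk_left,
    Measure.map_map hψ measurable_prodMk_left]
  rfl

/-! ### Integrals over products of folded intervals -/

section Fold

variable {d : ℕ} {Y : Type*} [MeasurableSpace Y] {ν : Measure Y} [SigmaFinite ν] {c : NNReal}
  {ψ : Bool × ℝ → Y}

lemma measurePreserving_fold (d : ℕ)
    (hψ : MeasurePreserving ψ ((boolMeasure c).prod unitMeasure) ν) :
    MeasurePreserving (fun (y : (Fin d → Bool) × (Fin d → ℝ)) i => ψ (y.1 i, y.2 i))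
      ((Measure.pi fun _ => boolMeasure c).prod (boxMeasure d)) (Measure.pi fun _ => ν) := by
  have h1 := measurePreserving_pi (fun _ : Fin d => (boolMeasure c).prod unitMeasure)
    (fun _ => ν) fun _ => hψ
  have h2 := (measurePreserving_arrowProdEquivProdArrow Bool ℝ (Fin d)
    (fun _ => boolMeasure c) (fun _ => unitMeasure)).symm
  exact h1.comp h2

/-- Integration over a power of `Y` of a function whose pull-back to the product of `{±1}^d` and the
cell is a product. -/
lemma integral_pi_eq_integral_boxMeasure
    (hψ : MeasurePreserving ψ ((boolMeasure c).prod unitMeasure) ν) {F : (Fin d → Y) → ℂ}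
    (hF : Integrable F (Measure.pi fun _ => ν)) {h : (Fin d → ℝ) → ℂ}
    {w : Fin d → Bool → ℝ → ℂ}
    (hFw : ∀ x : Fin d → ℝ, (∀ i, x i ∈ Ioo (0 : ℝ) 1) → ∀ b : Fin d → Bool,
      F (fun i => ψ (b i, x i)) = h x * ∏ i, w i (b i) (x i)) :
    ∫ y, F y ∂(Measure.pi fun _ => ν) =
      ∫ x, h x * ∏ i, ((c : ℂ) * (w i true (x i) + w i false (x i))) ∂boxMeasure d := by
  have hmp := measurePreserving_fold d hψ
  have hint := (hmp.integrable_comp hF.aestronglyMeasurable).2 hF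
  rw [← hmp.map_eq, integral_map hmp.measurable.aemeasurable
    (hmp.map_eq ▸ hF.aestronglyMeasurable)]
  rw [show (fun y : (Fin d → Bool) × (Fin d → ℝ) => F fun i => ψ (y.1 i, y.2 i)) =
    F ∘ fun (y : (Fin d → Bool) × (Fin d → ℝ)) i => ψ (y.1 i, y.2 i) from rfl,
    integral_prod_symm _ hint]
  refine integral_congr_ae ?_
  filter_upwards [ae_boxMeasure_mem_Ioo d] with x hx
  simp only [Function.comp_apply, hFw x hx]
  -- For fixed `x` the integral over the sheets `{true, false}^d` factors over the coordinates.
  rw [integral_const_mul, integral_fintype_prod_eq_prod (𝕜 := ℂ) (fun i b => w i b (x i))]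
  simp [integral_boolMeasure, mul_add]

end Fold

/-- Parseval's identity on the torus. -/
lemma hasSum_sq_integral_mFourier {d : ℕ} {F : (Fin d → UnitAddCircle) → ℂ}
    (hF : MemLp F 2 (Measure.pi fun _ => AddCircle.haarAddCircle)) :
    HasSum (fun n : Fin d → ℤ => ‖∫ t, (∏ i, fourier (-n i) (t i)) * F t
        ∂(Measure.pi fun _ => AddCircle.haarAddCircle)‖ ^ 2)
      (∫ t, ‖F t‖ ^ 2 ∂(Measure.pi fun _ => AddCircle.haarAddCircle)) := by
  have h := UnitAddTorus.hasSum_sq_mFourierCoeff (d := Fin d) (hF.toLp F)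
  have h1 : ∫ t, ‖hF.toLp F t‖ ^ 2 ∂(Measure.pi fun _ => AddCircle.haarAddCircle) =
      ∫ t, ‖F t‖ ^ 2 ∂(Measure.pi fun _ => AddCircle.haarAddCircle) :=
    integral_congr_ae (hF.coeFn_toLp.mono fun t ht => by simp only [ht])
  have h2 : ∀ n : Fin d → ℤ, UnitAddTorus.mFourierCoeff (hF.toLp F) n =
      ∫ t, (∏ i, fourier (-n i) (t i)) * F t ∂(Measure.pi fun _ => AddCircle.haarAddCircle) :=
    fun n => integral_congr_ae (hF.coeFn_toLp.mono fun t ht => by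
      change _ • _ = _
      rw [ht]; rfl)
  rw [← h1]
  exact hasSum_of_eq (fun n => by rw [h2]) h

lemma haarAddCircle_eq : (AddCircle.haarAddCircle : Measure UnitAddCircle) = volume := by
  rw [AddCircle.volume_eq_smul_haarAddCircle]; simp

/-- Parseval's identity on the cell, for the functions that arise by folding the circle. -/
lemma hasSum_sq_integral_fold {d : ℕ} {ψ : Bool × ℝ → UnitAddCircle}
    (hψ : MeasurePreserving ψ ((boolMeasure 2⁻¹).prod unitMeasure) AddCircle.haarAddCircle)
    {q : UnitAddCircle → ℝ} (hq : Measurable q)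
    (hqψ : ∀ b, ∀ x ∈ Ioo (0 : ℝ) 1, q (ψ (b, x)) = x)
    {τ : Fin d → UnitAddCircle → ℂ} (hτ : ∀ i, Measurable (τ i))
    {σ : Fin d → Bool → ℂ} (hσ : ∀ i b, ‖σ i b‖ = 1)
    (hτψ : ∀ i b, ∀ x ∈ Ioo (0 : ℝ) 1, τ i (ψ (b, x)) = σ i b)
    {f : (Fin d → ℝ) → ℂ} (hf : MemLp f 2 (boxMeasure d)) :
    HasSum (fun n : Fin d → ℤ => ‖∫ x, f x * ∏ i, (2⁻¹ * (fourier (-n i) (ψ (true, x i)) * σ i true +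
        fourier (-n i) (ψ (false, x i)) * σ i false)) ∂boxMeasure d‖ ^ 2)
      (∫ x, ‖f x‖ ^ 2 ∂boxMeasure d) := by
  have hqm : MeasurePreserving q AddCircle.haarAddCircle unitMeasure := by
    refine ⟨hq, ?_⟩
    rw [← hψ.map_eq, Measure.map_map hq hψ.measurable]
    refine Eq.trans (Measure.map_congr ?_)
      (measurePreserving_snd (μ := boolMeasure 2⁻¹) (ν := unitMeasure)).map_eq
    have h : ∀ᵐ y ∂unitMeasure, y ∈ Ioo (0 : ℝ) 1 := by
      rw [unitMeasure, ← Measure.restrict_congr_set Ioo_ae_eq_Ioc]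
      exact ae_restrict_mem measurableSet_Ioo
    filter_upwards [(Measure.quasiMeasurePreserving_snd (μ := boolMeasure 2⁻¹)).ae h] with y hy
    exact hqψ y.1 y.2 hy
  have hqd := measurePreserving_pi (fun _ : Fin d => AddCircle.haarAddCircle)
    (fun _ => unitMeasure) fun _ => hqm
  have hfq := hf.comp_measurePreserving hqd
  -- `F` is `f` pulled back to the torus and multiplied by unimodular constants on the sheets. It
  -- has the same square norm as `f`, and its Fourier coefficients integrate `f` against averages
  -- over the sheets.
  let F : (Fin d → UnitAddCircle) → ℂ := fun t => (∏ i, τ i (t i)) * f fun i => q (t i)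
  have hτm : Measurable fun t : Fin d → UnitAddCircle => ∏ i, τ i (t i) := by
    fun_prop
  have hnorm : ∀ᵐ t ∂(Measure.pi fun _ : Fin d => AddCircle.haarAddCircle),
      ‖∏ i, τ i (t i)‖ = 1 := by
    rw [← (measurePreserving_fold d hψ).map_eq,
      ae_map_iff (measurePreserving_fold d hψ).measurable.aemeasurable
        (measurableSet_eq_fun hτm.norm measurable_const)]
    filter_upwards [(Measure.quasiMeasurePreserving_snd
      (μ := Measure.pi fun _ : Fin d => boolMeasure 2⁻¹)).ae (ae_boxMeasure_mem_Ioo d)] with y hy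
    rw [norm_prod]
    exact Finset.prod_eq_one fun i _ => by rw [hτψ i _ _ (hy i), hσ]
  have hF2 : ∀ᵐ t ∂(Measure.pi fun _ : Fin d => AddCircle.haarAddCircle),
      ‖F t‖ = ‖f fun i => q (t i)‖ := by
    filter_upwards [hnorm] with t ht
    rw [norm_mul, ht, one_mul]
  have hF : MemLp F 2 (Measure.pi fun _ => AddCircle.haarAddCircle) :=
    hfq.of_le (hτm.aestronglyMeasurable.mul hfq.aestronglyMeasurable)
      (hF2.mono fun t ht => ht.le)
  have key := hasSum_sq_integral_mFourier hF
  have hI : ∫ t, ‖F t‖ ^ 2 ∂(Measure.pi fun _ => AddCircle.haarAddCircle) =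
      ∫ x, ‖f x‖ ^ 2 ∂boxMeasure d := by
    have h1 := integral_map hqd.measurable.aemeasurable (f := fun x => ‖f x‖ ^ 2)
      (by rw [hqd.map_eq]; exact hf.aestronglyMeasurable.norm.pow 2)
    rw [hqd.map_eq] at h1
    rw [h1]
    exact integral_congr_ae (hF2.mono fun t ht => by simp only [ht])
  rw [hI] at key
  refine hasSum_of_eq (fun n => ?_) key
  congr 2
  rw [integral_pi_eq_integral_boxMeasure (d := d) hψ (h := f)
    (w := fun i b x => fourier (-n i) (ψ (b, x)) * σ i b)]
  · simp
  · have hm : Continuous fun t : Fin d → UnitAddCircle => ∏ i, fourier (-n i) (t i) := by fun_prop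
    refine (hF.integrable (by norm_num)).bdd_mul (c := 1) hm.aestronglyMeasurable
      (ae_of_all _ fun t => ?_)
    rw [norm_prod]
    exact (Finset.prod_eq_one fun i _ => by rw [fourier_apply]; exact Circle.norm_coe _).le
  · intro x hx b
    have h1 : (fun i => q (ψ (b i, x i))) = x := funext fun i => hqψ _ _ (hx i)
    simp only [F, h1, Finset.prod_mul_distrib, fun i => hτψ i (b i) (x i) (hx i)]
    ring

/-! ### Product test functions -/

section ProductTest

variable {d : ℕ} {w : Fin d → ℝ → ℂ}

lemma contDiff_prod_coord (hw : ∀ j, ContDiff ℝ ∞ (w j)) :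
    ContDiff ℝ ∞ fun x : Space d => ∏ j, w j (x j) :=
  contDiff_prod fun j _ => (hw j).comp (EuclideanSpace.proj (𝕜 := ℝ) j).contDiff

lemma isTest_prod_coord (hw : ∀ j, ContDiff ℝ ∞ (w j)) {K : Fin d → Set ℝ}
    (hK : ∀ j, IsCompact (K j)) (hwK : ∀ j, ∀ x, x ∉ K j → w j x = 0) {U : Set (Space d)}
    (hU : ∀ x : Space d, (∀ j, x j ∈ K j) → x ∈ U) :
    IsTest U fun x : Space d => ∏ j, w j (x j) := by
  have hC : IsCompact {x : Space d | ∀ j, x j ∈ K j} := by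
    have h1 := (isCompact_univ_pi hK).image (PiLp.continuous_toLp 2 fun _ : Fin d => ℝ)
    convert h1 using 1
    ext x
    constructor
    · exact fun hx => ⟨x.ofLp, fun j _ => hx j, rfl⟩
    · rintro ⟨y, hy, rfl⟩ j
      exact hy j (mem_univ j)
  have hS : Function.support (fun x : Space d => ∏ j, w j (x j)) ⊆ {x : Space d | ∀ j, x j ∈ K j} :=
    fun x hx j => by
      by_contra h
      exact hx (Finset.prod_eq_zero (Finset.mem_univ j) (hwK j _ h))
  exact ⟨contDiff_prod_coord hw, HasCompactSupport.of_support_subset_isCompact hC hS,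
    (closure_minimal hS hC.isClosed).trans fun x hx => hU x hx⟩

lemma grad_prod_coord (hw : ∀ j, ContDiff ℝ ∞ (w j)) (x : Space d) (i : Fin d) :
    grad (fun x : Space d => ∏ j, w j (x j)) x i =
      ∏ j, (if j = i then deriv (w j) else w j) (x j) := by
  have hd : DifferentiableAt ℝ (fun x : Space d => ∏ j, w j (x j)) x :=
    (contDiff_prod_coord hw).differentiable (by simp) x
  change fderiv ℝ (fun x : Space d => ∏ j, w j (x j)) x (EuclideanSpace.single i 1) = _
  rw [← hd.lineDeriv_eq_fderiv]
  have hf : (fun t : ℝ => ∏ j, w j ((x + t • EuclideanSpace.single i (1 : ℝ)) j)) =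
      fun t : ℝ => w i (x i + t) * ∏ j ∈ Finset.univ.erase i, w j (x j) := by
    ext t
    rw [← Finset.mul_prod_erase _ _ (Finset.mem_univ i)]
    congr 1
    · simp
    · refine Finset.prod_congr rfl fun j hj => ?_
      simp [Finset.ne_of_mem_erase hj]
  have hwi : DifferentiableAt ℝ (w i) (x i + 0) := (hw i).differentiable (by simp) _
  have hder : HasDerivAt (fun t : ℝ => w i (x i + t) * ∏ j ∈ Finset.univ.erase i, w j (x j))
      (deriv (w i) (x i + 0) * ∏ j ∈ Finset.univ.erase i, w j (x j)) 0 :=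
    (hwi.hasDerivAt.comp_const_add (x i) 0).mul_const _
  rw [lineDeriv, hf, hder.deriv, ← Finset.mul_prod_erase _ _ (Finset.mem_univ i), if_pos rfl,
    add_zero]
  congr 1
  exact Finset.prod_congr rfl fun j hj => by rw [if_neg (Finset.ne_of_mem_erase hj)]

end ProductTest

/-! ### Square norms through coordinates -/

section Norms

variable {d : ℕ}

lemma norm_sq_eq_integral {F : Type*} [NormedAddCommGroup F] [InnerProductSpace ℂ F]
    (f : Lp F 2 (cellMeasure d)) : ‖f‖ ^ 2 = ∫ x, ‖f x‖ ^ 2 ∂cellMeasure d := by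
  have h1 : (⟪f, f⟫_ℂ) = ((∫ x, ‖f x‖ ^ 2 ∂cellMeasure d : ℝ) : ℂ) := by
    rw [L2.inner_def, ← integral_complex_ofReal]
    refine integral_congr_ae (ae_of_all _ fun x => ?_)
    simp only [inner_self_eq_norm_sq_to_K]
    norm_cast
  rw [inner_self_eq_norm_sq_to_K] at h1
  exact Complex.ofReal_injective ((Complex.ofReal_pow _ _).trans h1)

lemma memLp_toLp {F : Type*} [NormedAddCommGroup F] (f : Lp F 2 (cellMeasure d)) :
    MemLp (fun x => f (WithLp.toLp 2 x)) 2 (boxMeasure d) :=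
  (Lp.memLp f).comp_measurePreserving (measurePreserving_toLp_cell d)

lemma memLp_toLp_apply (g : L2Field d) (i : Fin d) :
    MemLp (fun x => g (WithLp.toLp 2 x) i) 2 (boxMeasure d) :=
  (EuclideanSpace.proj (𝕜 := ℂ) i).comp_memLp' (memLp_toLp g)

lemma norm_sq_eq_integral_box (u : L2 d) :
    ‖u‖ ^ 2 = ∫ x, ‖u (WithLp.toLp 2 x)‖ ^ 2 ∂boxMeasure d := by
  rw [norm_sq_eq_integral, integral_cellMeasure_eq]

lemma norm_sq_eq_sum_integral_box (g : L2Field d) :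
    ‖g‖ ^ 2 = ∑ i, ∫ x, ‖g (WithLp.toLp 2 x) i‖ ^ 2 ∂boxMeasure d := by
  rw [norm_sq_eq_integral, integral_cellMeasure_eq,
    ← integral_finsetSum _ fun i _ => (memLp_toLp_apply g i).integrable_norm_pow (by norm_num)]
  simp only [EuclideanSpace.norm_sq_eq]

/-- If `(aₙ)` and `(λᵢₙ aₙ)` are the squared Fourier coefficients of a function and of the
components of its gradient, a lower bound for `∑ᵢ λᵢₙ` gives a Poincaré inequality. -/
lemma mul_norm_sq_le_of_hasSum {p : L2 d × L2Field d} {ι : Type*} {a : ι → ℝ} {l : Fin d → ι → ℝ}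
    {Λ : ℝ} (ha : ∀ n, 0 ≤ a n)
    (h1 : HasSum a (∫ x, ‖p.1 (WithLp.toLp 2 x)‖ ^ 2 ∂boxMeasure d))
    (h2 : ∀ i, HasSum (fun n => l i n * a n) (∫ x, ‖p.2 (WithLp.toLp 2 x) i‖ ^ 2 ∂boxMeasure d))
    (hl : ∀ n, a n ≠ 0 → Λ ≤ ∑ i, l i n) : Λ * ‖p.1‖ ^ 2 ≤ ‖p.2‖ ^ 2 := by
  rw [norm_sq_eq_integral_box, norm_sq_eq_sum_integral_box]
  refine hasSum_le (fun n => ?_) (h1.mul_left Λ) (hasSum_sum fun i _ => h2 i)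
  rw [← Finset.sum_mul]
  by_cases hn : a n = 0
  · simp [hn]
  · exact mul_le_mul_of_nonneg_right (hl n hn) (ha n)

end Norms

/-! ### The Poincaré inequality for quasi-periodic functions -/

/-- The conjugate `e^{-i ξ ⬝ x}` of a plane wave. -/
def planeWave {d : ℕ} (ξ : Fin d → ℝ) (x : Fin d → ℝ) : ℂ :=
  ∏ i, Complex.exp (-(Complex.I * ξ i * x i))

lemma norm_exp_neg_I_mul (a b : ℝ) : ‖Complex.exp (-(Complex.I * a * b))‖ = 1 := by
  have : -(Complex.I * a * b) = ((-(a * b) : ℝ) : ℂ) * Complex.I := by push_cast; ring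
  rw [this, Complex.norm_exp_ofReal_mul_I]

lemma norm_planeWave {d : ℕ} (ξ x : Fin d → ℝ) : ‖planeWave ξ x‖ = 1 := by
  rw [planeWave, norm_prod]
  exact Finset.prod_eq_one fun i _ => norm_exp_neg_I_mul _ _

lemma continuous_planeWave {d : ℕ} (ξ : Fin d → ℝ) : Continuous (planeWave ξ) := by
  unfold planeWave; fun_prop

lemma measurePreserving_coe_snd : MeasurePreserving (fun y : Bool × ℝ => (y.2 : UnitAddCircle))
    ((boolMeasure 2⁻¹).prod unitMeasure) AddCircle.haarAddCircle := by
  have h := UnitAddCircle.measurePreserving_mk 0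
  rw [zero_add, ← haarAddCircle_eq] at h
  exact h.comp measurePreserving_snd

/-- Multiplication by the unimodular `planeWave α` reduces this to ordinary Fourier series; the two
sheets coincide here and the folding is trivial. -/
lemma hasSum_sq_planeWave {d : ℕ} (α : Fin d → ℝ) {f : (Fin d → ℝ) → ℂ}
    (hf : MemLp f 2 (boxMeasure d)) :
    HasSum (fun n : Fin d → ℤ => ‖∫ x, f x * planeWave (fun i => 2 * Real.pi * n i + α i) x
      ∂boxMeasure d‖ ^ 2) (∫ x, ‖f x‖ ^ 2 ∂boxMeasure d) := by
  have hf' : MemLp (fun x => f x * planeWave α x) 2 (boxMeasure d) :=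
    hf.of_le (hf.aestronglyMeasurable.mul (continuous_planeWave α).aestronglyMeasurable)
      (ae_of_all _ fun x => by rw [norm_mul, norm_planeWave, mul_one])
  have h := hasSum_sq_integral_fold (d := d) (ψ := fun y => (y.2 : UnitAddCircle))
    measurePreserving_coe_snd (q := fun θ => (AddCircle.measurableEquivIoc 1 0 θ : ℝ))
    (AddCircle.measurableEquivIoc 1 0).measurable.subtype_val
    (fun b x hx => by
      have h1 : (AddCircle.measurableEquivIoc (1 : ℝ) 0).symm ⟨x, hx.1, by linarith [hx.2]⟩ =
        (x : UnitAddCircle) := rfl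
      simp only [← h1, MeasurableEquiv.apply_symm_apply])
    (τ := fun _ _ => 1) (fun _ => measurable_const) (σ := fun _ _ => 1) (by simp) (by simp) hf'
  simp only [norm_mul, norm_planeWave, mul_one] at h
  refine hasSum_of_eq (fun n => ?_) h
  congr 2
  refine integral_congr_ae (ae_of_all _ fun x => ?_)
  simp only [planeWave, mul_assoc, ← Finset.prod_mul_distrib]
  congr 1
  refine Finset.prod_congr rfl fun i _ => ?_
  rw [fourier_coe_apply, ← two_mul, inv_mul_cancel_left₀ two_ne_zero, ← Complex.exp_add]
  congr 1
  push_cast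
  ring

/-- A smooth function supported in `[0,2]` whose integer translates sum to one. -/
def unitBump (x : ℝ) : ℝ := Real.smoothTransition x - Real.smoothTransition (x - 1)

lemma contDiff_unitBump : ContDiff ℝ ∞ unitBump :=
  Real.smoothTransition.contDiff.sub
    (Real.smoothTransition.contDiff.comp (contDiff_id.sub contDiff_const))

lemma unitBump_of_nonpos {x : ℝ} (hx : x ≤ 0) : unitBump x = 0 := by
  rw [unitBump, Real.smoothTransition.zero_of_nonpos hx,
    Real.smoothTransition.zero_of_nonpos (by linarith), sub_zero]

lemma unitBump_of_two_le {x : ℝ} (hx : 2 ≤ x) : unitBump x = 0 := by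
  rw [unitBump, Real.smoothTransition.one_of_one_le (by linarith),
    Real.smoothTransition.one_of_one_le (by linarith), sub_self]

lemma unitBump_add_unitBump_add_one {x : ℝ} (hx : x ∈ Ioo (0 : ℝ) 1) :
    unitBump x + unitBump (x + 1) = 1 := by
  rw [unitBump, unitBump, Real.smoothTransition.zero_of_nonpos (x := x - 1) (by linarith [hx.2]),
    Real.smoothTransition.one_of_one_le (x := x + 1) (by linarith [hx.1]), add_sub_cancel_right]
  ring

lemma deriv_unitBump_add {x : ℝ} (hx : x ∈ Ioo (0 : ℝ) 1) :
    deriv unitBump x + deriv unitBump (x + 1) = 0 := by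
  have hd : ∀ y, HasDerivAt unitBump (deriv unitBump y) y := fun y =>
    ((contDiff_unitBump.differentiable (by simp)) y).hasDerivAt
  have h1 : HasDerivAt (fun y => unitBump y + unitBump (y + 1))
      (deriv unitBump x + deriv unitBump (x + 1)) x :=
    (hd x).add ((hd (x + 1)).comp_add_const x 1)
  have h2 : HasDerivAt (fun y => unitBump y + unitBump (y + 1)) 0 x :=
    (hasDerivAt_const x (1 : ℝ)).congr_of_eventuallyEq
      (Filter.eventually_of_mem (isOpen_Ioo.mem_nhds hx) fun y hy => unitBump_add_unitBump_add_one hy)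
  exact h1.unique h2

/-- The shift `x + 1` or `x`. -/
def shift (y : Bool × ℝ) : ℝ := y.2 + if y.1 then 1 else 0

/-- Both points of `Bool` have mass 1, since the two sheets lie side by side and cover an interval
of length 2. -/
lemma measurePreserving_shift : MeasurePreserving shift ((boolMeasure 1).prod unitMeasure)
    (volume.restrict (Ioc (0 : ℝ) 2)) := by
  have hm : Measurable shift :=
    measurable_snd.add ((measurable_from_top (f := fun b : Bool => if b then (1 : ℝ) else 0)).comp
      measurable_fst)
  refine ⟨hm, ?_⟩
  have h1 := (measurePreserving_add_right (volume : Measure ℝ) 1).restrict_preimage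
    (measurableSet_Ioc (a := (1 : ℝ)) (b := 2))
  have h2 : (fun x : ℝ => x + 1) ⁻¹' Ioc 1 2 = Ioc 0 1 := by
    rw [Set.preimage_add_const_Ioc]; norm_num
  rw [h2] at h1
  have h3 : (fun x => shift (true, x)) = fun x => x + 1 := by ext x; simp [shift]
  have h4 : (fun x => shift (false, x)) = id := by ext x; simp [shift]
  rw [map_boolMeasure_prod 1 hm, one_smul, h3, h4, h1.map_eq, Measure.map_id, add_comm,
    ← Measure.restrict_union (by
      rw [Set.disjoint_left]; intro x h h'; exact absurd h.2 h'.1.not_ge) measurableSet_Ioc,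
    Ioc_union_Ioc_eq_Ioc zero_le_one one_le_two]

section Bloch

variable {d : ℕ} (α : Space d)

lemma qpExt_shift (v : Space d → ℂ) {x : Fin d → ℝ} (hx : ∀ i, x i ∈ Ioo (0 : ℝ) 1)
    (b : Fin d → Bool) :
    qpExt α v (WithLp.toLp 2 fun i => shift (b i, x i)) =
      v (WithLp.toLp 2 x) * ∏ i, Complex.exp (Complex.I * α i * if b i then 1 else 0) := by
  have h1 : (WithLp.toLp 2 fun i => shift (b i, x i)) -
      WithLp.toLp 2 (fun i => ((if b i then 1 else 0 : ℤ) : ℝ)) = (WithLp.toLp 2 x : Space d) := by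
    ext i
    simp only [PiLp.sub_apply, shift]
    split_ifs <;> simp
  have h2 : (WithLp.toLp 2 x : Space d) ∈ cell d := fun i => ⟨(hx i).1, (hx i).2.le⟩
  have h3 := latticePart_eq (h1 ▸ h2)
  rw [qpExt, h3, h1, smul_eq_mul, mul_comm, ← Complex.exp_sum]
  congr 2
  push_cast
  rw [Finset.mul_sum]
  refine Finset.sum_congr rfl fun i _ => ?_
  split_ifs <;> simp

/-- Integration of a quasi-periodic function against a product supported in `(0,2]^d`. -/
lemma integral_qpExt_mul_prod {v : Space d → ℂ} (hv : Integrable v (cellMeasure d))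
    {W V : Fin d → ℝ → ℂ} (hW : ∀ j, Continuous (W j)) (hW0 : ∀ j x, x ∉ Ioc (0 : ℝ) 2 → W j x = 0)
    (hV : ∀ j, ∀ x ∈ Ioo (0 : ℝ) 1,
      Complex.exp (Complex.I * α j) * W j (x + 1) + W j x = V j x) :
    ∫ x, qpExt α v x * ∏ j, W j (x j) = ∫ x, v (WithLp.toLp 2 x) * ∏ j, V j (x j) ∂boxMeasure d := by
  let G : Space d → ℂ := fun x => qpExt α v x * ∏ j, W j (x j)
  have hcont : Continuous fun x : Space d => ∏ j, W j (x j) :=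
    continuous_finsetProd _ fun j _ => (hW j).comp (EuclideanSpace.proj (𝕜 := ℝ) j).continuous
  have hcs : HasCompactSupport fun x : Space d => ∏ j, W j (x j) := by
    refine HasCompactSupport.intro (K := WithLp.toLp 2 '' univ.pi fun _ => Icc (0 : ℝ) 2)
      ((isCompact_univ_pi fun _ => isCompact_Icc).image
        (PiLp.continuous_toLp 2 fun _ : Fin d => ℝ)) fun x hx => ?_
    have h1 : ∃ j, x j ∉ Icc (0 : ℝ) 2 := by
      by_contra! h
      exact hx ⟨x.ofLp, fun j _ => h j, rfl⟩
    obtain ⟨j, hj⟩ := h1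
    exact Finset.prod_eq_zero (Finset.mem_univ j) (hW0 j _ fun h => hj (Ioc_subset_Icc_self h))
  have hG : Integrable G :=
    (qpExt_locallyIntegrable α hv).integrable_smul_right_of_hasCompactSupport hcont hcs
  have hmp := PiLp.volume_preserving_toLp (Fin d)
  have hemb := (MeasurableEquiv.toLp 2 (Fin d → ℝ)).measurableEmbedding
  have hG' : Integrable (fun x => G (WithLp.toLp 2 x)) (volume : Measure (Fin d → ℝ)) :=
    (hmp.integrable_comp_emb hemb).2 hG
  have hzero : ∀ x : Fin d → ℝ, x ∉ univ.pi (fun _ => Ioc (0 : ℝ) 2) → G (WithLp.toLp 2 x) = 0 := by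
    intro x hx
    rw [mem_univ_pi, not_forall] at hx
    obtain ⟨j, hj⟩ := hx
    change _ * _ = _
    rw [Finset.prod_eq_zero (Finset.mem_univ j) (hW0 j _ hj), mul_zero]
  rw [show ∫ x, qpExt α v x * ∏ j, W j (x j) = ∫ x, G x from rfl, ← hmp.integral_comp hemb G,
    ← setIntegral_eq_integral_of_forall_compl_eq_zero hzero, volume_pi, Measure.restrict_pi_pi]
  have hG'' : Integrable (fun x => G (WithLp.toLp 2 x))
      (Measure.pi fun _ : Fin d => volume.restrict (Ioc (0 : ℝ) 2)) := by
    rw [← Measure.restrict_pi_pi, ← volume_pi]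
    exact hG'.restrict
  rw [integral_pi_eq_integral_boxMeasure (d := d) measurePreserving_shift hG''
    (h := fun x => v (WithLp.toLp 2 x))
    (w := fun j b x => Complex.exp (Complex.I * α j * if b then 1 else 0) * W j (shift (b, x)))]
  · refine integral_congr_ae ?_
    filter_upwards [ae_boxMeasure_mem_Ioo d] with x hx
    congr 1
    refine Finset.prod_congr rfl fun j _ => ?_
    rw [← hV j _ (hx j)]
    simp [shift]
  · intro x hx b
    change qpExt α v _ * _ = _
    rw [qpExt_shift α v hx b, mul_assoc, ← Finset.prod_mul_distrib]

/-- The Fourier coefficients of the weak gradient of a quasi-periodic function. -/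
lemma integral_grad_planeWave {p : L2 d × L2Field d} (hp : p ∈ blochH1 α) (n : Fin d → ℤ)
    (i : Fin d) :
    ∫ x, p.2 (WithLp.toLp 2 x) i * planeWave (fun i => 2 * Real.pi * n i + α i) x ∂boxMeasure d =
      Complex.I * (2 * Real.pi * n i + α i : ℝ) *
        ∫ x, p.1 (WithLp.toLp 2 x) * planeWave (fun i => 2 * Real.pi * n i + α i) x
          ∂boxMeasure d := by
  set ξ : Fin d → ℝ := fun i => 2 * Real.pi * n i + α i with hξ
  let e : Fin d → ℝ → ℂ := fun j x => Complex.exp (-(Complex.I * ξ j * x))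
  let w : Fin d → ℝ → ℂ := fun j x => (unitBump x : ℂ) * e j x
  -- The quasi-periodicity factor cancels against the conjugate wave because `ξ j - α j` is a
  -- multiple of `2π`.
  have he1 : ∀ j x, Complex.exp (Complex.I * α j) * e j (x + 1) = e j x := fun j x => by
    have h1 : Complex.I * α j + -(Complex.I * ξ j * (x + 1 : ℝ)) =
        -(Complex.I * ξ j * x) - n j * (2 * Real.pi * Complex.I) := by
      rw [hξ]; push_cast; ring
    rw [← Complex.exp_add, h1, Complex.exp_sub, Complex.exp_int_mul_two_pi_mul_I, div_one]
  have hde : ∀ j x, HasDerivAt (e j) (-(Complex.I * ξ j) * e j x) x := fun j x => by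
    have h1 : HasDerivAt (fun x : ℝ => -(Complex.I * ξ j * x)) (-(Complex.I * ξ j)) x := by
      simpa using ((Complex.ofRealCLM.hasDerivAt (x := x)).const_mul (Complex.I * ξ j)).fun_neg
    rw [mul_comm]
    exact h1.cexp
  have hdb : ∀ x, HasDerivAt (fun x => (unitBump x : ℂ)) (deriv unitBump x : ℝ) x := fun x =>
    ((contDiff_unitBump.differentiable (by simp)) x).hasDerivAt.ofReal_comp
  have hdw : ∀ j, deriv (w j) = fun x => ((deriv unitBump x : ℝ) : ℂ) * e j x +
      (unitBump x : ℂ) * (-(Complex.I * ξ j) * e j x) := fun j =>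
    funext fun x => ((hdb x).mul (hde j x)).deriv
  have hwd : ∀ j, ContDiff ℝ ∞ (w j) := fun j => by
    have h1 : ContDiff ℝ ∞ (e j) := by
      refine ContDiff.cexp ?_
      exact (contDiff_const.mul Complex.ofRealCLM.contDiff).neg
    exact (Complex.ofRealCLM.contDiff.comp contDiff_unitBump).mul h1
  have hw0 : ∀ j x, x ∉ Ioo (0 : ℝ) 2 → w j x = 0 := fun j x hx => by
    have : unitBump x = 0 := by
      rw [mem_Ioo, not_and_or, not_lt, not_lt] at hx
      exact hx.elim unitBump_of_nonpos unitBump_of_two_le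
    simp [w, this]
  have hdw0 : ∀ j x, x ∉ Ioc (0 : ℝ) 2 → deriv (w j) x = 0 := fun j x hx => by
    have hc : ∀ᶠ y in nhdsWithin x (Iic 0 ∪ Ioi 2), w j y = 0 := by
      filter_upwards [self_mem_nhdsWithin] with y hy
      exact hw0 j y fun h => hy.elim (fun h' => absurd h.1 (not_lt.2 h'))
        fun h' => absurd h.2 (not_lt.2 (le_of_lt h'))
    have hx' : x ∈ Iic (0 : ℝ) ∪ Ioi 2 := by
      rw [mem_Ioc, not_and_or, not_lt, not_le] at hx
      exact hx
    -- At the end point 0 the function vanishes only on the left, so the derivative is computed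
    -- within a set.
    have hu : UniqueDiffWithinAt ℝ (Iic (0 : ℝ) ∪ Ioi 2) x := by
      rcases hx' with h | h
      · exact ((uniqueDiffOn_Iic 0) x h).mono subset_union_left
      · exact ((isOpen_Ioi.uniqueDiffOn) x h).mono subset_union_right
    have hdd := ((hwd j).differentiable (by simp) x)
    rw [← hdd.derivWithin hu, Filter.EventuallyEq.derivWithin_eq (f := fun _ => (0 : ℂ)) hc
      (hw0 j x fun h => hx ⟨h.1, h.2.le⟩)]
    simp
  have htest : IsTest univ fun x : Space d => ∏ j, w j (x j) :=
    isTest_prod_coord hwd (K := fun _ => Icc 0 2) (fun _ => isCompact_Icc)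
      (fun j x hx => hw0 j x fun h => hx (Ioo_subset_Icc_self h)) fun x _ => mem_univ x
  have key := hp _ htest i
  simp only [Measure.restrict_univ, grad_prod_coord hwd] at key
  rw [integral_qpExt_mul_prod α (integrable_coe p.1)
    (W := fun j => if j = i then deriv (w j) else w j)
    (V := fun j x => (if j = i then -(Complex.I * ξ i) else 1) * e j x)] at key
  · rw [show (fun x => qpExt α (p.2 : Space d → CVec d) x i * ∏ j, w j (x j)) =
      fun x => qpExt α (fun x => p.2 x i) x * ∏ j, w j (x j) from rfl,
      integral_qpExt_mul_prod α (v := fun x => p.2 x i) ((EuclideanSpace.proj (𝕜 := ℂ) i).integrable_comp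
        (integrable_coe p.2)) (W := w) (V := e) (fun j => (hwd j).continuous)
        (fun j x hx => hw0 j x fun h => hx (Ioo_subset_Ioc_self h))] at key
    · have h1 : ∀ x : Fin d → ℝ, ∏ j, (if j = i then -(Complex.I * ξ i) else 1) * e j (x j) =
          -(Complex.I * ξ i) * planeWave ξ x := fun x => by
        rw [Finset.prod_mul_distrib, Finset.prod_ite_eq' Finset.univ i fun _ => -(Complex.I * ξ i),
          if_pos (Finset.mem_univ i)]
        rfl
      simp only [h1] at key
      have h2 : ∀ x : Fin d → ℝ, p.1 (WithLp.toLp 2 x) * (-(Complex.I * ξ i) * planeWave ξ x) =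
          -(Complex.I * ξ i) * (p.1 (WithLp.toLp 2 x) * planeWave ξ x) := fun x => by ring
      simp only [h2] at key
      rw [integral_const_mul, neg_mul] at key
      exact (neg_injective key).symm
    · intro j x hx
      have h1 := unitBump_add_unitBump_add_one hx
      have h2 : ((unitBump (x + 1) : ℝ) : ℂ) + (unitBump x : ℝ) = 1 := by
        rw [add_comm]; exact_mod_cast h1
      change _ * ((unitBump (x + 1) : ℂ) * e j (x + 1)) + (unitBump x : ℂ) * e j x = e j x
      rw [mul_left_comm, he1, ← add_mul, h2, one_mul]
  · intro j
    split_ifs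
    · exact (hwd j).continuous_deriv (by simp)
    · exact (hwd j).continuous
  · intro j x hx
    split_ifs
    · exact hdw0 j x hx
    · exact hw0 j x fun h => hx (Ioo_subset_Ioc_self h)
  · intro j x hx
    have h1 := unitBump_add_unitBump_add_one hx
    have h2 : ((unitBump (x + 1) : ℝ) : ℂ) + (unitBump x : ℝ) = 1 := by
      rw [add_comm]; exact_mod_cast h1
    have h3 : ((deriv unitBump (x + 1) : ℝ) : ℂ) + (deriv unitBump x : ℝ) = 0 := by
      rw [add_comm]; exact_mod_cast deriv_unitBump_add hx
    by_cases hj : j = i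
    · subst hj
      simp only [if_true, hdw]
      -- The bumps sum to 1 and their derivatives to 0, so only the derivative of the wave remains.
      linear_combination (((deriv unitBump (x + 1) : ℝ) : ℂ) - Complex.I * ξ j * unitBump (x + 1)) *
        he1 j x + e j x * h3 - Complex.I * ξ j * e j x * h2
    · simp only [if_neg hj, one_mul]
      change _ * ((unitBump (x + 1) : ℂ) * e j (x + 1)) + (unitBump x : ℂ) * e j x = e j x
      linear_combination (unitBump (x + 1) : ℂ) * he1 j x + e j x * h2

lemma bloch_poincare_aux {p : L2 d × L2Field d} (hp : p ∈ blochH1 α) {Λ : ℝ}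
    (hΛ : ∀ n : Fin d → ℤ, ∫ x, p.1 (WithLp.toLp 2 x) *
      planeWave (fun i => 2 * Real.pi * n i + α i) x ∂boxMeasure d ≠ 0 →
        Λ ≤ ∑ i, (2 * Real.pi * n i + α i) ^ 2) :
    Λ * ‖p.1‖ ^ 2 ≤ ‖p.2‖ ^ 2 := by
  refine mul_norm_sq_le_of_hasSum (l := fun i (n : Fin d → ℤ) => (2 * Real.pi * n i + α i) ^ 2)
    (fun n => sq_nonneg _) (hasSum_sq_planeWave (fun i => α i) (memLp_toLp p.1)) (fun i => ?_)
    fun n hn => hΛ n fun h0 => hn (by rw [h0]; simp)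
  refine hasSum_of_eq (fun n => ?_) (hasSum_sq_planeWave (fun i => α i) (memLp_toLp_apply p.2 i))
  rw [integral_grad_planeWave α hp, norm_mul, norm_mul, Complex.norm_I, one_mul, mul_pow,
    Complex.norm_real, Real.norm_eq_abs, sq_abs]

/-- The Poincaré inequality for `α` quasi-periodic functions. -/
lemma bloch_poincare (hα : α ∈ brillouinZone d) (p : L2 d × L2Field d) (hp : p ∈ (bloch α).pairs) :
    ‖α‖ ^ 2 * ‖p.1‖ ^ 2 ≤ ‖p.2‖ ^ 2 := by
  refine bloch_poincare_aux α hp.1 fun n _ => ?_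
  rw [EuclideanSpace.norm_sq_eq]
  refine Finset.sum_le_sum fun i _ => ?_
  rw [Real.norm_eq_abs, sq_abs]
  have h := hα i
  have hπ := Real.pi_pos
  -- The difference `(2πn + α)² - α² = 4πn (πn + α)` is nonnegative for every integer `n`, as `|α| ≤
  -- π`.
  rcases lt_trichotomy (n i) 0 with hn | hn | hn
  · have : (n i : ℝ) ≤ -1 := by exact_mod_cast Int.le_sub_one_of_lt hn
    have h1 : Real.pi * n i + α i ≤ 0 := by nlinarith [h.2]
    nlinarith [mul_nonneg_of_nonpos_of_nonpos (show (n i : ℝ) ≤ 0 by linarith) h1]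
  · simp [hn]
  · have : (1 : ℝ) ≤ n i := by exact_mod_cast hn
    have h1 : 0 ≤ Real.pi * n i + α i := by nlinarith [h.1]
    nlinarith [mul_nonneg (show (0 : ℝ) ≤ n i by linarith) h1]

lemma zeroMean_integral_eq_zero {u : L2 d} (hu : u ∈ zeroMean d) :
    ∫ x, u (WithLp.toLp 2 x) ∂boxMeasure d = 0 := by
  have h := Submodule.mem_orthogonal_singleton_iff_inner_right.1 hu
  rw [L2.inner_def] at h
  rw [← integral_cellMeasure_eq (fun x => u x), ← h]
  refine integral_congr_ae ?_
  filter_upwards [Lp.coeFn_const (p := 2) (μ := cellMeasure d) (c := (1 : ℂ))] with x hx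
  rw [hx]
  simp

/-- The Poincaré inequality for periodic functions with zero average. -/
lemma periodic_poincare (p : L2 d × L2Field d) (hp : p ∈ (periodic d).pairs) :
    4 * Real.pi ^ 2 * ‖p.1‖ ^ 2 ≤ ‖p.2‖ ^ 2 := by
  refine bloch_poincare_aux 0 hp.1 fun n hn => ?_
  -- The coefficient at `n = 0` is the average, which vanishes.
  have hn0 : ∃ i, n i ≠ 0 := by
    by_contra! h
    refine hn ?_
    rw [← zeroMean_integral_eq_zero (show p.1 ∈ zeroMean d from hp.2)]
    simp [h, planeWave]
  obtain ⟨i, hi⟩ := hn0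
  refine le_trans ?_ (Finset.single_le_sum (f := fun i => (2 * Real.pi * n i + (0 : Space d) i) ^ 2)
    (fun _ _ => sq_nonneg _) (Finset.mem_univ i))
  have h1 : (1 : ℝ) ≤ (n i : ℝ) ^ 2 := by
    have : 1 ≤ (n i) ^ 2 := Order.one_le_iff_pos.2 (by positivity)
    exact_mod_cast this
  simp only [PiLp.zero_apply, add_zero, mul_pow]
  nlinarith [Real.pi_pos, sq_nonneg Real.pi]

end Bloch

/-! ### The Poincaré inequality for the Neumann problem -/

/-- The two halves of the circle as images of the unit interval. -/
def reflect (y : Bool × ℝ) : UnitAddCircle := ((if y.1 then y.2 / 2 else -(y.2 / 2) : ℝ) : UnitAddCircle)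

lemma measurable_reflect : Measurable reflect := by
  have h : Measurable fun y : Bool × ℝ => (if y.1 then y.2 / 2 else -(y.2 / 2) : ℝ) :=
    Measurable.ite (measurable_fst (measurableSet_singleton true)) (measurable_snd.div_const 2)
      (measurable_snd.div_const 2).neg
  exact AddCircle.measurable_mk'.comp h

lemma map_mul_unitMeasure {a : ℝ} (ha : a ≠ 0) {s : Set ℝ} (hs : MeasurableSet s)
    (h : (a * ·) ⁻¹' s = Ioc 0 1) :
    unitMeasure.map (a * ·) = ENNReal.ofReal |a⁻¹| • volume.restrict s := by
  rw [unitMeasure, ← h, ← Measure.restrict_map (by fun_prop) hs, Real.map_volume_mul_left ha,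
    Measure.restrict_smul]

/-- Each half of the circle receives the unit interval compressed by 2, hence with density 2, and
the weight `2⁻¹` of its sheet compensates. -/
lemma measurePreserving_reflect : MeasurePreserving reflect
    ((boolMeasure 2⁻¹).prod unitMeasure) AddCircle.haarAddCircle := by
  refine ⟨measurable_reflect, ?_⟩
  have hmk : Measurable ((↑) : ℝ → UnitAddCircle) := AddCircle.measurable_mk'
  have h1 : unitMeasure.map (fun x => reflect (true, x)) =
      ((2 : NNReal) • volume.restrict (Ioc (0 : ℝ) (1 / 2))).map ((↑) : ℝ → UnitAddCircle) := by
    have h := map_mul_unitMeasure (a := 2⁻¹) (by norm_num) (s := Ioc (0 : ℝ) (1 / 2))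
      measurableSet_Ioc (by
        ext x
        simp only [mem_preimage, mem_Ioc]
        constructor <;> intro h <;> constructor <;> linarith [h.1, h.2])
    have h2 : (fun x => reflect (true, x)) = ((↑) : ℝ → UnitAddCircle) ∘ (2⁻¹ * ·) := by
      ext x; simp [reflect, div_eq_inv_mul]
    rw [h2, ← Measure.map_map hmk (by fun_prop), h]
    norm_num
    rfl
  have h2 : unitMeasure.map (fun x => reflect (false, x)) =
      ((2 : NNReal) • volume.restrict (Ioc (-(1 / 2) : ℝ) 0)).map ((↑) : ℝ → UnitAddCircle) := by
    have h := map_mul_unitMeasure (a := -2⁻¹) (by norm_num) (s := Ico (-(1 / 2) : ℝ) 0)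
      measurableSet_Ico (by
        ext x
        simp only [mem_preimage, mem_Ioc, mem_Ico]
        constructor <;> intro h <;> constructor <;> linarith [h.1, h.2])
    have h2 : (fun x => reflect (false, x)) = ((↑) : ℝ → UnitAddCircle) ∘ (-2⁻¹ * ·) := by
      ext x; simp [reflect, div_eq_inv_mul]
    rw [h2, ← Measure.map_map hmk (by fun_prop), h, Measure.restrict_congr_set Ico_ae_eq_Ioc]
    norm_num
    rfl
  have h3 := UnitAddCircle.measurePreserving_mk (-(1 / 2))
  rw [map_boolMeasure_prod _ measurable_reflect, h1, h2, ← Measure.map_add _ _ hmk, ← smul_add,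
    ← Measure.restrict_union (by
      rw [Set.disjoint_left]; intro x h h'; exact absurd h'.2 h.1.not_ge) measurableSet_Ioc,
    Set.union_comm, Ioc_union_Ioc_eq_Ioc (by norm_num) (by norm_num), Measure.map_smul, smul_smul,
    inv_mul_cancel₀ two_ne_zero, one_smul, haarAddCircle_eq, ← h3.map_eq]
  norm_num

lemma two_mul_norm_reflect (b : Bool) {x : ℝ} (hx : x ∈ Ioo (0 : ℝ) 1) :
    2 * ‖reflect (b, x)‖ = x := by
  have h : ∀ y : ℝ, |y| = x / 2 → ‖(y : UnitAddCircle)‖ = x / 2 := fun y hy => by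
    rw [← hy, AddCircle.norm_coe_eq_abs_iff 1 one_ne_zero, hy, abs_one]
    linarith [hx.2]
  cases b
  · have : reflect (false, x) = ((-(x / 2) : ℝ) : UnitAddCircle) := by simp [reflect]
    rw [this, h]
    · ring
    · rw [abs_neg, abs_of_pos (by linarith [hx.1])]
  · have : reflect (true, x) = ((x / 2 : ℝ) : UnitAddCircle) := by simp [reflect]
    rw [this, h]
    · ring
    · rw [abs_of_pos (by linarith [hx.1])]

lemma fourier_reflect (n : ℤ) (b : Bool) (x : ℝ) :
    fourier n (reflect (b, x)) = Complex.cos (Real.pi * n * x) +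
      (if b then 1 else -1) * Complex.sin (Real.pi * n * x) * Complex.I := by
  cases b
  · have : reflect (false, x) = ((-(x / 2) : ℝ) : UnitAddCircle) := by simp [reflect]
    have h2 : 2 * Real.pi * Complex.I * n * ((-(x / 2) : ℝ) : ℂ) / (1 : ℝ) =
        (-(Real.pi * n * x)) * Complex.I := by
      push_cast; ring
    rw [this, fourier_coe_apply, h2, Complex.exp_mul_I, Complex.cos_neg, Complex.sin_neg]
    simp
  · have : reflect (true, x) = ((x / 2 : ℝ) : UnitAddCircle) := by simp [reflect]
    have h2 : 2 * Real.pi * Complex.I * n * ((x / 2 : ℝ) : ℂ) / (1 : ℝ) =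
        (Real.pi * n * x) * Complex.I := by
      push_cast; ring
    rw [this, fourier_coe_apply, h2, Complex.exp_mul_I]
    simp

/-- The sign of the imaginary part of a point of the circle. -/
def circleSign (θ : UnitAddCircle) : ℂ := if 0 < (fourier 1 θ : ℂ).im then 1 else -1

lemma measurable_circleSign : Measurable circleSign := by
  refine Measurable.ite ?_ measurable_const measurable_const
  exact measurableSet_lt measurable_const
    (Complex.continuous_im.comp (fourier 1).continuous).measurable

/-- The sign attached to the two halves of the circle. -/
def boolSign (b : Bool) : ℂ := if b then 1 else -1

lemma circleSign_reflect (b : Bool) {x : ℝ} (hx : x ∈ Ioo (0 : ℝ) 1) :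
    circleSign (reflect (b, x)) = boolSign b := by
  have hs : 0 < Real.sin (Real.pi * x) :=
    Real.sin_pos_of_pos_of_lt_pi (mul_pos Real.pi_pos hx.1)
      (by nlinarith [Real.pi_pos, hx.2])
  have h1 : Complex.cos (Real.pi * (1 : ℤ) * x) = (Real.cos (Real.pi * x) : ℝ) := by
    push_cast; rw [mul_one]
  have h2 : Complex.sin (Real.pi * (1 : ℤ) * x) = (Real.sin (Real.pi * x) : ℝ) := by
    push_cast; rw [mul_one]
  rw [circleSign, fourier_reflect, h1, h2]
  cases b
  · have : ¬ 0 < ((Real.cos (Real.pi * x) : ℂ) +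
        (if false = true then 1 else -1) * (Real.sin (Real.pi * x) : ℝ) * Complex.I).im := by
      simp [-Complex.ofReal_sin, -Complex.ofReal_cos, hs.le]
    rw [if_neg this]; simp [boolSign]
  · have : 0 < ((Real.cos (Real.pi * x) : ℂ) +
        (if true = true then 1 else -1) * (Real.sin (Real.pi * x) : ℝ) * Complex.I).im := by
      simpa [-Complex.ofReal_sin, -Complex.ofReal_cos] using hs
    rw [if_pos this]; simp [boolSign]

/-! ### Parseval's identity for products of cosines and sines -/

section Neumann

variable {d : ℕ}

/-- The product of the functions `cos (π nⱼ xⱼ)`. -/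
def cosProd (n : Fin d → ℤ) (x : Fin d → ℝ) : ℂ := ∏ j, (Real.cos (Real.pi * n j * x j) : ℂ)

/-- The product of the functions `cos (π nⱼ xⱼ)`, with `sin` in place of `cos` for `j = i`. -/
def sinCosProd (i : Fin d) (n : Fin d → ℤ) (x : Fin d → ℝ) : ℂ :=
  ∏ j, ((if j = i then Real.sin (Real.pi * n j * x j) else Real.cos (Real.pi * n j * x j) : ℝ) : ℂ)

/-- Even reflection in every coordinate: averaging a character over the two halves leaves the
cosine. -/
lemma hasSum_sq_cosProd {f : (Fin d → ℝ) → ℂ} (hf : MemLp f 2 (boxMeasure d)) :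
    HasSum (fun n : Fin d → ℤ => ‖∫ x, f x * cosProd n x ∂boxMeasure d‖ ^ 2)
      (∫ x, ‖f x‖ ^ 2 ∂boxMeasure d) := by
  have h := hasSum_sq_integral_fold (d := d) measurePreserving_reflect (q := fun θ => 2 * ‖θ‖)
    (continuous_norm.measurable.const_mul 2) (fun b x hx => two_mul_norm_reflect b hx)
    (τ := fun _ _ => 1) (fun _ => measurable_const) (σ := fun _ _ => 1) (by simp) (by simp) hf
  refine hasSum_of_eq (fun n => ?_) h
  congr 2
  refine integral_congr_ae (ae_of_all _ fun x => ?_)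
  simp only [cosProd]
  congr 1
  refine Finset.prod_congr rfl fun j _ => ?_
  rw [fourier_reflect, fourier_reflect]
  have h1 : (Real.pi * (-n j : ℤ) * x j : ℂ) = -(Real.pi * n j * x j : ℝ) := by push_cast; ring
  rw [h1, Complex.cos_neg, Complex.ofReal_cos]
  simp
  ring

/-- Reflection is odd in coordinate `i` and even in the others, so the average leaves `-I` times a
sine there; the factor has modulus 1. -/
lemma hasSum_sq_sinCosProd (i : Fin d) {f : (Fin d → ℝ) → ℂ} (hf : MemLp f 2 (boxMeasure d)) :
    HasSum (fun n : Fin d → ℤ => ‖∫ x, f x * sinCosProd i n x ∂boxMeasure d‖ ^ 2)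
      (∫ x, ‖f x‖ ^ 2 ∂boxMeasure d) := by
  have h := hasSum_sq_integral_fold (d := d) measurePreserving_reflect (q := fun θ => 2 * ‖θ‖)
    (continuous_norm.measurable.const_mul 2) (fun b x hx => two_mul_norm_reflect b hx)
    (τ := fun j => if j = i then circleSign else fun _ => 1)
    (fun j => by split_ifs; exacts [measurable_circleSign, measurable_const])
    (σ := fun j b => if j = i then boolSign b else 1)
    (fun j b => by split_ifs <;> cases b <;> simp [boolSign])
    (fun j b x hx => by
      split_ifs
      · exact circleSign_reflect b hx
      · rfl) hf
  refine hasSum_of_eq (fun n => ?_) h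
  have h1 : ∀ (x : Fin d → ℝ) j, (2⁻¹ * (fourier (-n j) (reflect (true, x j)) *
      (if j = i then boolSign true else 1) + fourier (-n j) (reflect (false, x j)) *
      (if j = i then boolSign false else 1)) : ℂ) =
      (if j = i then -Complex.I else 1) * ((if j = i then Real.sin (Real.pi * n j * x j)
        else Real.cos (Real.pi * n j * x j) : ℝ) : ℂ) := by
    intro x j
    have h1 : (Real.pi * (-n j : ℤ) * x j : ℂ) = -(Real.pi * n j * x j : ℝ) := by
      push_cast; ring
    rw [fourier_reflect, fourier_reflect, h1, Complex.cos_neg, Complex.sin_neg]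
    by_cases hj : j = i
    · simp only [if_pos hj, boolSign, if_true, Bool.false_eq_true, if_false, Complex.ofReal_sin]
      ring
    · simp only [if_neg hj, if_true, Bool.false_eq_true, if_false, Complex.ofReal_cos]
      ring
  have h2 : ∀ x : Fin d → ℝ, f x * ∏ j, (2⁻¹ * (fourier (-n j) (reflect (true, x j)) *
      (if j = i then boolSign true else 1) + fourier (-n j) (reflect (false, x j)) *
      (if j = i then boolSign false else 1))) = -Complex.I * (f x * sinCosProd i n x) := by
    intro x
    rw [Finset.prod_congr rfl fun j _ => h1 x j, Finset.prod_mul_distrib,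
      Finset.prod_ite_eq' Finset.univ i fun _ => -Complex.I, if_pos (Finset.mem_univ i), sinCosProd]
    ring
  simp only [h2]
  rw [integral_const_mul, norm_mul, norm_neg, Complex.norm_I, one_mul]

end Neumann

/-- A smooth cutoff function equal to one on `[2/m, 1 - 2/m]` and supported in
`[1/m, 1 - 1/m]`. -/
def cutoff (m x : ℝ) : ℝ :=
  Real.smoothTransition (m * x - 1) * Real.smoothTransition (m * (1 - x) - 1)

lemma contDiff_cutoff (m : ℝ) : ContDiff ℝ ∞ (cutoff m) :=
  (Real.smoothTransition.contDiff.comp ((contDiff_const.mul contDiff_id).sub contDiff_const)).mul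
    (Real.smoothTransition.contDiff.comp
      ((contDiff_const.mul (contDiff_const.sub contDiff_id)).sub contDiff_const))

lemma abs_cutoff_le_one (m x : ℝ) : |cutoff m x| ≤ 1 := by
  rw [cutoff, abs_of_nonneg (mul_nonneg (Real.smoothTransition.nonneg _)
    (Real.smoothTransition.nonneg _))]
  exact mul_le_one₀ (Real.smoothTransition.le_one _) (Real.smoothTransition.nonneg _)
    (Real.smoothTransition.le_one _)

lemma cutoff_eq_zero {m x : ℝ} (hm : 0 < m) (hx : x ∉ Icc m⁻¹ (1 - m⁻¹)) : cutoff m x = 0 := by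
  have hmm : m * m⁻¹ = 1 := mul_inv_cancel₀ hm.ne'
  rw [mem_Icc, not_and_or, not_le, not_le] at hx
  rcases hx with h | h
  · rw [cutoff, Real.smoothTransition.zero_of_nonpos (x := m * x - 1), zero_mul]
    nlinarith
  · rw [cutoff, Real.smoothTransition.zero_of_nonpos (x := m * (1 - x) - 1), mul_zero]
    nlinarith

lemma eventually_cutoff_eq_one {x : ℝ} (hx : x ∈ Ioo (0 : ℝ) 1) :
    ∀ᶠ m : ℕ in Filter.atTop, cutoff (m + 1) =ᶠ[nhds x] fun _ => 1 := by
  have h1 : ∀ y : ℝ, 0 < y → ∀ᶠ m : ℕ in Filter.atTop, 2 < ((m : ℝ) + 1) * y := fun y hy =>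
    ((Filter.tendsto_atTop_add_const_right _ 1
      tendsto_natCast_atTop_atTop).atTop_mul_const hy).eventually_gt_atTop 2
  filter_upwards [h1 x hx.1, h1 (1 - x) (by linarith [hx.2])] with m ha hb
  have hc1 : Continuous fun y : ℝ => ((m : ℝ) + 1) * y := by fun_prop
  have hc2 : Continuous fun y : ℝ => ((m : ℝ) + 1) * (1 - y) := by fun_prop
  filter_upwards [hc1.continuousAt.eventually_const_lt ha,
    hc2.continuousAt.eventually_const_lt hb] with y hya hyb
  rw [cutoff, Real.smoothTransition.one_of_one_le (by linarith),
    Real.smoothTransition.one_of_one_le (by linarith), mul_one]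

/-- The weight `y + 1` equals `m x` at `y = m x - 1`, the argument that occurs in `cutoff`. -/
lemma exists_bound_deriv_smoothTransition :
    ∃ C, 0 ≤ C ∧ ∀ y, |deriv Real.smoothTransition y * (y + 1)| ≤ C := by
  have h0 : ∀ y, y ∉ Icc (0 : ℝ) 1 → deriv Real.smoothTransition y = 0 := fun y hy => by
    rw [mem_Icc, not_and_or, not_le, not_le] at hy
    rcases hy with h | h
    · have : Real.smoothTransition =ᶠ[nhds y] fun _ => 0 := by
        filter_upwards [isOpen_Iio.mem_nhds h] with z hz
        exact Real.smoothTransition.zero_of_nonpos (le_of_lt hz)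
      rw [this.deriv_eq, deriv_const]
    · have : Real.smoothTransition =ᶠ[nhds y] fun _ => 1 := by
        filter_upwards [isOpen_Ioi.mem_nhds h] with z hz
        exact Real.smoothTransition.one_of_one_le (le_of_lt hz)
      rw [this.deriv_eq, deriv_const]
  have hc : Continuous (deriv Real.smoothTransition) :=
    (Real.smoothTransition.contDiff (n := 1)).continuous_deriv le_rfl
  obtain ⟨C, hC⟩ := (HasCompactSupport.intro (f := fun y => deriv Real.smoothTransition y * (y + 1))
    isCompact_Icc fun y hy => by rw [h0 y hy, zero_mul]).exists_bound_of_continuous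
      (hc.mul (by fun_prop))
  exact ⟨C, (norm_nonneg _).trans (hC 0), hC⟩

lemma hasDerivAt_cutoff (m x : ℝ) : HasDerivAt (cutoff m)
    (deriv Real.smoothTransition (m * x - 1) * m * Real.smoothTransition (m * (1 - x) - 1) +
      Real.smoothTransition (m * x - 1) *
        (deriv Real.smoothTransition (m * (1 - x) - 1) * -m)) x := by
  have hd : ∀ y, HasDerivAt Real.smoothTransition (deriv Real.smoothTransition y) y := fun y =>
    ((Real.smoothTransition.contDiff (n := 1)).differentiable (by simp) y).hasDerivAt
  have h1 : HasDerivAt (fun x : ℝ => m * x - 1) m x := by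
    simpa using ((hasDerivAt_id x).const_mul m).sub_const 1
  have h2 : HasDerivAt (fun x : ℝ => m * (1 - x) - 1) (-m) x := by
    simpa using (((hasDerivAt_id x).const_sub 1).const_mul m).sub_const 1
  exact ((hd _).comp x h1).mul ((hd _).comp x h2)

/-- The cutoff of a function vanishing at the end points has derivatives bounded uniformly. -/
lemma exists_bound_deriv_cutoff_mul {f f' : ℝ → ℝ} {L : ℝ} (hL : 0 ≤ L)
    (hf : ∀ x, HasDerivAt f (f' x) x) (hf' : ∀ x, |f' x| ≤ L)
    (h0 : ∀ x ∈ Ioo (0 : ℝ) 1, |f x| ≤ L * x) (h1 : ∀ x ∈ Ioo (0 : ℝ) 1, |f x| ≤ L * (1 - x)) :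
    ∃ C, ∀ m, 0 < m → ∀ x ∈ Ioo (0 : ℝ) 1, |deriv (fun x => cutoff m x * f x) x| ≤ C := by
  obtain ⟨C, hC0, hC⟩ := exists_bound_deriv_smoothTransition
  refine ⟨C * L + C * L + L, fun m hm x hx => ?_⟩
  rw [((hasDerivAt_cutoff m x).fun_mul (hf x)).deriv, add_mul]
  have hS : ∀ y, |Real.smoothTransition y| ≤ 1 := fun y => by
    rw [abs_of_nonneg (Real.smoothTransition.nonneg y)]; exact Real.smoothTransition.le_one y
  -- The factor `m` from differentiating the cutoff is absorbed by the linear decay of `f` at the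
  -- end point: `m |f x| ≤ L (m y)`.
  have hb : ∀ y, 0 < y → |f x| ≤ L * y →
      |deriv Real.smoothTransition (m * y - 1)| * m * |f x| ≤ C * L := fun y hy hfy => by
    have h2 := hC (m * y - 1)
    rw [sub_add_cancel, abs_mul, abs_of_pos (mul_pos hm hy)] at h2
    calc |deriv Real.smoothTransition (m * y - 1)| * m * |f x|
        ≤ |deriv Real.smoothTransition (m * y - 1)| * m * (L * y) := by gcongr
      _ = |deriv Real.smoothTransition (m * y - 1)| * (m * y) * L := by ring
      _ ≤ C * L := by gcongr
  refine (abs_add_le _ _).trans (add_le_add ((abs_add_le _ _).trans (add_le_add ?_ ?_)) ?_)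
  · rw [abs_mul, abs_mul, abs_mul, abs_of_pos hm, mul_right_comm]
    exact (mul_le_of_le_one_right (by positivity) (hS _)).trans (hb x hx.1 (h0 x hx))
  · rw [abs_mul, abs_mul, abs_mul, abs_neg, abs_of_pos hm, mul_assoc]
    exact (mul_le_of_le_one_left (by positivity) (hS _)).trans
      (hb (1 - x) (by linarith [hx.2]) (h1 x hx))
  · rw [abs_mul]
    exact (mul_le_of_le_one_left (abs_nonneg _) (abs_cutoff_le_one _ _)).trans (hf' x)

/-! ### Integration by parts up to the boundary of the cell -/

section Neumann

variable {d : ℕ}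

lemma tendsto_integral_mul_prod {v : (Fin d → ℝ) → ℂ} (hv : Integrable v (boxMeasure d))
    {W : ℕ → Fin d → ℝ → ℂ} {V : Fin d → ℝ → ℂ} (hW : ∀ m j, Continuous (W m j)) {C : Fin d → ℝ}
    (hC : ∀ m j, ∀ x ∈ Ioo (0 : ℝ) 1, ‖W m j x‖ ≤ C j)
    (hV : ∀ j, ∀ x ∈ Ioo (0 : ℝ) 1, Filter.Tendsto (fun m => W m j x) Filter.atTop (nhds (V j x))) :
    Filter.Tendsto (fun m => ∫ x, v x * ∏ j, W m j (x j) ∂boxMeasure d) Filter.atTop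
      (nhds (∫ x, v x * ∏ j, V j (x j) ∂boxMeasure d)) := by
  refine tendsto_integral_of_dominated_convergence (fun x => ‖v x‖ * ∏ j, C j) (fun m => ?_)
    (hv.norm.mul_const _) (fun m => ?_) ?_
  · exact hv.aestronglyMeasurable.mul (continuous_finsetProd _ fun j _ =>
      (hW m j).comp (continuous_apply j)).aestronglyMeasurable
  · filter_upwards [ae_boxMeasure_mem_Ioo d] with x hx
    rw [norm_mul, norm_prod]
    gcongr with j _
    exact hC m j _ (hx j)
  · filter_upwards [ae_boxMeasure_mem_Ioo d] with x hx
    exact (tendsto_finsetProd _ fun j _ => hV j _ (hx j)).const_mul _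

lemma restrict_openCell (d : ℕ) : volume.restrict (openCell d) = cellMeasure d := by
  have h : ∀ᵐ x ∂cellMeasure d, x ∈ openCell d :=
    (measurePreserving_ofLp_cell d).quasiMeasurePreserving.ae (ae_boxMeasure_mem_Ioo d)
  rw [← Measure.restrict_eq_self_of_ae_mem h, Measure.restrict_restrict' (measurableSet_cell d),
    inter_eq_left.2 (openCell_subset_cell d)]

/-- The cosine coefficients of a function in `H¹(Y)` and the mixed coefficients of its weak
gradient. -/
lemma integral_grad_sinCosProd {p : L2 d × L2Field d} (hp : p ∈ neumannH1 d) (n : Fin d → ℤ)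
    (i : Fin d) :
    ∫ x, p.2 (WithLp.toLp 2 x) i * sinCosProd i n x ∂boxMeasure d =
      -(Real.pi * n i : ℝ) * ∫ x, p.1 (WithLp.toLp 2 x) * cosProd n x ∂boxMeasure d := by
  let f : Fin d → ℝ → ℝ := fun j x =>
    if j = i then Real.sin (Real.pi * n j * x) else Real.cos (Real.pi * n j * x)
  have hfc : ∀ j, ContDiff ℝ ∞ (f j) := fun j => by
    by_cases hj : j = i
    · simp only [f, if_pos hj]; fun_prop
    · simp only [f, if_neg hj]; fun_prop
  have hf1 : ∀ j x, |f j x| ≤ 1 := fun j x => by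
    simp only [f]; split_ifs; exacts [Real.abs_sin_le_one _, Real.abs_cos_le_one _]
  have hfd : ∀ x, HasDerivAt (f i) (Real.pi * n i * Real.cos (Real.pi * n i * x)) x := fun x => by
    have h1 : HasDerivAt (fun x : ℝ => Real.pi * n i * x) (Real.pi * n i) x := by
      simpa using (hasDerivAt_id x).const_mul (Real.pi * n i)
    simp only [f, if_true]
    exact h1.sin.congr_deriv (mul_comm _ _)
  -- The parameter `m + 1` is positive for every natural `m`.
  let r : ℕ → Fin d → ℝ → ℝ := fun m j x => cutoff (m + 1) x * f j x
  let w : ℕ → Fin d → ℝ → ℂ := fun m j x => (r m j x : ℂ)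
  have hr : ∀ m j, ContDiff ℝ ∞ (r m j) := fun m j => (contDiff_cutoff _).mul (hfc j)
  have hw : ∀ m j, ContDiff ℝ ∞ (w m j) := fun m j => Complex.ofRealCLM.contDiff.comp (hr m j)
  have hdw : ∀ m j x, deriv (w m j) x = ((deriv (r m j) x : ℝ) : ℂ) := fun m j x =>
    ((hr m j).differentiable (by simp) x).hasDerivAt.ofReal_comp.deriv
  have hr1 : ∀ m j x, |r m j x| ≤ 1 := fun m j x => by
    rw [abs_mul]
    exact mul_le_one₀ (abs_cutoff_le_one _ _) (abs_nonneg _) (hf1 j x)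
  have hre : ∀ j, ∀ x ∈ Ioo (0 : ℝ) 1, ∀ᶠ m : ℕ in Filter.atTop, r m j =ᶠ[nhds x] f j := by
    intro j x hx
    filter_upwards [eventually_cutoff_eq_one hx] with m hm
    filter_upwards [hm] with y hy
    simp only [r, hy, one_mul]
  -- Only the sine factor is differentiated, and it vanishes at both ends because `n i` is an
  -- integer. This makes dominated convergence possible and leaves no boundary term.
  obtain ⟨C, hC⟩ := exists_bound_deriv_cutoff_mul (f := f i) (L := |Real.pi * n i|)
    (abs_nonneg _) hfd
    (fun x => by
      rw [abs_mul]; exact mul_le_of_le_one_right (abs_nonneg _) (Real.abs_cos_le_one _))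
    (fun x hx => by
      simp only [f, if_true]
      refine Real.abs_sin_le_abs.trans ?_
      rw [abs_mul, abs_of_pos hx.1])
    (fun x hx => by
      have h1 : Real.pi * n i * x = n i * Real.pi - Real.pi * n i * (1 - x) := by ring
      simp only [f, if_true]
      rw [h1, Real.sin_int_mul_pi_sub, abs_neg, abs_mul, abs_zpow, abs_neg, abs_one, one_zpow, one_mul]
      refine Real.abs_sin_le_abs.trans ?_
      rw [abs_mul, abs_of_pos (show 0 < 1 - x by linarith [hx.2])])
  have htest : ∀ m, IsTest (openCell d) fun x : Space d => ∏ j, w m j (x j) := fun m => by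
    have hm : (0 : ℝ) < (m + 1 : ℝ)⁻¹ := by positivity
    refine isTest_prod_coord (hw m) (K := fun _ => Icc (m + 1 : ℝ)⁻¹ (1 - (m + 1 : ℝ)⁻¹))
      (fun _ => isCompact_Icc) (fun j x hx => ?_) fun x hx j => ⟨?_, ?_⟩
    · simp only [w, r]
      rw [cutoff_eq_zero (by positivity) hx, zero_mul, Complex.ofReal_zero]
    · linarith [(hx j).1]
    · linarith [(hx j).2]
  have key : ∀ m, ∫ x, p.1 (WithLp.toLp 2 x) *
      ∏ j, (if j = i then deriv (w m j) else w m j) (x j) ∂boxMeasure d =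
        -∫ x, p.2 (WithLp.toLp 2 x) i * ∏ j, w m j (x j) ∂boxMeasure d := fun m => by
    have h1 := hp _ (htest m) i
    simp only [grad_prod_coord (hw m)] at h1
    rw [restrict_openCell, integral_cellMeasure_eq, integral_cellMeasure_eq] at h1
    exact h1
  have l1 := tendsto_integral_mul_prod (d := d) (v := fun x => p.1 (WithLp.toLp 2 x))
    ((memLp_toLp p.1).integrable (by norm_num))
    (W := fun m j => if j = i then deriv (w m j) else w m j)
    (V := fun j x => (if j = i then ((Real.pi * n i : ℝ) : ℂ) else 1) *
      (Real.cos (Real.pi * n j * x) : ℂ)) (C := fun j => if j = i then C else 1)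
    (fun m j => by
      split_ifs
      · exact (hw m j).continuous_deriv (by simp)
      · exact (hw m j).continuous)
    (fun m j x hx => by
      by_cases hj : j = i
      · subst hj
        simp only [if_true, hdw, Complex.norm_real]
        exact hC _ (by positivity) x hx
      · simp only [if_neg hj, w, Complex.norm_real]
        exact hr1 m j x)
    (fun j x hx => by
      refine tendsto_const_nhds.congr' ?_
      filter_upwards [hre j x hx] with m hm
      by_cases hj : j = i
      · subst hj
        simp only [if_true, hdw]
        rw [hm.deriv_eq, (hfd x).deriv, Complex.ofReal_mul (Real.pi * n j)]
      · simp only [if_neg hj, w, one_mul]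
        rw [hm.self_of_nhds]
        simp only [f, if_neg hj])
  have l2 := tendsto_integral_mul_prod (d := d) (v := fun x => p.2 (WithLp.toLp 2 x) i)
    ((memLp_toLp_apply p.2 i).integrable (by norm_num)) (W := w) (V := fun j x => (f j x : ℂ))
    (C := fun _ => 1) (fun m j => (hw m j).continuous)
    (fun m j x _ => by
      simp only [w, Complex.norm_real]
      exact hr1 m j x)
    (fun j x hx => by
      refine tendsto_const_nhds.congr' ?_
      filter_upwards [hre j x hx] with m hm
      simp only [w]
      rw [hm.self_of_nhds])
  simp only [key] at l1
  have h := tendsto_nhds_unique l1 l2.neg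
  have h1 : ∀ x : Fin d → ℝ, p.1 (WithLp.toLp 2 x) *
      ∏ j, (if j = i then ((Real.pi * n i : ℝ) : ℂ) else 1) * (Real.cos (Real.pi * n j * x j) : ℂ) =
        ((Real.pi * n i : ℝ) : ℂ) * (p.1 (WithLp.toLp 2 x) * cosProd n x) := fun x => by
    rw [Finset.prod_mul_distrib,
      Finset.prod_ite_eq' Finset.univ i fun _ => ((Real.pi * n i : ℝ) : ℂ),
      if_pos (Finset.mem_univ i), cosProd]
    ring
  simp only [h1] at h
  rw [integral_const_mul] at h
  rw [neg_mul, h, neg_neg]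
  rfl

/-- The Poincaré inequality for functions in `H¹(Y)` with zero average. -/
lemma neumann_poincare (p : L2 d × L2Field d) (hp : p ∈ (neumann d).pairs) :
    Real.pi ^ 2 * ‖p.1‖ ^ 2 ≤ ‖p.2‖ ^ 2 := by
  refine mul_norm_sq_le_of_hasSum (l := fun i (n : Fin d → ℤ) => (Real.pi * n i) ^ 2)
    (fun n => sq_nonneg _) (hasSum_sq_cosProd (memLp_toLp p.1)) (fun i => ?_) fun n hn => ?_
  · refine hasSum_of_eq (fun n => ?_) (hasSum_sq_sinCosProd i (memLp_toLp_apply p.2 i))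
    rw [integral_grad_sinCosProd hp.1, norm_mul, mul_pow, norm_neg, Complex.norm_real,
      Real.norm_eq_abs, sq_abs]
  -- The cosine product at `n = 0` is 1, and the zero average excludes it.
  · have hn0 : ∃ i, n i ≠ 0 := by
      by_contra! h
      refine hn ?_
      have h1 := zeroMean_integral_eq_zero (show p.1 ∈ zeroMean d from hp.2)
      simp [h, cosProd, h1]
    obtain ⟨i, hi⟩ := hn0
    refine le_trans ?_ (Finset.single_le_sum (f := fun i => (Real.pi * n i) ^ 2)
      (fun _ _ => sq_nonneg _) (Finset.mem_univ i))
    have h1 : (1 : ℝ) ≤ (n i : ℝ) ^ 2 := by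
      have : 1 ≤ (n i) ^ 2 := Order.one_le_iff_pos.2 (by positivity)
      exact_mod_cast this
    rw [mul_pow]
    nlinarith [sq_nonneg Real.pi]

end Neumann

end HighContrast

end

/-! ### The three eigenvalue problems -/

open HighContrast
theorem mainTheorem7 (d : ℕ) (hd : d = 2 ∨ d = 3) (D : Set (Space d)) (hD : IsInclusionDomain D) :
    (∀ α ∈ brillouinZone d, α ≠ 0 → ∀ (γ : ℝ → ℂ) (β₀ : ℂ) (μs : ℝ),
      Separates γ (spectrum ℂ ((bloch α).A D 0)) β₀ →
      -1 / 2 < μs → μs < 1 / 2 → (∀ μ : ℝ, (bloch α).IsResonance D μ → μs ≤ μ) →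
      ∀ dhat r : ℝ, dhat = contourDist γ (spectrum ℂ ((bloch α).A D 0)) →
      r = rStar (‖α‖ ^ 2) dhat μs →
      ∀ z : ℝ, |z| < r → ∀ (φ : (bloch α).base) (β : ℂ),
      ‖φ‖ = 1 → (bloch α).A D z φ = β • φ → windingNumber γ β ≠ 0 → ∀ p : ℕ,
        ‖β - ∑ n ∈ Finset.range (p + 1), (z : ℂ) ^ n * eigCoeff (bloch α) D γ β₀ z φ n‖ ≤
          dhat * |z| ^ (p + 1) / (r ^ p * (r - |z|))) ∧
    (∀ (γ : ℝ → ℂ) (β₀ : ℂ) (μs : ℝ),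
      Separates γ (spectrum ℂ ((periodic d).A D 0)) β₀ →
      -1 / 2 < μs → μs < 1 / 2 → (∀ μ : ℝ, (periodic d).IsResonance D μ → μs ≤ μ) →
      ∀ dhat r : ℝ, dhat = contourDist γ (spectrum ℂ ((periodic d).A D 0)) →
      r = rStar (4 * Real.pi ^ 2) dhat μs →
      ∀ z : ℝ, |z| < r → ∀ (φ : (periodic d).base) (β : ℂ),
      ‖φ‖ = 1 → (periodic d).A D z φ = β • φ → windingNumber γ β ≠ 0 → ∀ p : ℕ,
        ‖β - ∑ n ∈ Finset.range (p + 1), (z : ℂ) ^ n * eigCoeff (periodic d) D γ β₀ z φ n‖ ≤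
          dhat * |z| ^ (p + 1) / (r ^ p * (r - |z|))) ∧
    (∀ (γ : ℝ → ℂ) (β₀ : ℂ) (μs : ℝ),
      Separates γ (spectrum ℂ ((neumann d).A D 0)) β₀ →
      -1 / 2 < μs → μs < 1 / 2 → (∀ μ : ℝ, (neumann d).IsResonance D μ → μs ≤ μ) →
      ∀ dhat r : ℝ, dhat = contourDist γ (spectrum ℂ ((neumann d).A D 0)) →
      r = rStar (Real.pi ^ 2) dhat μs →
      ∀ z : ℝ, |z| < r → ∀ (φ : (neumann d).base) (β : ℂ),
      ‖φ‖ = 1 → (neumann d).A D z φ = β • φ → windingNumber γ β ≠ 0 → ∀ p : ℕ,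
        ‖β - ∑ n ∈ Finset.range (p + 1), (z : ℂ) ^ n * eigCoeff (neumann d) D γ β₀ z φ n‖ ≤
          dhat * |z| ^ (p + 1) / (r ^ p * (r - |z|))) := by
  refine ⟨fun α hα hα0 γ β₀ μs hγ hμ1 hμ2 hμ dhat r hd' hr z hz φ β hφ hβ hw p => ?_,
    fun γ β₀ μs hγ hμ1 hμ2 hμ dhat r hd' hr z hz φ β hφ hβ hw p => ?_,
    fun γ β₀ μs hγ hμ1 hμ2 hμ dhat r hd' hr z hz φ β hφ hβ hw p => ?_⟩
  · exact (bloch α).norm_eigenvalue_sub_le D (by have := norm_pos_iff.2 hα0; positivity)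
      (bloch_poincare α hα) γ β₀ μs hγ hμ1 hμ2 hμ dhat r hd' hr z hz φ β hφ hβ hw p
  · exact (periodic d).norm_eigenvalue_sub_le D (by positivity) periodic_poincare γ β₀ μs hγ hμ1
      hμ2 hμ dhat r hd' hr z hz φ β hφ hβ hw p
  · exact (neumann d).norm_eigenvalue_sub_le D (by positivity) neumann_poincare γ β₀ μs hγ hμ1
      hμ2 hμ dhat r hd' hr z hz φ β hφ hβ hw p
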